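/- Let $n\ge 1$, $K>0$, $r\ge 0$, and let $\sigma_i\ge 0$, $q_i\ge 0$ ($1\le i\le n$) be volatilities and continuous dividend rates. On a probability space with risk-neutral measure $\mathbb P$ let $W=(W_1,\dots,W_n)$ be jointly Gaussian standard Wiener processes with $\operatorname{Cov}(W_i(s),W_j(t))=\rho_{ij}\min(s,t)$. Put $\mu_i=r-q_i-\sigma_i^2/2$, $\Sigma=(\rho_{ij}\sigma_i\sigma_j)_{i,j}$, and let $X_t=(\mu_i t+\sigma_iW_i(t))_i$ be the corresponding Brownian motion with drift. For $0\le t\le T$ and $S\in(0,\infty)^n$ let $$V_E^P(S,t)=e^{-r(T-t)}\,\mathbb E\big[\theta\big(S_1e^{X_{T,1}-X_{t,1}},\dots,S_ne^{X_{T,n}-X_{t,n}}\big)\big],\qquad \theta(S)=\Big(K-\sum_{i=1}^n S_i\Big)^+,$$ be the price of the European basket put with exercise price $K$ and maturity $T$ on the $n$ correlated geometric Brownian motions with current prices $S$. Then the following hold. 1. For all $w\in\mathbb C^n$ with $\Re(w_j)>0$ for every $j$, the Mellin transform $\hat\theta(w)=\int_{(0,\infty)^n}\theta(x)\prod_j x_j^{w_j-1}\,dx$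 converges absolutely and $$\hat\theta(w)=\frac{\beta_n(w)\,K^{1+\sum_j w_j}}{\big(\sum_j w_j\big)\big(\sum_j w_j+1\big)},\qquad \beta_n(w)=\frac{\prod_{j}\Gamma(w_j)}{\Gamma\big(\sum_j w_j\big)}.$$ 2. For all $u\in\mathbb C^n$ and $t\ge0$ the variable $e^{iu'X_t}$ is integrable, and the characteristic function $\Phi(u,t)=\mathbb E[e^{iu'X_t}]$ equals $e^{-t\Psi(u)}$ with $\Psi(u)=\tfrac12u'\Sigma u-i\mu'u$. 3. For all $0\le t\le T$, $S\in(0,\infty)^n$ and $a\in(0,\infty)^n$, $$V_E^P(S,t)=e^{-r(T-t)}\,\mathcal M^{-1}\big\{\hat\theta(w)\,\Phi(wi,T-t)\big\}(S),$$ where $$\mathcal M^{-1}\{F(w)\}(S)=(2\pi i)^{-n}\int_{\Re w=a}F(w)\prod_jS_j^{-w_j}\,dw=\lim_{R_1,\dots,R_n\to\infty}(2\pi)^{-n}\int_{\prod_j[-R_j,R_j]}F(a+ib)\prod_jS_j^{-(a_j+ib_j)}\,db ,$$ and this limit exists. If $t<T$ and $\Sigma$ is positive definite, the integral over $\mathbb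 R^n$ converges absolutely. 4. The same formula holds for the price obtained from the generalized Black–Scholes problem: if $V$ is continuous on $[0,\infty)^n\times[0,T]$, is twice continuously differentiable in $S$ and differentiable in $t$ on $(0,\infty)^n\times(0,T)$, satisfies there $$\frac{\partial V}{\partial t}+\frac12\sum_{i,j=1}^n\rho_{ij}\sigma_i\sigma_jS_iS_j\frac{\partial^2V}{\partial S_i\partial S_j}+\sum_{i=1}^n(r-q_i)S_i\frac{\partial V}{\partial S_i}-rV=0,$$ and satisfies $V(S,T)=\theta(S)$ and $V(S,t)\to0$ as $\|S\|\to\infty$ uniformly in $t\in[0,T]$, then $V(S,t)=e^{-r(T-t)}\mathcal M^{-1}\{\hat\theta(w)\Phi(wi,T-t)\}(S)$ for all $S$, $t$, $a$ as in 3. -/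

import Mathlib

open MeasureTheory ProbabilityTheory Filter Topology
open scoped NNReal

namespace BasketOption

noncomputable section

/-- The open orthant of `ℝⁿ`: all coordinates are positive. -/
def posOrthant (n : ℕ) : Set (Fin n → ℝ) := {x | ∀ i, 0 < x i}

/-! ### Multidimensional Mellin transform and its inverse -/

/-- The `n`-dimensional Mellin transform `∫_{(0,∞)ⁿ} f(x) ∏ xᵢ^{wᵢ - 1} dx`. -/
def mellinTransform {n : ℕ} (f : (Fin n → ℝ) → ℂ) (w : Fin n → ℂ) : ℂ :=
  ∫ x in posOrthant n, f x * ∏ i, (x i : ℂ) ^ (w i - 1)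

/-- The integral defining the Mellin transform of `f` at `w` converges absolutely. -/
def MellinTransformConvergent {n : ℕ} (f : (Fin n → ℝ) → ℂ) (w : Fin n → ℂ) : Prop :=
  IntegrableOn (fun x => f x * ∏ i, (x i : ℂ) ^ (w i - 1)) (posOrthant n)

/-- The point `a + i b` of the contour `∏ⱼ {Re wⱼ = aⱼ}`. -/
def contourPoint {n : ℕ} (a b : Fin n → ℝ) : Fin n → ℂ :=
  fun j => (a j : ℂ) + (b j : ℂ) * Complex.I

/-- The integrand `F(w) x^{-w}` of the inverse Mellin transform at `w = a + i b`. -/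
def mellinInvIntegrand {n : ℕ} (a : Fin n → ℝ) (F : (Fin n → ℂ) → ℂ) (x : Fin n → ℝ)
    (b : Fin n → ℝ) : ℂ :=
  F (contourPoint a b) * ∏ j, (x j : ℂ) ^ (-(contourPoint a b j))

/-- `HasMellinInverse a F x v`: the inverse Mellin transform
`(2πi)⁻ⁿ ∫ F(w) x^{-w} dw` along the contour `∏ⱼ {Re wⱼ = aⱼ}` exists and equals `v`. Since
`dw = iⁿ db`, this is `(2π)⁻ⁿ ∫ F(a + i b) x^{-(a + i b)} db`. As usual for Mellin inversion, the
integral is the limit of the integrals over `∏ⱼ [-Rⱼ, Rⱼ]` as all `Rⱼ → ∞` (independently). -/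
def HasMellinInverse {n : ℕ} (a : Fin n → ℝ) (F : (Fin n → ℂ) → ℂ) (x : Fin n → ℝ) (v : ℂ) :
    Prop :=
  Tendsto
    (fun R : Fin n → ℝ =>
      ((2 * Real.pi : ℝ) : ℂ)⁻¹ ^ n * ∫ b in Set.Icc (-R) R, mellinInvIntegrand a F x b)
    atTop (𝓝 v)

/-! ### The payoff -/

/-- The payoff `(K - ∑ Sᵢ)⁺` of a basket put with exercise price `K`. -/
def putPayoff {n : ℕ} (K : ℝ) (S : Fin n → ℝ) : ℝ := max (K - ∑ i, S i) 0

/-- The Mellin transform of the basket put payoff. -/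
def payoffMellin {n : ℕ} (K : ℝ) : (Fin n → ℂ) → ℂ :=
  mellinTransform fun S => (putPayoff K S : ℂ)

/-- The multinomial beta function `∏ Γ(wⱼ) / Γ(∑ wⱼ)`. -/
def multinomialBeta {n : ℕ} (w : Fin n → ℂ) : ℂ :=
  (∏ j, Complex.Gamma (w j)) / Complex.Gamma (∑ j, w j)

/-! ### The market -/

/-- `W₁, …, Wₙ` are (jointly Gaussian) standard Wiener processes with
`corr(dWᵢ, dWⱼ) = ρᵢⱼ`. -/
structure IsCorrelatedBrownian {Ω : Type*} [MeasurableSpace Ω] {n : ℕ}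
    (W : Fin n → ℝ≥0 → Ω → ℝ) (ρ : Matrix (Fin n) (Fin n) ℝ) (P : Measure Ω) : Prop where
  brownian : ∀ i, IsBrownianReal (W i) P
  gaussian : IsGaussianProcess (fun p : Fin n × ℝ≥0 => W p.1 p.2) P
  covariance_eq : ∀ i j s t, covariance (W i s) (W j t) P = ρ i j * ((min s t : ℝ≥0) : ℝ)

/-- The covariance matrix `ρᵢⱼ σᵢ σⱼ` of the log prices per unit of time. -/
def covMatrix {n : ℕ} (ρ : Matrix (Fin n) (Fin n) ℝ) (σ : Fin n → ℝ) :
    Matrix (Fin n) (Fin n) ℝ :=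
  Matrix.of fun i j => ρ i j * σ i * σ j

/-- The risk-neutral drift `r - qᵢ - σᵢ²/2` of the log price of asset `i`. -/
def riskNeutralDrift {n : ℕ} (r : ℝ) (q σ : Fin n → ℝ) : Fin n → ℝ :=
  fun i => r - q i - σ i ^ 2 / 2

/-- The multivariate Brownian motion with drift `Xₜ = μ t + (σᵢ Wᵢ(t))ᵢ`. -/
def driftedBrownian {Ω : Type*} {n : ℕ} (W : Fin n → ℝ≥0 → Ω → ℝ) (μ σ : Fin n → ℝ)
    (t : ℝ≥0) (ω : Ω) : Fin n → ℝ :=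
  fun i => μ i * (t : ℝ) + σ i * W i t ω

/-- The characteristic function `𝔼[exp(i u·Xₜ)]`, for complex arguments `u`. -/
def charFn {Ω : Type*} [MeasurableSpace Ω] {n : ℕ} (P : Measure Ω)
    (X : ℝ≥0 → Ω → Fin n → ℝ) (u : Fin n → ℂ) (t : ℝ≥0) : ℂ :=
  ∫ ω, Complex.exp (Complex.I * ∑ j, u j * (X t ω j : ℂ)) ∂P

/-- The characteristic exponent `Ψ(u) = ½ u'Cu - i μ'u`. -/
def charExponent {n : ℕ} (C : Matrix (Fin n) (Fin n) ℝ) (μ : Fin n → ℝ) (u : Fin n → ℂ) : ℂ :=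
  1 / 2 * ∑ i, ∑ j, (C i j : ℂ) * u i * u j - Complex.I * ∑ j, (μ j : ℂ) * u j

/-- The price at time `t`, when the assets trade at `S`, of the European basket put with maturity
`T`: the discounted risk-neutral expectation of the payoff. The assets are the geometric Brownian
motions `Sᵢ(s) = Sᵢ exp(Xᵢ(s) - Xᵢ(t))`, `s ≥ t`, where `X` is the log-price process. -/
def europeanPutPrice {Ω : Type*} [MeasurableSpace Ω] {n : ℕ} (P : Measure Ω)
    (X : ℝ≥0 → Ω → Fin n → ℝ) (K r : ℝ) (T : ℝ≥0) (S : Fin n → ℝ) (t : ℝ≥0) : ℝ :=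
  Real.exp (-(r * ((T : ℝ) - t))) *
    ∫ ω, putPayoff K (fun i => S i * Real.exp (X T ω i - X t ω i)) ∂P

/-! ### The generalized Black-Scholes problem -/

/-- The partial derivative `∂f/∂xᵢ`. -/
def pderiv {n : ℕ} (i : Fin n) (f : (Fin n → ℝ) → ℝ) (x : Fin n → ℝ) : ℝ :=
  lineDeriv ℝ f x (Pi.single i 1)

/-- `V = V(S, t)` is a classical solution of the European basket put pricing problem on the prices
`S ∈ [0,∞)ⁿ` and times `t ∈ [0,T]`: it is continuous, satisfies the generalized Black-Scholes
equation for positive prices and `0 < t < T`, equals the payoff at maturity, and tends to `0` as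
`S → ∞` (uniformly in `t`). -/
structure SolvesBlackScholes {n : ℕ} (ρ : Matrix (Fin n) (Fin n) ℝ) (σ q : Fin n → ℝ)
    (r K T : ℝ) (V : (Fin n → ℝ) → ℝ → ℝ) : Prop where
  continuousOn : ContinuousOn (fun p : (Fin n → ℝ) × ℝ => V p.1 p.2)
    ({S | ∀ i, 0 ≤ S i} ×ˢ Set.Icc 0 T)
  contDiffOn : ∀ t ∈ Set.Ioo 0 T, ContDiffOn ℝ 2 (fun S => V S t) (posOrthant n)
  differentiableAt : ∀ S ∈ posOrthant n, ∀ t ∈ Set.Ioo 0 T, DifferentiableAt ℝ (V S) t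
  equation : ∀ S ∈ posOrthant n, ∀ t ∈ Set.Ioo 0 T,
    deriv (V S) t
      + 1 / 2 * ∑ i, ∑ j, ρ i j * σ i * σ j * S i * S j *
          pderiv i (fun S' => pderiv j (fun S'' => V S'' t) S') S
      + ∑ i, (r - q i) * S i * pderiv i (fun S' => V S' t) S
      - r * V S t = 0
  terminal : ∀ S : Fin n → ℝ, (∀ i, 0 ≤ S i) → V S T = putPayoff K S
  tendsto_zero : ∀ ε > 0, ∃ R : ℝ, ∀ S : Fin n → ℝ, (∀ i, 0 ≤ S i) → R ≤ ‖S‖ →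
    ∀ t ∈ Set.Icc 0 T, |V S t| ≤ ε

end

end BasketOption

/-!
Three facts carry the pricing formula.

* The payoff is the composition of `x ↦ x⁺` with a linear function, and `x⁺` is the inverse Laplace
  transform `(2π)⁻¹ ∫ e^{zx} z⁻² dy` along the line `z = 1 + iy`. Hence the basket put payoff is a
  superposition of products `∏ⱼ e^{-z Sⱼ}`, whose Mellin transform is `∏ⱼ Γ(wⱼ) z^{-wⱼ}`. This
  yields `∏ⱼ Γ(wⱼ)` times a one-dimensional integral depending on `∑ⱼ wⱼ` only, which is known from
  the case of one asset (`payoffMellin_eq`).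

* For the same reason the inversion integral over a box factorizes, under the integral over `z`,
  into the one-dimensional truncated inverse Mellin transforms of the Gamma function
  (`truncGammaInv`). These converge to `e^{-ζ}`, and they grow at most logarithmically in `|ζ|`,
  uniformly in the truncation (`exists_norm_truncGammaInv_le`): after the substitution `u = e^{-v}`
  in the Gamma integral they are Dirichlet integrals. The logarithmic bound is integrable against
  `|z|⁻²`, which gives both the convergence of the truncated inversion integral of the payoff and a
  bound uniform in the truncation (`tendsto_truncPayoffInv`, `exists_norm_truncPayoffInv_le`).

* The increments of the log-price process are Gaussian, so that their exponential moments exist and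
  `𝔼[exp (i u'Xₜ)]` is known for complex `u` (`charFn_driftedBrownian`). Exchanging the expectation
  with the box integral and passing to the limit under the expectation, with the bound just
  mentioned, proves the pricing formula (`tendsto_integral_box`). For this no decay of `Φ` is
  needed, hence the covariance matrix may be degenerate and `t = T` is allowed. If the covariance
  matrix is positive definite and `t < T`, then `Φ` has Gaussian decay on the contour.

It remains to identify a solution `V` of the Black-Scholes problem with the expectation. In
log-prices the equation has constant coefficients, and the exponentials `e^{i ω·y}` propagate
explicitly, both under the equation and under the expectation. Up to `ε` times the weight `1 + ∑ⱼ
(Sⱼ + 1 / Sⱼ)`, the payoff is a trigonometric polynomial in the log-prices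
(`exists_trigSum_approx_putPayoff`). The maximum principle, with a growing multiple of the weight
as a supersolution (`le_of_hasGeneratorAt_zero`), shows that `V` differs from the corresponding
explicit solution by a multiple of `ε`, and so does the expectation. As the weight is infinite at
the faces `Sⱼ = 0`, no boundary condition is needed there; as the second-order part is a sum of
second derivatives along lines, the maximum principle does not need ellipticity.
-/

namespace BasketOption

/-! ### The Gamma integral with a complex rate -/

open Complex in
theorem integrableOn_cpow_mul_exp_neg_mul {w ζ : ℂ} (hw : 0 < w.re) (hζ : 0 < ζ.re) :
    IntegrableOn (fun u : ℝ => (u : ℂ) ^ (w - 1) * cexp (-(ζ * u))) (Set.Ioi 0) := by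
  have h := integrableOn_rpow_mul_exp_neg_mul_rpow (s := w.re - 1) (p := 1) (b := ζ.re)
    (by linarith) one_pos hζ
  refine Integrable.mono' h ?_ ?_
  · refine (ContinuousOn.mul ?_ ?_).aestronglyMeasurable measurableSet_Ioi
    · exact fun u hu => (Complex.continuousAt_ofReal_cpow_const _ _
        (Or.inr (ne_of_gt hu))).continuousWithinAt
    · fun_prop
  · filter_upwards [ae_restrict_mem measurableSet_Ioi] with u hu
    rw [norm_mul, Complex.norm_cpow_eq_rpow_re_of_pos hu, Complex.norm_exp]
    simp

open Complex in
/-- Both sides are holomorphic in `ζ` and agree for real `ζ`. -/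
theorem integral_cpow_mul_exp_neg_mul_of_re_pos {w ζ : ℂ} (hw : 0 < w.re) (hζ : 0 < ζ.re) :
    ∫ u : ℝ in Set.Ioi 0, (u : ℂ) ^ (w - 1) * cexp (-(ζ * u)) = Gamma w * ζ ^ (-w) := by
  have hopen : IsOpen {z : ℂ | 0 < z.re} := isOpen_lt continuous_const continuous_re
  have hmeas : ∀ (s z : ℂ), AEStronglyMeasurable
      (fun u : ℝ => (u : ℂ) ^ s * cexp (-(z * u))) (volume.restrict (Set.Ioi 0)) := by
    intro s z
    refine (ContinuousOn.mul ?_ ?_).aestronglyMeasurable measurableSet_Ioi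
    · exact fun u hu => (Complex.continuousAt_ofReal_cpow_const _ _
        (Or.inr (ne_of_gt hu))).continuousWithinAt
    · fun_prop
  have hdiff : DifferentiableOn ℂ
      (fun z : ℂ => ∫ u : ℝ in Set.Ioi 0, (u : ℂ) ^ (w - 1) * cexp (-(z * u)))
      {z | 0 < z.re} := by
    intro z hz
    have hz' : 0 < z.re := hz
    have hball : Metric.ball z (z.re / 2) ∈ 𝓝 z := Metric.ball_mem_nhds z (by positivity)
    refine DifferentiableAt.differentiableWithinAt (HasDerivAt.differentiableAt
      (f' := ∫ u : ℝ in Set.Ioi 0, (u : ℂ) ^ (w - 1) * (cexp (-(z * u)) * (-(u : ℂ)))) ?_)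
    refine (hasDerivAt_integral_of_dominated_loc_of_deriv_le
      (F' := fun (ζ' : ℂ) (u : ℝ) => (u : ℂ) ^ (w - 1) * (cexp (-(ζ' * u)) * (-(u : ℂ))))
      (F := fun (ζ' : ℂ) (u : ℝ) => (u : ℂ) ^ (w - 1) * cexp (-(ζ' * u)))
      (bound := fun u : ℝ => u ^ w.re * Real.exp (-(z.re / 2) * u ^ (1 : ℝ)))
      hball (Eventually.of_forall fun z' => hmeas _ _)
      (integrableOn_cpow_mul_exp_neg_mul hw hz') ?_ ?_ ?_ ?_).2
    · have := (hmeas (w - 1) z).mul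
        (Continuous.aestronglyMeasurable (μ := volume.restrict (Set.Ioi 0))
          (f := fun u : ℝ => -(u : ℂ)) (by fun_prop))
      refine this.congr (Eventually.of_forall fun u => ?_)
      simp [mul_assoc]
    · filter_upwards [ae_restrict_mem measurableSet_Ioi] with u hu z' hz''
      have hu' : 0 < u := hu
      have h1 : z.re / 2 ≤ z'.re := by
        have := (Complex.abs_re_le_norm (z' - z)).trans (mem_ball_iff_norm.1 hz'').le
        rw [Complex.sub_re, abs_le] at this
        linarith [this.1]
      rw [norm_mul, norm_mul, Complex.norm_cpow_eq_rpow_re_of_pos hu', Complex.norm_exp, norm_neg,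
        Complex.norm_real, Real.norm_of_nonneg hu'.le, Real.rpow_one]
      have h2 : u ^ w.re = u ^ (w - 1).re * u := by
        rw [← Real.rpow_add_one hu'.ne']; simp
      rw [h2, mul_assoc, mul_comm (Real.exp _) u]
      have h3 : (-(z' * (u : ℂ))).re ≤ -(z.re / 2) * u := by
        simp only [neg_re, mul_re, ofReal_re, ofReal_im]
        nlinarith
      gcongr
    · exact integrableOn_rpow_mul_exp_neg_mul_rpow (by linarith) one_pos (by positivity)
    · refine Eventually.of_forall fun u z' _ => ?_
      have h : HasDerivAt (fun z : ℂ => -(z * (u : ℂ))) (-(u : ℂ)) z' := by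
        simpa using ((hasDerivAt_id z').mul_const (u : ℂ)).fun_neg
      exact (h.cexp).const_mul _
  have hdiff2 : DifferentiableOn ℂ (fun z : ℂ => Gamma w * z ^ (-w)) {z | 0 < z.re} := by
    intro z hz
    exact (((hasDerivAt_id z).cpow_const (Or.inl hz)).const_mul _
      ).differentiableAt.differentiableWithinAt
  refine (hdiff.analyticOnNhd hopen).eqOn_of_preconnected_of_frequently_eq
    (hdiff2.analyticOnNhd hopen) (convex_halfSpace_re_gt 0).isPreconnected
    (z₀ := 1) (by simp) ?_ hζ
  have hreal : ∀ r : ℝ, 0 < r →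
      ∫ u : ℝ in Set.Ioi 0, (u : ℂ) ^ (w - 1) * cexp (-((r : ℂ) * u))
        = Gamma w * (r : ℂ) ^ (-w) := by
    intro r hr
    rw [integral_cpow_mul_exp_neg_mul_Ioi hw hr, mul_comm, one_div, Complex.inv_cpow,
      Complex.cpow_neg]
    rw [Complex.arg_ofReal_of_nonneg hr.le]
    exact Real.pi_pos.ne
  have htend : Tendsto (fun r : ℝ => (r : ℂ)) (𝓝[≠] 1) (𝓝[≠] 1) := by
    refine tendsto_nhdsWithin_iff.2 ⟨?_, ?_⟩
    · exact (Complex.continuous_ofReal.tendsto' 1 1 (by simp)).mono_left nhdsWithin_le_nhds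
    · filter_upwards [self_mem_nhdsWithin] with r hr
      simpa using hr
  refine htend.frequently (Eventually.frequently ?_)
  filter_upwards [nhdsWithin_le_nhds (Ioi_mem_nhds (zero_lt_one' ℝ))] with r hr
  exact hreal r hr

open Complex in
theorem norm_Gamma_mul_cpow_le {w ζ : ℂ} (hw : 0 < w.re) (hζ : 0 < ζ.re) :
    ‖Gamma w * ζ ^ (-w)‖ ≤ Real.Gamma w.re * ζ.re ^ (-w.re) := by
  rw [← integral_cpow_mul_exp_neg_mul_of_re_pos hw hζ]
  have h := Real.integral_rpow_mul_exp_neg_mul_Ioi hw hζ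
  refine (norm_integral_le_integral_norm _).trans (le_of_eq ?_)
  rw [mul_comm, Real.rpow_neg hζ.le, ← Real.inv_rpow hζ.le, ← one_div, ← h]
  refine setIntegral_congr_fun measurableSet_Ioi fun u hu => ?_
  rw [norm_mul, Complex.norm_cpow_eq_rpow_re_of_pos hu, Complex.norm_exp]
  simp

/-! ### Truncated inverse Mellin transform of the Gamma function -/

/-- The integral `(2π)⁻¹ ∫_{-R}^R Γ(a + ib) ζ^{-(a + ib)} db`, the truncation at height `R` of the
inverse Mellin transform of `Γ` on the line `Re w = a`. -/
noncomputable def truncGammaInv (a R : ℝ) (ζ : ℂ) : ℂ :=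
  ((2 * Real.pi : ℝ) : ℂ)⁻¹ * ∫ b in Set.Icc (-R) R,
    Complex.Gamma (a + b * Complex.I) * ζ ^ (-((a : ℂ) + b * Complex.I))

theorem integrable_exp_neg_mul_abs {k : ℝ} (hk : 0 < k) :
    Integrable fun b : ℝ => Real.exp (-(k * |b|)) := by
  rw [← integrableOn_univ, ← Set.Iic_union_Ioi (a := (0 : ℝ))]
  refine IntegrableOn.union ?_ ?_
  · refine (integrableOn_exp_mul_Iic hk 0).congr_fun (fun b hb => ?_) measurableSet_Iic
    rw [abs_of_nonpos hb]
    ring_nf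
  · refine (integrableOn_exp_mul_Ioi (neg_neg_iff_pos.2 hk) 0).congr_fun (fun b hb => ?_)
      measurableSet_Ioi
    rw [abs_of_pos (Set.mem_Ioi.1 hb)]
    ring_nf

open Complex in
theorem continuous_Gamma_line {a : ℝ} (ha : 0 < a) :
    Continuous fun b : ℝ => Gamma ((a : ℂ) + b * I) := by
  refine continuous_iff_continuousAt.2 fun b => ?_
  have h : ContinuousAt Gamma ((a : ℂ) + b * I) := by
    refine (differentiableAt_Gamma _ fun m hm => ?_).continuousAt
    have := congrArg Complex.re hm
    simp at this
    have h2 : (0 : ℝ) ≤ m := Nat.cast_nonneg m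
    linarith
  exact ContinuousAt.comp (f := fun b : ℝ => (a : ℂ) + b * I) h (by fun_prop)

open Complex in
theorem continuous_Gamma_mul_cpow_line {a : ℝ} (ha : 0 < a) {ζ : ℂ} (hζ : ζ ≠ 0) :
    Continuous fun b : ℝ => Gamma ((a : ℂ) + b * I) * ζ ^ (-((a : ℂ) + b * I)) := by
  refine (continuous_Gamma_line ha).mul ?_
  exact Continuous.const_cpow (by fun_prop) (Or.inl hζ)

open Complex in
/-- The decay of `Γ` on vertical lines follows from the bound `norm_Gamma_mul_cpow_le` at a number
whose argument is nearer to `±π/2` than that of `ζ`. -/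
theorem integrable_Gamma_mul_cpow_line {a : ℝ} (ha : 0 < a) {ζ : ℂ} (hζ : 0 < ζ.re) :
    Integrable fun b : ℝ => Gamma ((a : ℂ) + b * I) * ζ ^ (-((a : ℂ) + b * I)) := by
  have hζ0 : ζ ≠ 0 := by rintro rfl; simp at hζ
  have harg : |arg ζ| < Real.pi / 2 := abs_arg_lt_pi_div_two_iff.2 (Or.inl hζ)
  obtain ⟨φ, hφ1, hφ2⟩ := exists_between harg
  have hφ0 : 0 < φ := (abs_nonneg _).trans_lt hφ1
  set c := Real.Gamma a * Real.cos φ ^ (-a) with hc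
  have hcos : 0 < Real.cos φ := Real.cos_pos_of_mem_Ioo ⟨by linarith, by linarith⟩
  -- the exponential decay of `Γ`
  have hG : ∀ b : ℝ, ‖Gamma ((a : ℂ) + b * I)‖ ≤ c * Real.exp (-(φ * |b|)) := by
    intro b
    -- the sign of the argument is that of `b`
    obtain ⟨ψ, hψ, hψb, hψc⟩ : ∃ ψ : ℝ, |ψ| = φ ∧ ψ * b = φ * |b| ∧ Real.cos ψ = Real.cos φ := by
      rcases le_total 0 b with hb | hb
      · exact ⟨φ, abs_of_pos hφ0, by rw [abs_of_nonneg hb], rfl⟩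
      · exact ⟨-φ, by rw [abs_neg, abs_of_pos hφ0], by rw [abs_of_nonpos hb]; ring, by simp⟩
    have hre : (cexp (ψ * I)).re = Real.cos φ := by
      rw [exp_ofReal_mul_I_re, hψc]
    have h := norm_Gamma_mul_cpow_le (w := (a : ℂ) + b * I) (ζ := cexp (ψ * I)) (by simpa using ha)
      (by rw [hre]; exact hcos)
    rw [hre] at h
    have hlog : Complex.log (cexp (ψ * I)) = ψ * I := by
      rw [Complex.log_exp]
      · simp; have := (abs_lt.1 (hψ.trans_lt hφ2)).1; linarith [Real.pi_pos]
      · simp; have := (abs_lt.1 (hψ.trans_lt hφ2)).2; linarith [Real.pi_pos]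
    rw [norm_mul, cpow_def_of_ne_zero (exp_ne_zero _), hlog, Complex.norm_exp] at h
    have hre2 : ((ψ : ℂ) * I * -((a : ℂ) + b * I)).re = φ * |b| := by
      rw [← hψb]; simp
    simp only [add_re, ofReal_re, mul_re, I_re, mul_zero, ofReal_im, I_im, mul_one, sub_self,
      add_zero] at h
    rw [← hc] at h
    simp only [mul_re, mul_im, neg_re, neg_im, add_re, add_im, ofReal_re, ofReal_im, I_re, I_im,
      mul_zero, mul_one, zero_mul, add_zero, zero_add, sub_self, zero_sub] at h hre2
    rw [hre2] at h
    rw [Real.exp_neg, ← div_eq_mul_inv, le_div_iff₀ (Real.exp_pos _)]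
    exact h
  have hint : Integrable fun b : ℝ =>
      c * ‖ζ‖ ^ (-a) * Real.exp (-((φ - |arg ζ|) * |b|)) := by
    exact (integrable_exp_neg_mul_abs (by linarith)).const_mul _
  refine hint.mono' (continuous_Gamma_mul_cpow_line ha hζ0).aestronglyMeasurable
    (Eventually.of_forall fun b => ?_)
  have h2 : ‖ζ ^ (-((a : ℂ) + b * I))‖ ≤ ‖ζ‖ ^ (-a) * Real.exp (|arg ζ| * |b|) := by
    rw [norm_cpow_of_ne_zero hζ0, div_eq_mul_inv, ← Real.exp_neg]
    have h3 : -(arg ζ * (-((a : ℂ) + b * I)).im) ≤ |arg ζ| * |b| := by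
      rw [← abs_mul]
      refine le_trans (le_of_eq ?_) (le_abs_self _)
      simp
    have h4 : (-((a : ℂ) + b * I)).re = -a := by simp
    rw [h4]
    gcongr
  calc _ ≤ (c * Real.exp (-(φ * |b|))) * (‖ζ‖ ^ (-a) * Real.exp (|arg ζ| * |b|)) := by
        rw [norm_mul]
        exact mul_le_mul (hG b) h2 (norm_nonneg _) ((norm_nonneg _).trans (hG b))
    _ = c * ‖ζ‖ ^ (-a) * (Real.exp (-(φ * |b|)) * Real.exp (|arg ζ| * |b|)) := by ring
    _ = _ := by rw [← Real.exp_add]; ring_nf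

open Complex in
theorem tendsto_truncGammaInv {a : ℝ} (ha : 0 < a) {ζ : ℂ} (hζ : 0 < ζ.re) :
    Tendsto (fun R => truncGammaInv a R ζ) atTop (𝓝 (cexp (-ζ))) := by
  have hmellin : ∀ s : ℂ, 0 < s.re → mellin (fun u : ℝ => cexp (-(ζ * u))) s
      = Gamma s * ζ ^ (-s) := by
    intro s hs
    rw [← integral_cpow_mul_exp_neg_mul_of_re_pos hs hζ]
    simp [mellin]
  have hint := integrable_Gamma_mul_cpow_line ha hζ
  have hre : ∀ b : ℝ, 0 < ((a : ℂ) + b * I).re := by intro b; simpa using ha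
  have hinv := mellinInv_mellin_eq a (fun u : ℝ => cexp (-(ζ * u))) one_pos
    (by
      have := integrableOn_cpow_mul_exp_neg_mul (w := a) (by simpa using ha) hζ
      simpa [MellinConvergent] using this)
    (by
      refine hint.congr (Eventually.of_forall fun b => ?_)
      simp only
      rw [hmellin _ (hre b)])
    (by fun_prop)
  rw [mellinInv] at hinv
  simp only [ofReal_one, one_cpow, one_smul, mul_one] at hinv
  rw [← hinv]
  simp_rw [hmellin _ (hre _)]
  have h := intervalIntegral_tendsto_integral hint tendsto_neg_atTop_atBot tendsto_id
  rw [real_smul]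
  have h3 := h.const_mul (((2 * Real.pi : ℝ) : ℂ)⁻¹)
  rw [one_div, ofReal_inv]
  refine h3.congr' ?_
  filter_upwards [eventually_ge_atTop 0] with R hR
  rw [truncGammaInv, integral_Icc_eq_integral_Ioc, intervalIntegral.integral_of_le]
  · rfl
  · simp only [id]; linarith

/-! ### A bound for the truncated transforms, uniform in the truncation -/

theorem abs_integral_sinc_le {X : ℝ} (hX : 0 ≤ X) : |∫ v in (0 : ℝ)..X, Real.sinc v| ≤ 4 := by
  have hcont := Real.continuous_sinc
  have hsmall : ∀ Y : ℝ, 0 ≤ Y → Y ≤ 1 → |∫ v in (0 : ℝ)..Y, Real.sinc v| ≤ 1 := by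
    intro Y hY hY1
    have := intervalIntegral.norm_integral_le_of_norm_le_const (a := (0 : ℝ)) (b := Y) (C := 1)
      (f := Real.sinc) (fun v _ => Real.abs_sinc_le_one v)
    rw [Real.norm_eq_abs, sub_zero, abs_of_nonneg hY] at this
    linarith
  rcases le_total X 1 with h | h
  · linarith [hsmall X hX h]
  rw [← intervalIntegral.integral_add_adjacent_intervals (b := 1)
    (hcont.intervalIntegrable _ _) (hcont.intervalIntegrable _ _)]
  have h1 := hsmall 1 zero_le_one le_rfl
  -- integration by parts beyond `1`
  have hpos : ∀ v ∈ Set.uIcc 1 X, 0 < v := by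
    intro v hv
    rw [Set.uIcc_of_le h] at hv
    linarith [hv.1]
  have hparts := intervalIntegral.integral_mul_deriv_eq_deriv_mul (a := 1) (b := X)
    (u := fun v : ℝ => v⁻¹) (v := fun v => -Real.cos v) (u' := fun v => -(v ^ 2)⁻¹)
    (v' := Real.sin)
    (fun v hv => hasDerivAt_inv (hpos v hv).ne')
    (fun v _ => by simpa using (Real.hasDerivAt_cos v).fun_neg)
    (ContinuousOn.intervalIntegrable (by
      refine ContinuousOn.neg (ContinuousOn.inv₀ (by fun_prop) fun v hv => ?_)
      have := hpos v hv
      positivity))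
    (Real.continuous_sin.intervalIntegrable _ _)
  have hcongr : ∫ v in (1 : ℝ)..X, Real.sinc v = ∫ v in (1 : ℝ)..X, v⁻¹ * Real.sin v := by
    refine intervalIntegral.integral_congr fun v hv => ?_
    rw [Real.sinc_of_ne_zero (hpos v hv).ne', div_eq_inv_mul]
  have hrest : |∫ v in (1 : ℝ)..X, -(v ^ 2)⁻¹ * -Real.cos v| ≤ 1 := by
    have hle : ‖∫ v in (1 : ℝ)..X, -(v ^ 2)⁻¹ * -Real.cos v‖ ≤ ∫ v in (1 : ℝ)..X, v ^ (-2 : ℤ) := by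
      refine intervalIntegral.norm_integral_le_of_norm_le h (ae_of_all _ fun v hv => ?_) ?_
      · rw [norm_mul, norm_neg, norm_neg, norm_inv, norm_pow, Real.norm_eq_abs, sq_abs]
        rw [zpow_neg]
        have := Real.abs_cos_le_one v
        rw [Real.norm_eq_abs]
        have h3 : 0 ≤ (v ^ 2)⁻¹ := by positivity
        norm_cast
        nlinarith
      · refine ContinuousOn.intervalIntegrable fun v hv => ?_
        exact (continuousAt_zpow₀ v _ (Or.inl (hpos v hv).ne')).continuousWithinAt
    rw [integral_zpow (Or.inr ⟨by norm_num, fun h0 => (hpos 0 h0).ne' rfl⟩)] at hle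
    refine hle.trans ?_
    norm_num
    have : 0 ≤ X⁻¹ := by positivity
    linarith
  rw [hcongr, hparts]
  have hX1 : |X⁻¹| ≤ 1 := by
    rw [abs_of_nonneg (by positivity)]
    exact inv_le_one_of_one_le₀ h
  have h4 : |X⁻¹ * -Real.cos X| ≤ 1 := by
    rw [abs_mul, abs_neg]
    exact mul_le_one₀ hX1 (abs_nonneg _) (Real.abs_cos_le_one X)
  have h5 : |(1 : ℝ)⁻¹ * -Real.cos 1| ≤ 1 := by
    rw [inv_one, one_mul, abs_neg]
    exact Real.abs_cos_le_one 1
  simp only [abs_le] at *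
  constructor <;> linarith [h1.1, h1.2, h4.1, h4.2, h5.1, h5.2, hrest.1, hrest.2]

/-- The Dirichlet kernel `∫_{-R}^R e^{-ibv} db = 2 R sinc (R v)`. -/
noncomputable def dirichletKer (R v : ℝ) : ℝ := 2 * R * Real.sinc (R * v)

theorem continuous_dirichletKer (R : ℝ) : Continuous (dirichletKer R) := by
  unfold dirichletKer
  exact continuous_const.mul (Real.continuous_sinc.comp (by fun_prop))

theorem abs_dirichletKer_mul_le (R v : ℝ) : |dirichletKer R v| * |v| ≤ 2 := by
  rcases eq_or_ne (R * v) 0 with h | h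
  · rcases mul_eq_zero.1 h with h | h <;> simp [dirichletKer, h]
  · rw [dirichletKer, Real.sinc_of_ne_zero h, ← abs_mul]
    have hR : R ≠ 0 := left_ne_zero_of_mul h
    have hv : v ≠ 0 := right_ne_zero_of_mul h
    rw [show 2 * R * (Real.sin (R * v) / (R * v)) * v = 2 * Real.sin (R * v) by field_simp,
      abs_mul, abs_two]
    linarith [Real.abs_sin_le_one (R * v)]

theorem abs_integral_dirichletKer_le {R δ : ℝ} (hR : 0 ≤ R) (hδ : 0 ≤ δ) :
    |∫ v in -δ..δ, dirichletKer R v| ≤ 16 := by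
  have h1 : ∫ v in -δ..δ, dirichletKer R v = 2 * ∫ v in -(R * δ)..(R * δ), Real.sinc v := by
    unfold dirichletKer
    rw [intervalIntegral.integral_const_mul, mul_assoc, intervalIntegral.mul_integral_comp_mul_left]
    ring_nf
  have h2 : ∫ v in -(R * δ)..(0 : ℝ), Real.sinc v = ∫ v in (0 : ℝ)..(R * δ), Real.sinc v := by
    have := intervalIntegral.integral_comp_neg (a := 0) (b := R * δ) Real.sinc
    simp only [Real.sinc_neg, neg_zero] at this
    exact this.symm
  have hc := Real.continuous_sinc
  rw [h1, ← intervalIntegral.integral_add_adjacent_intervals (b := 0)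
    (hc.intervalIntegrable _ _) (hc.intervalIntegrable _ _), h2]
  have := abs_integral_sinc_le (mul_nonneg hR hδ)
  rw [abs_le] at *
  constructor <;> linarith [this.1, this.2]

open Complex in
theorem integral_exp_neg_mul_I_eq_dirichletKer {R : ℝ} (hR : 0 ≤ R) (v : ℝ) :
    ∫ b in Set.Icc (-R) R, cexp (-(b * v * I)) = dirichletKer R v := by
  rw [integral_Icc_eq_integral_Ioc, ← intervalIntegral.integral_of_le (by linarith)]
  rcases eq_or_ne v 0 with rfl | hv
  · simp [dirichletKer]; ring
  have h := intervalIntegral.integral_comp_mul_left (a := -R) (b := R)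
    (fun x : ℝ => cexp (x * I)) (neg_ne_zero.2 hv)
  have h2 : ∀ b : ℝ, cexp (((-v * b : ℝ) : ℂ) * I) = cexp (-(b * v * I)) := by
    intro b; push_cast; ring_nf
  simp_rw [h2] at h
  rw [h, show -v * -R = -(-v * R) by ring, integral_exp_mul_I_eq_sinc, dirichletKer]
  rw [show -v * R = -(R * v) by ring, Real.sinc_neg, real_smul]
  push_cast
  have : (v : ℂ) ≠ 0 := by exact_mod_cast hv
  field_simp

/-- The integrand of the Gamma integral `∫ u^a e^{-ζu} du/u` in the variable `v = -log u`. -/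
noncomputable def logGammaIntegrand (a : ℝ) (ζ : ℂ) (v : ℝ) : ℂ :=
  Complex.exp (-(a * v) - ζ * Complex.exp (-v))

open Complex in
theorem continuous_logGammaIntegrand (a : ℝ) (ζ : ℂ) : Continuous (logGammaIntegrand a ζ) := by
  unfold logGammaIntegrand; fun_prop

theorem norm_logGammaIntegrand (a : ℝ) (ζ : ℂ) (v : ℝ) :
    ‖logGammaIntegrand a ζ v‖ = Real.exp (-(a * v) - ζ.re * Real.exp (-v)) := by
  rw [logGammaIntegrand, Complex.norm_exp, ← Complex.ofReal_neg v, ← Complex.ofReal_exp]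
  rw [Complex.sub_re, Complex.re_mul_ofReal]
  simp

open Complex in
/-- On vertical lines, `Γ(w) ζ^{-w}` is a Fourier transform. -/
theorem Gamma_mul_cpow_line_eq_integral {a : ℝ} (ha : 0 < a) {ζ : ℂ} (hζ : 0 < ζ.re) (b : ℝ) :
    Gamma ((a : ℂ) + b * I) * ζ ^ (-((a : ℂ) + b * I))
      = ∫ v : ℝ, cexp (-(b * v * I)) * logGammaIntegrand a ζ v := by
  have hm : mellin (fun u : ℝ => cexp (-(ζ * u))) ((a : ℂ) + b * I)
      = Gamma ((a : ℂ) + b * I) * ζ ^ (-((a : ℂ) + b * I)) := by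
    rw [← integral_cpow_mul_exp_neg_mul_of_re_pos (by simpa using ha) hζ]
    simp [mellin]
  rw [← hm, mellin_eq_fourier, Real.fourier_real_eq_integral_exp_smul]
  refine integral_congr_ae (Eventually.of_forall fun v => ?_)
  simp only [logGammaIntegrand, smul_eq_mul, real_smul]
  push_cast
  rw [← Complex.exp_add, ← Complex.exp_add, ← Complex.exp_add]
  congr 1
  have : (Real.pi : ℂ) ≠ 0 := by exact_mod_cast Real.pi_ne_zero
  simp
  field_simp
  ring

open Complex in
theorem integrable_logGammaIntegrand_and_integral_norm {a : ℝ} (ha : 0 < a) {ζ : ℂ}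
    (hζ : 0 < ζ.re) : Integrable (logGammaIntegrand a ζ) ∧
      ∫ v, ‖logGammaIntegrand a ζ v‖ = Real.Gamma a * ζ.re ^ (-a) := by
  have h := Gamma_mul_cpow_line_eq_integral ha (ζ := (ζ.re : ℂ)) (by simpa using hζ) 0
  have h2 : ∀ v : ℝ, cexp (-((0 : ℝ) * v * I)) * logGammaIntegrand a (ζ.re : ℂ) v
      = ((‖logGammaIntegrand a ζ v‖ : ℝ) : ℂ) := by
    intro v
    rw [norm_logGammaIntegrand, logGammaIntegrand]
    push_cast
    simp
  simp_rw [h2] at h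
  rw [integral_complex_ofReal] at h
  simp only [ofReal_zero, zero_mul, add_zero] at h
  rw [Complex.Gamma_ofReal, ← ofReal_neg, ← ofReal_cpow hζ.le, ← ofReal_mul, ofReal_inj] at h
  refine ⟨?_, h.symm⟩
  -- a Bochner integral that does not vanish is that of an integrable function
  by_contra hn
  rw [integral_undef (fun hi => hn ((integrable_norm_iff
    (continuous_logGammaIntegrand a ζ).aestronglyMeasurable).1 hi))] at h
  exact (mul_pos (Real.Gamma_pos_of_pos ha) (Real.rpow_pos_of_pos hζ _)).ne' h

open Complex in
theorem truncGammaInv_eq_integral_dirichletKer {a : ℝ} (ha : 0 < a) {ζ : ℂ} (hζ : 0 < ζ.re)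
    {R : ℝ} (hR : 0 ≤ R) : truncGammaInv a R ζ
      = ((2 * Real.pi : ℝ) : ℂ)⁻¹ * ∫ v, dirichletKer R v * logGammaIntegrand a ζ v := by
  obtain ⟨hint, -⟩ := integrable_logGammaIntegrand_and_integral_norm ha hζ
  rw [truncGammaInv]
  congr 1
  simp_rw [Gamma_mul_cpow_line_eq_integral ha hζ]
  rw [integral_integral_swap]
  · refine integral_congr_ae (Eventually.of_forall fun v => ?_)
    simp only
    rw [integral_mul_const, integral_exp_neg_mul_I_eq_dirichletKer hR]
  · have h1 : Integrable (fun _ : ℝ => (1 : ℂ)) (volume.restrict (Set.Icc (-R) R)) := by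
      simp
    refine (h1.mul_prod hint).mono ?_ (Eventually.of_forall fun p => ?_)
    · have := continuous_logGammaIntegrand a ζ
      exact Continuous.aestronglyMeasurable (by unfold Function.uncurry; fun_prop)
    · simp only [Function.uncurry, norm_mul]
      rw [Complex.norm_exp]
      simp

theorem norm_logGammaIntegrand_le {a : ℝ} (ha : 0 < a) {ζ : ℂ} (hζ : 0 < ζ.re) {v : ℝ}
    (hv : |v| ≤ 1) : ‖logGammaIntegrand a ζ v‖ ≤ Real.exp a := by
  rw [norm_logGammaIntegrand, Real.exp_le_exp]
  have h1 : 0 < ζ.re * Real.exp (-v) := by positivity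
  nlinarith [(abs_le.1 hv).1]

open Complex in
theorem norm_logGammaIntegrand_sub_le {a : ℝ} (ha : 0 < a) {ζ : ℂ} (hζ : 0 < ζ.re) {v : ℝ}
    (hv : |v| ≤ 1) : ‖logGammaIntegrand a ζ v - logGammaIntegrand a ζ 0‖
      ≤ (a + ‖ζ‖ * Real.exp 1) * Real.exp a * |v| := by
  have hderiv : ∀ x : ℝ, HasDerivAt (logGammaIntegrand a ζ)
      (logGammaIntegrand a ζ x * (-(a : ℂ) + ζ * cexp (-x))) x := by
    intro x
    have h1 : HasDerivAt (fun v : ℝ => (v : ℂ)) 1 x := ofRealCLM.hasDerivAt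
    have h2 : HasDerivAt (fun v : ℝ => -((a : ℂ) * v) - ζ * cexp (-(v : ℂ)))
        (-(a : ℂ) + ζ * cexp (-x)) x := by
      refine (((h1.const_mul (a : ℂ)).fun_neg).fun_sub ((h1.fun_neg.cexp).const_mul ζ)).congr_deriv
        ?_
      ring
    exact h2.cexp
  have h := Convex.norm_image_sub_le_of_norm_hasDerivWithin_le (s := Set.Icc (-1 : ℝ) 1)
    (f := logGammaIntegrand a ζ) (x := 0) (y := v) (C := (a + ‖ζ‖ * Real.exp 1) * Real.exp a)
    (fun x _ => (hderiv x).hasDerivWithinAt) (fun x hx => ?_) (convex_Icc _ _) (by simp)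
    (abs_le.1 hv)
  · simpa using h
  rw [norm_mul, mul_comm]
  have hx' : |x| ≤ 1 := abs_le.2 hx
  refine mul_le_mul ?_ (norm_logGammaIntegrand_le ha hζ hx') (norm_nonneg _) (by positivity)
  refine (norm_add_le _ _).trans ?_
  rw [norm_neg, norm_mul, Complex.norm_real, Real.norm_of_nonneg ha.le, Complex.norm_exp]
  have : (-(x : ℂ)).re ≤ 1 := by simp; linarith [hx.1]
  gcongr

/-- The truncated inverse Mellin transforms of `Γ` are bounded uniformly in the truncation, with
only a logarithmic growth in `|ζ|`. The Dirichlet kernel `2 sin(Rv) / v` is integrated against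
`logGammaIntegrand a ζ`. Near `v = 0`, at the scale `1 / (1 + |ζ|)` on which this function is
almost constant, the cancellation of the kernel is used; up to `|v| = 1` the kernel is bounded by
`2 / |v|`, whose integral is the logarithm; beyond, the function is integrable. -/
theorem exists_norm_truncGammaInv_le {a : ℝ} (ha : 0 < a) : ∃ C : ℝ, 0 ≤ C ∧
    ∀ R : ℝ, 0 ≤ R → ∀ ζ : ℂ, 0 < ζ.re →
      ‖truncGammaInv a R ζ‖ ≤ C * (1 + ζ.re ^ (-a) + Real.log (1 + ‖ζ‖)) := by
  refine ⟨2 * Real.Gamma a + 4 * (a + Real.exp 1) * Real.exp a + 4 * Real.exp a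
    + 16 * Real.exp a, ?_, fun R hR ζ hζ => ?_⟩
  · have := Real.Gamma_pos_of_pos ha
    positivity
  obtain ⟨hint, hnorm⟩ := integrable_logGammaIntegrand_and_integral_norm ha hζ
  set g := logGammaIntegrand a ζ with hg
  set δ : ℝ := (1 + ‖ζ‖)⁻¹ with hδ
  have hδ0 : 0 < δ := by positivity
  have hδ1 : δ ≤ 1 := inv_le_one_of_one_le₀ (by linarith [norm_nonneg ζ])
  set L : ℝ := (a + ‖ζ‖ * Real.exp 1) * Real.exp a with hL
  have hL0 : 0 ≤ L := by positivity
  have hgc : Continuous g := continuous_logGammaIntegrand a ζ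
  have hDc := continuous_dirichletKer R
  -- the three parts of the majorant
  set M1 : ℝ → ℝ := fun v => 2 * ‖g v‖ with hM1
  set M2 : ℝ → ℝ := (Set.Ioc (-δ) δ).indicator fun _ => 2 * L with hM2
  set M3 : ℝ → ℝ := (Set.Icc δ 1).indicator fun v => 2 * Real.exp a * v⁻¹ with hM3
  have hM3pos : ∀ v, 0 ≤ M3 v := fun v => Set.indicator_nonneg (fun v hv => by
    have : 0 < v := hδ0.trans_le hv.1
    positivity) v
  have hM2pos : ∀ v, 0 ≤ M2 v := fun v => Set.indicator_nonneg (fun v hv => by positivity) v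
  have hi1 : Integrable M1 := hint.norm.const_mul 2
  have hi2 : Integrable M2 :=
    (integrable_indicator_iff measurableSet_Ioc).2 continuous_const.integrableOn_Ioc
  have hinv : IntervalIntegrable (fun v : ℝ => 2 * Real.exp a * v⁻¹) volume δ 1 := by
    refine ContinuousOn.intervalIntegrable ?_
    rw [Set.uIcc_of_le hδ1]
    refine continuousOn_const.mul (continuousOn_inv₀.mono fun v hv => ?_)
    exact (hδ0.trans_le hv.1).ne'
  have hi3 : Integrable M3 := (integrable_indicator_iff measurableSet_Icc).2
    ((intervalIntegrable_iff_integrableOn_Icc_of_le hδ1).1 hinv)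
  have hi3' : Integrable fun v => M3 (-v) := hi3.comp_neg
  have hj1 : ∫ v, M1 v = 2 * (Real.Gamma a * ζ.re ^ (-a)) := by
    rw [hM1, integral_const_mul, hnorm]
  have hj2 : ∫ v, M2 v = 4 * δ * L := by
    rw [hM2, integral_indicator measurableSet_Ioc, setIntegral_const]
    simp [hδ0.le]
    ring
  have hj3 : ∫ v, M3 v = 2 * Real.exp a * Real.log (1 + ‖ζ‖) := by
    rw [hM3, integral_indicator measurableSet_Icc, integral_Icc_eq_integral_Ioc,
      ← intervalIntegral.integral_of_le hδ1,
      intervalIntegral.integral_const_mul, integral_inv_of_pos hδ0 one_pos, hδ]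
    simp
  have hj3' : ∫ v, M3 (-v) = 2 * Real.exp a * Real.log (1 + ‖ζ‖) := by
    rw [integral_neg_eq_self M3, hj3]
  -- the cancelling part
  set c : ℝ → ℂ := (Set.Ioc (-δ) δ).indicator fun v => dirichletKer R v * g 0 with hc
  have hic : Integrable c := (integrable_indicator_iff measurableSet_Ioc).2
    (Continuous.integrableOn_Ioc (by fun_prop))
  have hjc : ‖∫ v, c v‖ ≤ 16 * Real.exp a := by
    rw [hc, integral_indicator measurableSet_Ioc, integral_mul_const, integral_complex_ofReal,
      norm_mul, ← intervalIntegral.integral_of_le (by linarith), Complex.norm_real]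
    exact mul_le_mul (abs_integral_dirichletKer_le hR hδ0.le)
      (norm_logGammaIntegrand_le ha hζ (by simp)) (norm_nonneg _) (by norm_num)
  have hiD : Integrable fun v => (dirichletKer R v : ℂ) * g v := by
    refine hint.bdd_mul (c := 2 * R) (by fun_prop) (Eventually.of_forall fun v => ?_)
    rw [Complex.norm_real, dirichletKer, norm_mul, Real.norm_of_nonneg (by positivity)]
    exact mul_le_of_le_one_right (by positivity) (Real.abs_sinc_le_one _)
  have hbound : ∀ v, ‖(dirichletKer R v : ℂ) * g v - c v‖
      ≤ M1 v + M2 v + M3 v + M3 (-v) := by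
    intro v
    have hD := abs_dirichletKer_mul_le R v
    have hM1v : 0 ≤ M1 v := by positivity
    by_cases hv : v ∈ Set.Ioc (-δ) δ
    · have hv1 : |v| ≤ 1 := (abs_le.2 ⟨hv.1.le, hv.2⟩).trans hδ1
      have h1 : ‖(dirichletKer R v : ℂ) * g v - c v‖ ≤ M2 v := by
        rw [hc, Set.indicator_of_mem hv, hM2, Set.indicator_of_mem hv, ← mul_sub, norm_mul,
          Complex.norm_real, Real.norm_eq_abs]
        calc _ ≤ |dirichletKer R v| * (L * |v|) :=
              mul_le_mul_of_nonneg_left (norm_logGammaIntegrand_sub_le ha hζ hv1) (abs_nonneg _)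
          _ = |dirichletKer R v| * |v| * L := by ring
          _ ≤ 2 * L := mul_le_mul_of_nonneg_right hD hL0
      linarith [hM3pos v, hM3pos (-v)]
    · rw [hc, Set.indicator_of_notMem hv, sub_zero, norm_mul, Complex.norm_real, Real.norm_eq_abs]
      have hv0 : v ≠ 0 := by rintro rfl; exact hv ⟨by linarith, hδ0.le⟩
      have hvp : 0 < |v| := abs_pos.2 hv0
      rw [← le_div_iff₀ hvp] at hD
      rcases le_or_gt |v| 1 with h1 | h1
      · have h2 : |dirichletKer R v| * ‖g v‖ ≤ 2 * Real.exp a * |v|⁻¹ := by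
          calc _ ≤ 2 / |v| * Real.exp a := mul_le_mul hD (norm_logGammaIntegrand_le ha hζ h1)
                (norm_nonneg _) (by positivity)
            _ = _ := by ring
        rcases lt_or_gt_of_ne hv0 with h3 | h3
        · have : -v ∈ Set.Icc δ 1 := by
            rw [abs_of_neg h3] at h1
            refine ⟨?_, h1⟩
            by_contra h5
            exact hv ⟨by linarith, by linarith⟩
          have h6 : M3 (-v) = 2 * Real.exp a * |v|⁻¹ := by
            rw [hM3, Set.indicator_of_mem this, abs_of_neg h3]
          linarith [hM3pos v, hM2pos v]
        · have : v ∈ Set.Icc δ 1 := by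
            rw [abs_of_pos h3] at h1
            refine ⟨?_, h1⟩
            by_contra h5
            exact hv ⟨by linarith, by linarith⟩
          have h6 : M3 v = 2 * Real.exp a * |v|⁻¹ := by
            rw [hM3, Set.indicator_of_mem this, abs_of_pos h3]
          linarith [hM3pos (-v), hM2pos v]
      · have h2 : |dirichletKer R v| * ‖g v‖ ≤ M1 v := by
          refine mul_le_mul_of_nonneg_right (hD.trans ?_) (norm_nonneg _)
          rw [div_le_iff₀ hvp]; linarith
        linarith [hM3pos v, hM3pos (-v), hM2pos v]
  have hmain : ‖∫ v, (dirichletKer R v : ℂ) * g v‖ ≤ 2 * (Real.Gamma a * ζ.re ^ (-a)) + 4 * δ * L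
      + 2 * (2 * Real.exp a * Real.log (1 + ‖ζ‖)) + 16 * Real.exp a := by
    have h1 : ∫ v, (dirichletKer R v : ℂ) * g v
        = (∫ v, ((dirichletKer R v : ℂ) * g v - c v)) + ∫ v, c v := by
      rw [integral_sub hiD hic]; ring
    rw [h1]
    refine (norm_add_le _ _).trans ?_
    have h2 := norm_integral_le_of_norm_le (((hi1.add hi2).add hi3).add hi3')
      (Eventually.of_forall hbound)
    have h3 : ∫ v, (((M1 + M2) + M3) + fun v => M3 (-v)) v = 2 * (Real.Gamma a * ζ.re ^ (-a))
        + 4 * δ * L + 2 * (2 * Real.exp a * Real.log (1 + ‖ζ‖)) := by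
      rw [integral_add' ((hi1.add hi2).add hi3) hi3', integral_add' (hi1.add hi2) hi3,
        integral_add' hi1 hi2, hj1, hj2, hj3, hj3']
      ring
    rw [h3] at h2
    linarith
  have hδL : δ * L ≤ (a + Real.exp 1) * Real.exp a := by
    rw [hδ, inv_mul_le_iff₀ (by positivity), hL, ← mul_assoc]
    refine mul_le_mul_of_nonneg_right ?_ (Real.exp_pos a).le
    nlinarith [norm_nonneg ζ, Real.exp_pos 1, mul_nonneg (norm_nonneg ζ) ha.le]
  rw [truncGammaInv_eq_integral_dirichletKer ha hζ hR, norm_mul, norm_inv, Complex.norm_real,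
    Real.norm_of_nonneg (by positivity)]
  have hpi : (2 * Real.pi)⁻¹ ≤ 1 := inv_le_one_of_one_le₀ (by linarith [Real.pi_gt_three])
  refine (mul_le_of_le_one_left (norm_nonneg _) hpi).trans (hmain.trans ?_)
  have hx : 0 ≤ ζ.re ^ (-a) := by positivity
  have hl : 0 ≤ Real.log (1 + ‖ζ‖) := Real.log_nonneg (by linarith [norm_nonneg ζ])
  have hG := Real.Gamma_pos_of_pos ha
  have he := Real.exp_pos a
  have he1 : 0 ≤ (a + Real.exp 1) * Real.exp a := by positivity
  nlinarith [mul_nonneg hG.le hl, mul_nonneg he1 hx, mul_nonneg he1 hl, mul_nonneg he.le hx,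
    mul_nonneg he.le hl, hG.le]

/-! ### The positive part as a Laplace inversion integral -/

/-- The parametrization of the vertical line `Re z = 1`. -/
noncomputable def unitLine (y : ℝ) : ℂ := 1 + y * Complex.I

theorem unitLine_re (y : ℝ) : (unitLine y).re = 1 := by simp [unitLine]

theorem unitLine_ne_zero (y : ℝ) : unitLine y ≠ 0 := by
  intro h
  have := congrArg Complex.re h
  simp [unitLine_re] at this

theorem continuous_unitLine : Continuous unitLine := by unfold unitLine; fun_prop

theorem norm_unitLine (y : ℝ) : ‖unitLine y‖ = (1 + ‖y‖ ^ 2) ^ (1 / 2 : ℝ) := by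
  rw [← Real.sqrt_eq_rpow, Complex.norm_def, Complex.normSq_apply]
  simp [unitLine, sq]

theorem one_le_norm_unitLine (y : ℝ) : 1 ≤ ‖unitLine y‖ := by
  have := Complex.abs_re_le_norm (unitLine y)
  simpa [unitLine_re] using this

theorem integrable_norm_unitLine_rpow {s : ℝ} (hs : 1 < s) :
    Integrable fun y => ‖unitLine y‖ ^ (-s) := by
  have h := integrable_rpow_neg_one_add_norm_sq (E := ℝ) (μ := volume) (r := s) (by simpa using hs)
  refine h.congr (Eventually.of_forall fun y => ?_)
  simp only
  rw [norm_unitLine, ← Real.rpow_mul (by positivity)]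
  ring_nf

theorem continuous_inv_unitLine_sq : Continuous fun y => (unitLine y ^ 2)⁻¹ :=
  (continuous_unitLine.pow 2).inv₀ fun y => pow_ne_zero 2 (unitLine_ne_zero y)

theorem integrable_inv_unitLine_sq : Integrable fun y => (unitLine y ^ 2)⁻¹ := by
  refine (integrable_norm_unitLine_rpow one_lt_two).mono'
    continuous_inv_unitLine_sq.aestronglyMeasurable (Eventually.of_forall fun y => ?_)
  rw [norm_inv, norm_pow, Real.rpow_neg (norm_nonneg _), Real.rpow_two]

open Complex in
open scoped FourierTransform in
/-- The Laplace transform of `v ↦ v⁺` is `z⁻²`. -/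
theorem integral_exp_unitLine_eq_max (x : ℝ) :
    ((2 * Real.pi : ℝ) : ℂ)⁻¹ * ∫ y, cexp (unitLine y * x) * (unitLine y ^ 2)⁻¹
      = ((max x 0 : ℝ) : ℂ) := by
  set F : ℝ → ℂ := fun v => ((max v 0 * Real.exp (-v) : ℝ) : ℂ) with hF
  have hFc : Continuous F := by rw [hF]; fun_prop
  have hlap : ∀ z : ℂ, 0 < z.re →
      IntegrableOn (fun v : ℝ => (v : ℂ) * cexp (-(z * v))) (Set.Ioi 0) ∧
      ∫ v in Set.Ioi (0 : ℝ), (v : ℂ) * cexp (-(z * v)) = (z ^ 2)⁻¹ := by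
    intro z hz
    have h1 := integrableOn_cpow_mul_exp_neg_mul (w := 2) (by simp) hz
    have h2 := integral_cpow_mul_exp_neg_mul_of_re_pos (w := 2) (by simp) hz
    rw [show (2 : ℂ) - 1 = 1 by norm_num] at h1 h2
    simp only [cpow_one] at h1 h2
    refine ⟨h1, h2.trans ?_⟩
    rw [show Gamma 2 = 1 by simp, one_mul, cpow_neg]
    norm_num
  have hind : ∀ (G : ℝ → ℂ), (fun v => G v * F v)
      = (Set.Ioi (0 : ℝ)).indicator fun v => (v : ℂ) * (G v * cexp (-v)) := by
    intro G
    ext v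
    by_cases hv : v ∈ Set.Ioi (0 : ℝ)
    · rw [Set.indicator_of_mem hv, hF]
      simp only
      rw [max_eq_left (Set.mem_Ioi.1 hv).le]
      push_cast
      ring
    · rw [Set.indicator_of_notMem hv, hF]
      simp only
      rw [max_eq_right (not_lt.1 hv)]
      simp
  have hFi : Integrable F := by
    have h1 := hind fun _ => 1
    simp only [one_mul] at h1
    rw [show F = fun v => F v from rfl, h1, integrable_indicator_iff measurableSet_Ioi]
    simpa using (hlap 1 (by simp)).1
  have hFour : 𝓕 F = fun w => (unitLine (2 * Real.pi * w) ^ 2)⁻¹ := by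
    ext w
    rw [Real.fourier_real_eq_integral_exp_smul]
    simp only [smul_eq_mul]
    rw [hind, integral_indicator measurableSet_Ioi,
      ← (hlap (unitLine (2 * Real.pi * w)) (by simp [unitLine_re])).2]
    refine setIntegral_congr_fun measurableSet_Ioi fun v _ => ?_
    rw [← Complex.exp_add, unitLine]
    congr 2
    push_cast
    ring
  have h2pi : 2 * Real.pi ≠ 0 := by positivity
  have hFFi : Integrable (𝓕 F) := by
    rw [hFour]
    exact integrable_inv_unitLine_sq.comp_mul_left' h2pi
  have hinv := congrFun (hFc.fourierInv_fourier_eq hFi hFFi) x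
  rw [Real.fourierInv_eq', hFour] at hinv
  have hscale := Measure.integral_comp_mul_left
    (fun y : ℝ => cexp (unitLine y * x) * (unitLine y ^ 2)⁻¹) (2 * Real.pi)
  rw [abs_of_pos (by positivity), real_smul, ofReal_inv] at hscale
  rw [← hscale]
  have hmul : ∀ w : ℝ, cexp (unitLine (2 * Real.pi * w) * x) * (unitLine (2 * Real.pi * w) ^ 2)⁻¹
      = (Real.exp x : ℂ) * (cexp (((2 * Real.pi * inner ℝ w x : ℝ) : ℂ) * I) •
        (unitLine (2 * Real.pi * w) ^ 2)⁻¹) := by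
    intro w
    rw [smul_eq_mul, ← mul_assoc, ofReal_exp, ← Complex.exp_add]
    congr 2
    simp [unitLine]
    ring
  simp_rw [hmul]
  rw [integral_const_mul, hinv, hF]
  simp only
  rw [← ofReal_mul, mul_left_comm, ← Real.exp_add]
  simp

theorem integrable_max_sub_mul {X : Type*} [MeasurableSpace X] {ν : Measure X} {L : X → ℝ}
    (hL : Measurable L) {g : X → ℂ} (hgm : AEStronglyMeasurable g ν)
    (hg : Integrable (fun x => (Real.exp (-L x) : ℂ) * g x) ν) (K : ℝ) :
    Integrable (fun x => ((max (K - L x) 0 : ℝ) : ℂ) * g x) ν := by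
  refine (hg.const_mul (Real.exp K : ℂ)).mono ?_ (Eventually.of_forall fun x => ?_)
  · refine AEStronglyMeasurable.mul ?_ hgm
    exact (Measurable.aestronglyMeasurable (by fun_prop))
  · rw [← mul_assoc, ← Complex.ofReal_mul, ← Real.exp_add, norm_mul, norm_mul, Complex.norm_real,
      Complex.norm_real, Real.norm_of_nonneg (by positivity), Real.norm_of_nonneg (by positivity)]
    refine mul_le_mul_of_nonneg_right ?_ (norm_nonneg _)
    refine max_le ?_ (Real.exp_pos _).le
    have := Real.add_one_le_exp (K - L x)
    rw [← sub_eq_add_neg]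
    linarith

open Complex in
/-- By `integral_exp_unitLine_eq_max` and Fubini, the integral of `(K - L)⁺ g` is a superposition of
the integrals of `e^{-zL} g`, `Re z = 1`. -/
theorem integral_max_sub_mul_eq {X : Type*} [MeasurableSpace X] {ν : Measure X} [SFinite ν]
    {L : X → ℝ} (hL : Measurable L) {g : X → ℂ} (hgm : AEStronglyMeasurable g ν)
    (hg : Integrable (fun x => (Real.exp (-L x) : ℂ) * g x) ν) (K : ℝ) :
    ∫ x, ((max (K - L x) 0 : ℝ) : ℂ) * g x ∂ν = ((2 * Real.pi : ℝ) : ℂ)⁻¹ *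
      ∫ y, cexp (unitLine y * K) * (unitLine y ^ 2)⁻¹ *
        ∫ x, cexp (-(unitLine y * L x)) * g x ∂ν := by
  simp_rw [← integral_exp_unitLine_eq_max, mul_assoc]
  rw [integral_const_mul]
  congr 1
  simp_rw [← integral_mul_const, ← integral_const_mul]
  have heq : ∀ (x : X) (y : ℝ), cexp (unitLine y * ((K - L x : ℝ) : ℂ)) * (unitLine y ^ 2)⁻¹ * g x
      = cexp (unitLine y * K) * ((unitLine y ^ 2)⁻¹ * (cexp (-(unitLine y * L x)) * g x)) := by
    intro x y
    have : unitLine y * ((K - L x : ℝ) : ℂ) = unitLine y * K + -(unitLine y * L x) := by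
      push_cast; ring
    rw [this, Complex.exp_add]
    ring
  rw [integral_integral_swap]
  · simp_rw [heq]
  · have h := (hg.mul_prod integrable_inv_unitLine_sq).const_mul (Real.exp K : ℂ)
    refine h.mono ?_ (Eventually.of_forall fun p => ?_)
    · have hu := continuous_unitLine.measurable
      have h1 : Measurable fun p : X × ℝ =>
          cexp (unitLine p.2 * ((K - L p.1 : ℝ) : ℂ)) * (unitLine p.2 ^ 2)⁻¹ := by fun_prop
      exact h1.aestronglyMeasurable.mul hgm.comp_fst
    · simp only [Function.uncurry, norm_mul]
      rw [Complex.norm_exp, Complex.re_mul_ofReal, unitLine_re, one_mul, sub_eq_add_neg,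
        Real.exp_add]
      simp only [Complex.norm_real, Real.norm_of_nonneg (Real.exp_pos _).le]
      exact le_of_eq (by ring)

/-! ### The Mellin transform of the payoff -/

theorem prod_cpow_eq {ι : Type*} {s : Finset ι} {z : ℂ} (hz : z ≠ 0) (w : ι → ℂ) :
    ∏ j ∈ s, z ^ w j = z ^ ∑ j ∈ s, w j := by
  simp_rw [Complex.cpow_def_of_ne_zero hz, ← Complex.exp_sum, ← Finset.mul_sum]

theorem posOrthant_eq_pi (n : ℕ) : posOrthant n = Set.univ.pi fun _ => Set.Ioi (0 : ℝ) := by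
  ext x; simp [posOrthant]

theorem volume_restrict_posOrthant (n : ℕ) : (volume : Measure (Fin n → ℝ)).restrict (posOrthant n)
    = Measure.pi fun _ => volume.restrict (Set.Ioi (0 : ℝ)) := by
  rw [posOrthant_eq_pi, volume_pi, Measure.restrict_pi_pi]

theorem measurableSet_posOrthant (n : ℕ) : MeasurableSet (posOrthant n) := by
  rw [posOrthant_eq_pi]
  exact MeasurableSet.univ_pi fun _ => measurableSet_Ioi

theorem aestronglyMeasurable_prod_cpow {n : ℕ} (w : Fin n → ℂ) :
    AEStronglyMeasurable (fun x : Fin n → ℝ => ∏ i, (x i : ℂ) ^ (w i))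
      (volume.restrict (posOrthant n)) := by
  refine ContinuousOn.aestronglyMeasurable ?_ (measurableSet_posOrthant n)
  refine continuousOn_finsetProd _ fun i _ => fun x hx => ContinuousAt.continuousWithinAt ?_
  exact ContinuousAt.comp (f := fun x : Fin n → ℝ => x i)
    (Complex.continuousAt_ofReal_cpow_const _ _ (Or.inr (hx i).ne'))
    (continuous_apply i).continuousAt

open Complex in
theorem integrable_exp_mul_prod_cpow {n : ℕ} {w : Fin n → ℂ} (hw : ∀ j, 0 < (w j).re)
    {z : ℂ} (hz : 0 < z.re) :
    IntegrableOn (fun x : Fin n → ℝ => cexp (-(z * (∑ i, x i : ℝ))) * ∏ i, (x i : ℂ) ^ (w i - 1))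
      (posOrthant n) ∧
    ∫ x in posOrthant n, cexp (-(z * (∑ i, x i : ℝ))) * ∏ i, (x i : ℂ) ^ (w i - 1)
      = (∏ j, Gamma (w j)) * z ^ (-∑ j, w j) := by
  have hz0 : z ≠ 0 := by rintro rfl; simp at hz
  have heq : (fun x : Fin n → ℝ => cexp (-(z * (∑ i, x i : ℝ))) * ∏ i, (x i : ℂ) ^ (w i - 1))
      = fun x => ∏ i, ((x i : ℂ) ^ (w i - 1) * cexp (-(z * x i))) := by
    ext x
    rw [Finset.prod_mul_distrib, ← Complex.exp_sum, mul_comm]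
    push_cast
    rw [Finset.mul_sum, Finset.sum_neg_distrib]
  rw [heq, IntegrableOn, volume_restrict_posOrthant]
  refine ⟨Integrable.fintype_prod (f := fun i (u : ℝ) => (u : ℂ) ^ (w i - 1) * cexp (-(z * u)))
    fun i => integrableOn_cpow_mul_exp_neg_mul (hw i) hz, ?_⟩
  rw [integral_fintype_prod_eq_prod (fun i (u : ℝ) => (u : ℂ) ^ (w i - 1) * cexp (-(z * u)))]
  simp_rw [fun i => integral_cpow_mul_exp_neg_mul_of_re_pos (hw i) hz]
  rw [Finset.prod_mul_distrib, ← Finset.sum_neg_distrib, prod_cpow_eq hz0]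

/-- The kernel `(2π)⁻¹ ∫ e^{zK} z^{-2-s} dy` over the line `z = 1 + iy`. Its value is
`K^{s+1} / Γ(s+2)`, but only its product with `Γ(s)` is ever needed. -/
noncomputable def laplaceInvPow (K : ℝ) (s : ℂ) : ℂ :=
  ((2 * Real.pi : ℝ) : ℂ)⁻¹ *
    ∫ y, Complex.exp (unitLine y * K) * (unitLine y ^ 2)⁻¹ * unitLine y ^ (-s)

open Complex in
/-- The case of one asset: the Mellin transform of `(K - x)⁺` is elementary. -/
theorem Gamma_mul_laplaceInvPow {K : ℝ} (hK : 0 < K) {s : ℂ} (hs : 0 < s.re) :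
    Gamma s * laplaceInvPow K s = (K : ℂ) ^ (1 + s) / (s * (s + 1)) := by
  have hs0 : s ≠ 0 := by rintro rfl; simp at hs
  have hs1 : s + 1 ≠ 0 := by
    intro h
    have := congrArg Complex.re h
    simp at this
    linarith
  have hpow : ∀ r : ℂ, AEStronglyMeasurable (fun x : ℝ => (x : ℂ) ^ r)
      (volume.restrict (Set.Ioi 0)) := fun r =>
    ContinuousOn.aestronglyMeasurable (fun x hx => (Complex.continuousAt_ofReal_cpow_const _ _
      (Or.inr (ne_of_gt hx))).continuousWithinAt) measurableSet_Ioi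
  have h := integral_max_sub_mul_eq (ν := volume.restrict (Set.Ioi (0 : ℝ))) (L := fun x => x)
    measurable_id (g := fun x : ℝ => (x : ℂ) ^ (s - 1)) (hpow _) (by
      have := integrableOn_cpow_mul_exp_neg_mul (w := s) (ζ := 1) hs (by simp)
      refine Integrable.congr this (Eventually.of_forall fun x => ?_)
      simp [mul_comm]) K
  have hin : ∀ y : ℝ, ∫ x in Set.Ioi (0 : ℝ), cexp (-(unitLine y * x)) * (x : ℂ) ^ (s - 1)
      = Gamma s * unitLine y ^ (-s) := by
    intro y
    rw [← integral_cpow_mul_exp_neg_mul_of_re_pos hs (by simp [unitLine_re])]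
    simp_rw [mul_comm (cexp _)]
  simp_rw [hin] at h
  have h2 : Gamma s * laplaceInvPow K s
      = ∫ x in Set.Ioi (0 : ℝ), ((max (K - x) 0 : ℝ) : ℂ) * (x : ℂ) ^ (s - 1) := by
    rw [h, laplaceInvPow, mul_left_comm, ← integral_const_mul]
    congr 2
    ext y
    ring
  rw [h2]
  have h3 : ∫ x in Set.Ioi (0 : ℝ), ((max (K - x) 0 : ℝ) : ℂ) * (x : ℂ) ^ (s - 1)
      = ∫ x in (0 : ℝ)..K, ((K : ℂ) * (x : ℂ) ^ (s - 1) - (x : ℂ) ^ s) := by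
    rw [intervalIntegral.integral_of_le hK.le,
      setIntegral_eq_of_subset_of_forall_sdiff_eq_zero measurableSet_Ioi Set.Ioc_subset_Ioi_self]
    · refine setIntegral_congr_fun measurableSet_Ioc fun x hx => ?_
      have hx0 : (x : ℂ) ≠ 0 := by exact_mod_cast hx.1.ne'
      rw [max_eq_left (by linarith [hx.2]), Complex.cpow_sub _ _ hx0, cpow_one]
      push_cast
      field_simp
    · intro x hx
      have : K < x := by
        by_contra hcon
        exact hx.2 ⟨hx.1, not_lt.1 hcon⟩
      rw [max_eq_right (by linarith)]
      simp
  rw [h3, intervalIntegral.integral_sub, intervalIntegral.integral_const_mul,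
    integral_cpow (Or.inl (by simpa using hs)), integral_cpow (Or.inl (by linarith))]
  · have hK0 : (K : ℂ) ≠ 0 := by exact_mod_cast hK.ne'
    rw [sub_add_cancel, ofReal_zero, zero_cpow hs0, zero_cpow hs1, add_comm 1 s,
      cpow_add _ _ hK0, cpow_one]
    field_simp
    ring
  · exact (intervalIntegral.intervalIntegrable_cpow' (by simpa using hs)).const_mul _
  · exact intervalIntegral.intervalIntegrable_cpow' (by linarith)

open Complex in
theorem mellinTransformConvergent_putPayoff {n : ℕ} (K : ℝ) {w : Fin n → ℂ}
    (hw : ∀ j, 0 < (w j).re) :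
    MellinTransformConvergent (fun S => (putPayoff K S : ℂ)) w := by
  refine integrable_max_sub_mul (L := fun x : Fin n → ℝ => ∑ i, x i) (by fun_prop)
    (aestronglyMeasurable_prod_cpow _) ?_ K
  simpa [IntegrableOn] using (integrable_exp_mul_prod_cpow hw (z := 1) (by simp)).1

open Complex in
theorem payoffMellin_eq_mul_laplaceInvPow {n : ℕ} (K : ℝ) {w : Fin n → ℂ}
    (hw : ∀ j, 0 < (w j).re) :
    payoffMellin K w = (∏ j, Gamma (w j)) * laplaceInvPow K (∑ j, w j) := by
  have h := integral_max_sub_mul_eq (ν := volume.restrict (posOrthant n))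
    (L := fun x : Fin n → ℝ => ∑ i, x i) (by fun_prop)
    (aestronglyMeasurable_prod_cpow fun i => w i - 1)
    (by simpa [IntegrableOn] using (integrable_exp_mul_prod_cpow hw (z := 1) (by simp)).1) K
  rw [payoffMellin, mellinTransform]
  refine Eq.trans h ?_
  simp_rw [fun y => (integrable_exp_mul_prod_cpow hw (z := unitLine y) (by simp [unitLine_re])).2]
  rw [laplaceInvPow, mul_left_comm]
  congr 1
  rw [← integral_const_mul]
  refine integral_congr_ae (Eventually.of_forall fun y => ?_)
  simp only
  ring

open Complex in
theorem payoffMellin_eq {n : ℕ} (hn : 0 < n) {K : ℝ} (hK : 0 < K) {w : Fin n → ℂ}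
    (hw : ∀ j, 0 < (w j).re) :
    payoffMellin K w =
      multinomialBeta w * (K : ℂ) ^ (1 + ∑ j, w j) / ((∑ j, w j) * (∑ j, w j + 1)) := by
  have hs : 0 < (∑ j, w j).re := by
    rw [Complex.re_sum]
    exact Finset.sum_pos (fun j _ => hw j) ⟨⟨0, hn⟩, Finset.mem_univ _⟩
  rw [payoffMellin_eq_mul_laplaceInvPow K hw, multinomialBeta, mul_div_assoc,
    ← Gamma_mul_laplaceInvPow hK hs]
  have := Gamma_ne_zero_of_re_pos hs
  field_simp

/-! ### Truncated Mellin inversion of the payoff -/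

open Complex in
theorem ofReal_mul_cpow {x : ℝ} (hx : 0 < x) {z : ℂ} (hz : z ≠ 0) (w : ℂ) :
    (z * x) ^ w = z ^ w * (x : ℂ) ^ w := by
  have hx0 : (x : ℂ) ≠ 0 := by exact_mod_cast hx.ne'
  rw [cpow_def_of_ne_zero (mul_ne_zero hz hx0), cpow_def_of_ne_zero hz, cpow_def_of_ne_zero hx0,
    mul_comm z, log_ofReal_mul hx hz, ofReal_log hx.le, ← Complex.exp_add]
  ring_nf

theorem contourPoint_re {n : ℕ} (a b : Fin n → ℝ) (j : Fin n) : (contourPoint a b j).re = a j := by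
  simp [contourPoint]

theorem unitLine_mul_re (y x : ℝ) : (unitLine y * x).re = x := by
  rw [Complex.re_mul_ofReal, unitLine_re, one_mul]

/-- The integrand of the double integral over the contour and the line `Re z = 1` which represents
the truncated inverse Mellin transform of the payoff. -/
noncomputable def doubleIntegrand {n : ℕ} (K : ℝ) (a x b : Fin n → ℝ) (y : ℝ) : ℂ :=
  Complex.exp (unitLine y * K) * (unitLine y ^ 2)⁻¹ *
    ∏ j, (Complex.Gamma ((a j : ℂ) + b j * Complex.I) *
      (unitLine y * x j) ^ (-((a j : ℂ) + b j * Complex.I)))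

open Complex in
theorem mellinInvIntegrand_payoffMellin_eq {n : ℕ} (K : ℝ) {a x : Fin n → ℝ}
    (ha : ∀ j, 0 < a j) (hx : x ∈ posOrthant n) (b : Fin n → ℝ) :
    mellinInvIntegrand a (payoffMellin K) x b
      = ((2 * Real.pi : ℝ) : ℂ)⁻¹ * ∫ y, doubleIntegrand K a x b y := by
  rw [mellinInvIntegrand, payoffMellin_eq_mul_laplaceInvPow K (fun j => by
    rw [contourPoint_re]; exact ha j), laplaceInvPow]
  rw [mul_left_comm, mul_assoc]
  congr 1
  rw [← integral_const_mul, ← integral_mul_const]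
  refine integral_congr_ae (Eventually.of_forall fun y => ?_)
  simp only [doubleIntegrand]
  simp_rw [fun j w => ofReal_mul_cpow (hx j) (unitLine_ne_zero y) w]
  rw [Finset.prod_mul_distrib, Finset.prod_mul_distrib, prod_cpow_eq (unitLine_ne_zero y)]
  simp only [contourPoint, Finset.sum_neg_distrib]
  ring

open Complex in
theorem norm_doubleIntegrand_le {n : ℕ} (K : ℝ) {a x : Fin n → ℝ}
    (ha : ∀ j, 0 < a j) (hx : x ∈ posOrthant n) (b : Fin n → ℝ) (y : ℝ) :
    ‖doubleIntegrand K a x b y‖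
      ≤ (Real.exp K * ∏ j, (Real.Gamma (a j) * x j ^ (-a j))) * ‖(unitLine y ^ 2)⁻¹‖ := by
  have h : ‖∏ j, (Gamma ((a j : ℂ) + b j * I) * (unitLine y * x j) ^ (-((a j : ℂ) + b j * I)))‖
      ≤ ∏ j, (Real.Gamma (a j) * x j ^ (-a j)) := by
    rw [norm_prod]
    refine Finset.prod_le_prod (fun _ _ => norm_nonneg _) fun j _ => ?_
    have := norm_Gamma_mul_cpow_le (w := (a j : ℂ) + b j * I) (ζ := unitLine y * x j)
      (by simpa using ha j) (by rw [unitLine_mul_re]; exact hx j)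
    rw [unitLine_mul_re] at this
    simpa using this
  rw [doubleIntegrand, norm_mul, norm_mul, Complex.norm_exp, unitLine_mul_re]
  calc _ ≤ Real.exp K * ‖(unitLine y ^ 2)⁻¹‖ * ∏ j, (Real.Gamma (a j) * x j ^ (-a j)) := by
        gcongr
    _ = _ := by ring

open Complex in
theorem continuous_doubleIntegrand {n : ℕ} (K : ℝ) {a x : Fin n → ℝ}
    (ha : ∀ j, 0 < a j) (hx : x ∈ posOrthant n) :
    Continuous fun p : (Fin n → ℝ) × ℝ => doubleIntegrand K a x p.1 p.2 := by
  unfold doubleIntegrand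
  have hu := continuous_unitLine
  refine Continuous.mul (Continuous.mul (by fun_prop)
    (continuous_inv_unitLine_sq.comp continuous_snd)) ?_
  refine continuous_finsetProd _ fun j _ => Continuous.mul ?_ ?_
  · exact (continuous_Gamma_line (ha j)).comp
      (g := fun b : ℝ => Gamma ((a j : ℂ) + b * I)) (f := fun p : (Fin n → ℝ) × ℝ => p.1 j)
      (by fun_prop)
  · refine Continuous.cpow (by fun_prop) (by fun_prop) fun p => Or.inl ?_
    rw [unitLine_mul_re]
    exact hx j

theorem integrable_doubleIntegrand {n : ℕ} (K : ℝ) {a x : Fin n → ℝ}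
    (ha : ∀ j, 0 < a j) (hx : x ∈ posOrthant n) (R : Fin n → ℝ) :
    Integrable (Function.uncurry (doubleIntegrand K a x))
      ((volume.restrict (Set.Icc (-R) R)).prod volume) := by
  have h1 : Integrable (fun _ : Fin n → ℝ => Real.exp K * ∏ j, (Real.Gamma (a j) * x j ^ (-a j)))
      (volume.restrict (Set.Icc (-R) R)) := continuous_const.integrableOn_Icc
  refine (h1.mul_prod integrable_inv_unitLine_sq.norm).mono'
    (continuous_doubleIntegrand K ha hx).aestronglyMeasurable
    (Eventually.of_forall fun p => norm_doubleIntegrand_le K ha hx p.1 p.2)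

theorem volume_restrict_Icc_pi {n : ℕ} (A B : Fin n → ℝ) :
    (volume : Measure (Fin n → ℝ)).restrict (Set.Icc A B)
      = Measure.pi fun j => volume.restrict (Set.Icc (A j) (B j)) := by
  rw [← Set.pi_univ_Icc, volume_pi, Measure.restrict_pi_pi]

/-- The truncation `(2π)⁻ⁿ ∫_{∏ [-Rⱼ, Rⱼ]} θ̂(a + ib) x^{-(a + ib)} db` of the inverse Mellin
transform of the payoff. -/
noncomputable def truncPayoffInv {n : ℕ} (K : ℝ) (a R x : Fin n → ℝ) : ℂ :=
  ((2 * Real.pi : ℝ) : ℂ)⁻¹ ^ n *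
    ∫ b in Set.Icc (-R) R, mellinInvIntegrand a (payoffMellin K) x b

/-- What is left of `doubleIntegrand` after the integration over the box, as a function on the line
`Re z = 1`. -/
noncomputable def truncIntegrand {n : ℕ} (K : ℝ) (a R x : Fin n → ℝ) (y : ℝ) : ℂ :=
  Complex.exp (unitLine y * K) * (unitLine y ^ 2)⁻¹ *
    ∏ j, truncGammaInv (a j) (R j) (unitLine y * x j)

theorem integral_doubleIntegrand_eq {n : ℕ} (K : ℝ) (a R x : Fin n → ℝ) (y : ℝ) :
    ((2 * Real.pi : ℝ) : ℂ)⁻¹ ^ n * ∫ b in Set.Icc (-R) R, doubleIntegrand K a x b y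
      = truncIntegrand K a R x y := by
  unfold doubleIntegrand truncIntegrand truncGammaInv
  rw [integral_const_mul, volume_restrict_Icc_pi]
  rw [integral_fintype_prod_eq_prod (fun j (b : ℝ) => Complex.Gamma ((a j : ℂ) + b * Complex.I) *
      (unitLine y * x j) ^ (-((a j : ℂ) + b * Complex.I))), Finset.prod_mul_distrib,
    Finset.prod_const, Finset.card_univ, Fintype.card_fin]
  simp only [Pi.neg_apply]
  ring

/-- In the double integral, the integral over the box is a product of one-dimensional integrals. -/
theorem truncPayoffInv_eq_integral {n : ℕ} (K : ℝ) {a x : Fin n → ℝ}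
    (ha : ∀ j, 0 < a j) (hx : x ∈ posOrthant n) (R : Fin n → ℝ) :
    truncPayoffInv K a R x = ((2 * Real.pi : ℝ) : ℂ)⁻¹ * ∫ y, truncIntegrand K a R x y := by
  rw [truncPayoffInv]
  simp_rw [mellinInvIntegrand_payoffMellin_eq K ha hx, ← integral_doubleIntegrand_eq]
  rw [integral_const_mul, integral_integral_swap (integrable_doubleIntegrand K ha hx R),
    integral_const_mul]
  ring

theorem integrable_truncIntegrand {n : ℕ} (K : ℝ) {a x : Fin n → ℝ}
    (ha : ∀ j, 0 < a j) (hx : x ∈ posOrthant n) (R : Fin n → ℝ) :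
    Integrable (truncIntegrand K a R x) := by
  have := (integrable_doubleIntegrand K ha hx R).integral_prod_right
  refine (this.const_mul (((2 * Real.pi : ℝ) : ℂ)⁻¹ ^ n)).congr (Eventually.of_forall fun y => ?_)
  simp only [Function.uncurry]
  exact integral_doubleIntegrand_eq K a R x y

/-- The weight which dominates the truncated inverse Mellin transforms of the payoff. -/
noncomputable def dominatingWeight {n : ℕ} (a x : Fin n → ℝ) : ℝ :=
  ∏ j, (1 + x j ^ (-a j) + x j)

theorem dominatingWeight_nonneg {n : ℕ} (a : Fin n → ℝ) {x : Fin n → ℝ} (hx : x ∈ posOrthant n) :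
    0 ≤ dominatingWeight a x :=
  Finset.prod_nonneg fun j _ => by
    have := hx j
    positivity

/-- The logarithm in the bound of each of the `n` factors is at most a multiple of
`|z|^ε (1 + xⱼ)`; as `n ε ≤ 1/2`, the product still leaves an integrable power of `|z|`. -/
theorem exists_norm_truncIntegrand_le {n : ℕ} (K : ℝ) {a : Fin n → ℝ} (ha : ∀ j, 0 < a j) :
    ∃ C : ℝ, 0 ≤ C ∧ ∀ R : Fin n → ℝ, 0 ≤ R → ∀ x ∈ posOrthant n, ∀ y,
      ‖truncIntegrand K a R x y‖
        ≤ C * dominatingWeight a x * ‖unitLine y‖ ^ (-(3 / 2) : ℝ) := by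
  choose C hC0 hC using fun j => exists_norm_truncGammaInv_le (ha j)
  set ε : ℝ := 1 / (2 * (n + 1)) with hε
  have hε0 : 0 < ε := by positivity
  set A : ℝ := 1 + 1 / ε with hA
  have hA1 : 1 ≤ A := by rw [hA]; linarith [one_div_pos.2 hε0]
  refine ⟨Real.exp K * ∏ j, (C j * A), ?_, fun R hR x hx y => ?_⟩
  · exact mul_nonneg (Real.exp_pos _).le (Finset.prod_nonneg fun j _ =>
      mul_nonneg (hC0 j) (by linarith))
  set Z := ‖unitLine y‖ with hZ
  have hZ1 : 1 ≤ Z := one_le_norm_unitLine y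
  have hZε : 1 ≤ Z ^ ε := Real.one_le_rpow hZ1 hε0.le
  have hfactor : ∀ j, ‖truncGammaInv (a j) (R j) (unitLine y * x j)‖
      ≤ C j * A * (1 + x j ^ (-a j) + x j) * Z ^ ε := by
    intro j
    have hxj := hx j
    have h := hC j (R j) (hR j) (unitLine y * x j) (by rw [unitLine_mul_re]; exact hxj)
    rw [unitLine_mul_re, norm_mul, Complex.norm_real, Real.norm_of_nonneg hxj.le, ← hZ] at h
    have hlog : Real.log (1 + Z * x j) ≤ Z ^ ε / ε + x j := by
      calc Real.log (1 + Z * x j) ≤ Real.log (Z * (1 + x j)) := by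
            refine Real.log_le_log (by positivity) ?_
            nlinarith
        _ = Real.log Z + Real.log (1 + x j) := Real.log_mul (by positivity) (by positivity)
        _ ≤ Z ^ ε / ε + x j := by
            refine add_le_add (Real.log_le_rpow_div (by linarith) hε0) ?_
            have := Real.log_le_sub_one_of_pos (show 0 < 1 + x j by positivity)
            linarith
    have hp : 0 ≤ x j ^ (-a j) := by positivity
    have hsum : 1 + x j ^ (-a j) + Real.log (1 + Z * x j)
        ≤ A * (1 + x j ^ (-a j) + x j) * Z ^ ε := by
      have h1 : 1 + x j ^ (-a j) + x j + Z ^ ε / ε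
          ≤ (1 + x j ^ (-a j) + x j) * Z ^ ε + (1 + x j ^ (-a j) + x j) * Z ^ ε / ε := by
        refine add_le_add ?_ ?_
        · exact le_mul_of_one_le_right (by positivity) hZε
        · gcongr
          exact le_mul_of_one_le_left (by positivity) (by linarith)
      have h2 : A * (1 + x j ^ (-a j) + x j) * Z ^ ε
          = (1 + x j ^ (-a j) + x j) * Z ^ ε + (1 + x j ^ (-a j) + x j) * Z ^ ε / ε := by
        rw [hA]; ring
      linarith
    calc _ ≤ C j * (1 + x j ^ (-a j) + Real.log (1 + Z * x j)) := h
      _ ≤ C j * (A * (1 + x j ^ (-a j) + x j) * Z ^ ε) := mul_le_mul_of_nonneg_left hsum (hC0 j)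
      _ = _ := by ring
  have hprod : ‖∏ j, truncGammaInv (a j) (R j) (unitLine y * x j)‖
      ≤ (∏ j, (C j * A)) * dominatingWeight a x * Z ^ (1 / 2 : ℝ) := by
    rw [norm_prod]
    refine (Finset.prod_le_prod (fun _ _ => norm_nonneg _) fun j _ => hfactor j).trans ?_
    rw [Finset.prod_mul_distrib, Finset.prod_mul_distrib, Finset.prod_const, Finset.card_univ,
      Fintype.card_fin, ← dominatingWeight]
    refine mul_le_mul_of_nonneg_left ?_ (mul_nonneg (Finset.prod_nonneg fun j _ =>
      mul_nonneg (hC0 j) (by linarith)) (dominatingWeight_nonneg a hx))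
    rw [← Real.rpow_natCast, ← Real.rpow_mul (by linarith)]
    refine Real.rpow_le_rpow_of_exponent_le hZ1 ?_
    rw [hε, div_mul_eq_mul_div, div_le_div_iff₀ (by positivity) two_pos]
    linarith
  rw [truncIntegrand, norm_mul, norm_mul, Complex.norm_exp, unitLine_mul_re, norm_inv, norm_pow,
    ← hZ]
  have hZ2 : (Z ^ 2)⁻¹ * Z ^ (1 / 2 : ℝ) = Z ^ (-(3 / 2) : ℝ) := by
    rw [← Real.rpow_natCast, ← Real.rpow_neg (by linarith), ← Real.rpow_add (by linarith)]
    norm_num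
  calc _ ≤ Real.exp K * (Z ^ 2)⁻¹ *
        ((∏ j, (C j * A)) * dominatingWeight a x * Z ^ (1 / 2 : ℝ)) := by gcongr
    _ = Real.exp K * (∏ j, (C j * A)) * dominatingWeight a x * ((Z ^ 2)⁻¹ * Z ^ (1 / 2 : ℝ)) := by
        ring
    _ = _ := by rw [hZ2]

theorem integrable_unitLine_majorant : Integrable fun y => ‖unitLine y‖ ^ (-(3 / 2) : ℝ) :=
  integrable_norm_unitLine_rpow (by norm_num)

theorem exists_norm_truncPayoffInv_le {n : ℕ} (K : ℝ) {a : Fin n → ℝ} (ha : ∀ j, 0 < a j) :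
    ∃ C : ℝ, ∀ R : Fin n → ℝ, 0 ≤ R → ∀ x ∈ posOrthant n,
      ‖truncPayoffInv K a R x‖ ≤ C * dominatingWeight a x := by
  obtain ⟨C, hC0, hC⟩ := exists_norm_truncIntegrand_le K ha
  refine ⟨‖((2 * Real.pi : ℝ) : ℂ)⁻¹‖ * (C * ∫ y, ‖unitLine y‖ ^ (-(3 / 2) : ℝ)),
    fun R hR x hx => ?_⟩
  rw [truncPayoffInv_eq_integral K ha hx, norm_mul, mul_assoc]
  refine mul_le_mul_of_nonneg_left ?_ (norm_nonneg _)
  refine (norm_integral_le_of_norm_le (integrable_unitLine_majorant.const_mul _)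
    (Eventually.of_forall (hC R hR x hx))).trans (le_of_eq ?_)
  rw [integral_const_mul]
  ring

theorem atTop_le_pi_atTop {n : ℕ} :
    (atTop : Filter (Fin n → ℝ)) ≤ Filter.pi fun _ => atTop := by
  refine le_iInf fun j => tendsto_iff_comap.1 (tendsto_atTop.2 fun b => ?_)
  filter_upwards [eventually_ge_atTop fun _ => b] with R hR using hR j

theorem eventually_nonneg_pi_atTop {n : ℕ} :
    ∀ᶠ R in Filter.pi fun _ : Fin n => (atTop : Filter ℝ), 0 ≤ R := by
  have : ∀ j : Fin n, ∀ᶠ R in Filter.pi fun _ : Fin n => (atTop : Filter ℝ), 0 ≤ R j :=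
    fun j => (Filter.tendsto_eval_pi _ j).eventually (eventually_ge_atTop 0)
  filter_upwards [eventually_all.2 this] with R hR using hR

/-- Mellin inversion for the payoff holds at every point, as a limit over boxes. -/
theorem tendsto_truncPayoffInv {n : ℕ} (K : ℝ) {a x : Fin n → ℝ} (ha : ∀ j, 0 < a j)
    (hx : x ∈ posOrthant n) :
    Tendsto (fun R => truncPayoffInv K a R x) (Filter.pi fun _ => atTop)
      (𝓝 (putPayoff K x : ℂ)) := by
  obtain ⟨C, hC0, hC⟩ := exists_norm_truncIntegrand_le K ha
  have hlim : (putPayoff K x : ℂ) = ((2 * Real.pi : ℝ) : ℂ)⁻¹ *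
      ∫ y, Complex.exp (unitLine y * K) * (unitLine y ^ 2)⁻¹ *
        ∏ j, Complex.exp (-(unitLine y * x j)) := by
    rw [putPayoff, ← integral_exp_unitLine_eq_max]
    congr 1
    refine integral_congr_ae (Eventually.of_forall fun y => ?_)
    simp only
    rw [← Complex.exp_sum, Finset.sum_neg_distrib, ← Finset.mul_sum, mul_right_comm,
      ← Complex.exp_add]
    push_cast
    ring_nf
  rw [hlim]
  simp_rw [truncPayoffInv_eq_integral K ha hx]
  refine Tendsto.const_mul _ (tendsto_integral_filter_of_dominated_convergence
    (fun y => C * dominatingWeight a x * ‖unitLine y‖ ^ (-(3 / 2) : ℝ))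
    (Eventually.of_forall fun R => (integrable_truncIntegrand K ha hx R).aestronglyMeasurable)
    ?_ (integrable_unitLine_majorant.const_mul _) (Eventually.of_forall fun y => ?_))
  · filter_upwards [eventually_nonneg_pi_atTop] with R hR
    exact Eventually.of_forall (hC R hR x hx)
  · refine Tendsto.const_mul _ (tendsto_finsetProd _ fun j _ => ?_)
    exact (tendsto_truncGammaInv (ha j) (by rw [unitLine_mul_re]; exact hx j)).comp
      (Filter.tendsto_eval_pi _ j)

/-! ### Exponential moments of Gaussian vectors -/

section Gaussian

variable {Ω : Type*} [MeasurableSpace Ω] {P : Measure Ω} {n : ℕ}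

theorem hasGaussianLaw_sum_mul {Z : Fin n → Ω → ℝ} (hZ : HasGaussianLaw (fun ω i => Z i ω) P)
    (α : Fin n → ℝ) : HasGaussianLaw (fun ω => ∑ j, α j * Z j ω) P := by
  have h := hZ.map_fun (∑ j, α j • ContinuousLinearMap.proj (R := ℝ) (φ := fun _ : Fin n => ℝ) j)
  simpa using h

/-- The covariance form `∑ Cᵢⱼ uᵢ vⱼ`. -/
noncomputable def covForm (C : Matrix (Fin n) (Fin n) ℝ) (u v : Fin n → ℂ) : ℂ :=
  ∑ i, ∑ j, (C i j : ℂ) * u i * v j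

/-- `Z` is a centred Gaussian vector with covariance matrix `C`. -/
structure IsCenteredGaussian (Z : Fin n → Ω → ℝ) (C : Matrix (Fin n) (Fin n) ℝ)
    (P : Measure Ω) : Prop where
  gaussian : HasGaussianLaw (fun ω i => Z i ω) P
  mean : ∀ i, ∫ ω, Z i ω ∂P = 0
  cov : ∀ i j, covariance (Z i) (Z j) P = C i j

variable {Z : Fin n → Ω → ℝ} {C : Matrix (Fin n) (Fin n) ℝ}

namespace IsCenteredGaussian

theorem memLp_two (h : IsCenteredGaussian Z C P) (i : Fin n) : MemLp (Z i) 2 P :=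
  (h.gaussian.eval i).memLp_two

theorem symm (h : IsCenteredGaussian Z C P) (i j : Fin n) : C i j = C j i := by
  rw [← h.cov, ← h.cov, covariance_comm]

theorem map_sum_mul (h : IsCenteredGaussian Z C P) (α : Fin n → ℝ) :
    P.map (fun ω => ∑ j, α j * Z j ω)
      = gaussianReal 0 (∑ i, ∑ j, C i j * α i * α j).toNNReal := by
  have := h.gaussian.isProbabilityMeasure
  rw [(hasGaussianLaw_sum_mul h.gaussian α).map_eq_gaussianReal]
  congr 1
  · rw [integral_finsetSum _ fun j _ => ((h.gaussian.eval j).integrable).const_mul _]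
    simp_rw [integral_const_mul, h.mean]
    simp
  · congr 1
    rw [variance_fun_sum fun j => (h.memLp_two j).const_mul _]
    refine Finset.sum_congr rfl fun i _ => Finset.sum_congr rfl fun j _ => ?_
    rw [covariance_const_mul_left, covariance_const_mul_right, h.cov]
    ring

theorem sum_mul_nonneg (h : IsCenteredGaussian Z C P) (α : Fin n → ℝ) :
    0 ≤ ∑ i, ∑ j, C i j * α i * α j := by
  have := h.gaussian.isProbabilityMeasure
  have hv := variance_nonneg (fun ω => ∑ j, α j * Z j ω) P
  rw [variance_fun_sum fun j => (h.memLp_two j).const_mul _] at hv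
  refine hv.trans (le_of_eq (Finset.sum_congr rfl fun i _ => Finset.sum_congr rfl fun j _ => ?_))
  rw [covariance_const_mul_left, covariance_const_mul_right, h.cov]
  ring

theorem integrable_exp_sum (h : IsCenteredGaussian Z C P) (α : Fin n → ℝ) :
    Integrable (fun ω => Real.exp (∑ j, α j * Z j ω)) P := by
  have hm := h.map_sum_mul α
  have := integrable_exp_mul_gaussianReal (μ := 0)
    (v := (∑ i, ∑ j, C i j * α i * α j).toNNReal) 1
  rw [← hm, integrable_map_measure (by fun_prop)
    (hasGaussianLaw_sum_mul h.gaussian α).aemeasurable] at this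
  simpa [Function.comp_def] using this

theorem integral_exp_sum (h : IsCenteredGaussian Z C P) (α : Fin n → ℝ) :
    ∫ ω, Real.exp (∑ j, α j * Z j ω) ∂P = Real.exp ((∑ i, ∑ j, C i j * α i * α j) / 2) := by
  have := mgf_gaussianReal (h.map_sum_mul α) 1
  rw [mgf] at this
  simpa [Real.coe_toNNReal _ (h.sum_mul_nonneg α)] using this

open Complex in
/-- The exponential moments of a Gaussian vector at complex arguments: under the law tilted by the
exponential with the real parts of the coefficients, the linear combination with the imaginary
parts has the real moment generating function of a Gaussian variable, hence also its complex one. -/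
theorem integral_cexp_sum (h : IsCenteredGaussian Z C P) (u : Fin n → ℂ) :
    Integrable (fun ω => cexp (∑ j, u j * Z j ω)) P ∧
      ∫ ω, cexp (∑ j, u j * Z j ω) ∂P = cexp (covForm C u u / 2) := by
  have hP := h.gaussian.isProbabilityMeasure
  set α : Fin n → ℝ := fun j => (u j).re with hα
  set β : Fin n → ℝ := fun j => (u j).im with hβ
  set A : Ω → ℝ := fun ω => ∑ j, α j * Z j ω with hA
  set B : Ω → ℝ := fun ω => ∑ j, β j * Z j ω with hB
  have hAm : AEMeasurable A P := (hasGaussianLaw_sum_mul h.gaussian α).aemeasurable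
  have hBm : AEMeasurable B P := (hasGaussianLaw_sum_mul h.gaussian β).aemeasurable
  have hsplit : ∀ ω, cexp (∑ j, u j * Z j ω) = (Real.exp (A ω) : ℂ) * cexp (I * B ω) := by
    intro ω
    rw [ofReal_exp, ← Complex.exp_add]
    congr 1
    rw [hA, hB]
    push_cast
    rw [Finset.mul_sum, ← Finset.sum_add_distrib]
    refine Finset.sum_congr rfl fun j _ => ?_
    conv_lhs => rw [← re_add_im (u j)]
    ring
  have hint : Integrable (fun ω => cexp (∑ j, u j * Z j ω)) P := by
    refine (h.integrable_exp_sum α).mono ?_ (Eventually.of_forall fun ω => ?_)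
    · simp_rw [hsplit]
      exact AEMeasurable.aestronglyMeasurable (by fun_prop)
    · rw [hsplit, norm_mul, mul_comm I, norm_exp_ofReal_mul_I, mul_one, norm_real]
  refine ⟨hint, ?_⟩
  set vA : ℝ := ∑ i, ∑ j, C i j * α i * α j with hvA
  set vB : ℝ := ∑ i, ∑ j, C i j * β i * β j with hvB
  set cAB : ℝ := ∑ i, ∑ j, C i j * α i * β j with hcAB
  have hcsym : ∑ i, ∑ j, C i j * β i * α j = cAB := by
    rw [Finset.sum_comm]
    refine Finset.sum_congr rfl fun i _ => Finset.sum_congr rfl fun j _ => ?_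
    rw [h.symm]; ring
  have hquad : ∀ t : ℝ, ∑ i, ∑ j, C i j * (α i + t * β i) * (α j + t * β j)
      = vA + 2 * t * cAB + t ^ 2 * vB := by
    intro t
    have h1 : ∀ i j, C i j * (α i + t * β i) * (α j + t * β j)
        = C i j * α i * α j + t * (C i j * α i * β j) + t * (C i j * β i * α j)
          + t ^ 2 * (C i j * β i * β j) := fun i j => by ring
    simp_rw [h1, Finset.sum_add_distrib, ← Finset.mul_sum]
    rw [hcsym]
    ring
  have hAi := h.integrable_exp_sum α
  have hAv : ∫ ω, Real.exp (A ω) ∂P = Real.exp (vA / 2) := h.integral_exp_sum α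
  set Q : Measure Ω := P.tilted A with hQ
  have hQp : IsProbabilityMeasure Q := isProbabilityMeasure_tilted hAi
  have hBQ : AEMeasurable B Q := hBm.mono_ac (tilted_absolutelyContinuous P A)
  have hmgf : mgf B Q = mgf id (gaussianReal cAB vB.toNNReal) := by
    ext t
    rw [mgf_id_gaussianReal, mgf, hQ, integral_tilted]
    simp_rw [hAv, smul_eq_mul, div_mul_eq_mul_div, ← Real.exp_add]
    rw [integral_div]
    have h2 : ∀ ω, A ω + t * B ω = ∑ j, (α j + t * β j) * Z j ω := by
      intro ω
      rw [hA, hB]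
      simp only
      rw [Finset.mul_sum, ← Finset.sum_add_distrib]
      exact Finset.sum_congr rfl fun j _ => by ring
    simp_rw [h2]
    rw [h.integral_exp_sum, hquad, ← Real.exp_sub, Real.coe_toNNReal _ (h.sum_mul_nonneg β)]
    congr 1
    ring
  have hset : integrableExpSet B Q = Set.univ := by
    rw [integrableExpSet_eq_of_mgf hmgf, integrableExpSet_id_gaussianReal]
  have hcm := eqOn_complexMGF_of_mgf hmgf (show I ∈ {z : ℂ | z.re ∈ interior (integrableExpSet B Q)}
    by rw [hset]; simp)
  rw [complexMGF_id_gaussianReal, complexMGF, hQ, integral_tilted] at hcm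
  simp_rw [hAv] at hcm
  have h3 : ∫ ω, cexp (∑ j, u j * Z j ω) ∂P
      = (Real.exp (vA / 2) : ℂ) *
        ∫ ω, (Real.exp (A ω) / Real.exp (vA / 2)) • cexp (I * B ω) ∂P := by
    rw [← integral_const_mul]
    refine integral_congr_ae (Eventually.of_forall fun ω => ?_)
    simp only
    rw [hsplit, real_smul, ofReal_div]
    have : (Real.exp (vA / 2) : ℂ) ≠ 0 := by exact_mod_cast (Real.exp_pos _).ne'
    field_simp
  rw [h3, hcm, ofReal_exp, ← Complex.exp_add, Real.coe_toNNReal vB (h.sum_mul_nonneg β)]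
  congr 1
  have h4 : covForm C u u = vA + 2 * I * cAB + I ^ 2 * vB := by
    have h1 : ∀ i j, (C i j : ℂ) * u i * u j
        = ((C i j * α i * α j : ℝ) : ℂ) + I * ((C i j * α i * β j : ℝ) : ℂ)
          + I * ((C i j * β i * α j : ℝ) : ℂ) + I ^ 2 * ((C i j * β i * β j : ℝ) : ℂ) := by
      intro i j
      conv_lhs => rw [← re_add_im (u i), ← re_add_im (u j)]
      push_cast
      ring
    rw [covForm]
    simp_rw [h1, Finset.sum_add_distrib, ← Finset.mul_sum]
    simp_rw [← ofReal_sum]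
    rw [hcsym]
    ring
  rw [h4]
  push_cast
  ring

/-- Exponential moments of all orders of the sum of the absolute values. -/
theorem integrable_exp_mul_sum_abs (h : IsCenteredGaussian Z C P) (m : ℝ) :
    Integrable (fun ω => Real.exp (m * ∑ j, |Z j ω|)) P := by
  have hZm : ∀ j, AEMeasurable (Z j) P := fun j => (h.gaussian.eval j).aemeasurable
  -- `e^{m ∑ |Zⱼ|}` is at most the sum over all sign patterns of `e^{∑ ± |m| Zⱼ}`
  have hi : Integrable (fun ω => ∑ s : Fin n → Bool,
      Real.exp (∑ j, (if s j then |m| else -|m|) * Z j ω)) P :=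
    integrable_finsetSum _ fun s _ => h.integrable_exp_sum _
  refine hi.mono' (AEMeasurable.aestronglyMeasurable (by fun_prop))
    (Eventually.of_forall fun ω => ?_)
  rw [Real.norm_of_nonneg (Real.exp_pos _).le]
  set s : Fin n → Bool := fun j => decide (0 ≤ Z j ω) with hs
  refine le_trans ?_ (Finset.single_le_sum (f := fun s : Fin n → Bool =>
      Real.exp (∑ j, (if s j then |m| else -|m|) * Z j ω))
    (fun s _ => (Real.exp_pos _).le) (Finset.mem_univ s))
  rw [Real.exp_le_exp, Finset.mul_sum]
  refine Finset.sum_le_sum fun j _ => ?_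
  simp only [hs, decide_eq_true_eq]
  split_ifs with h0
  · rw [abs_of_nonneg h0]
    exact mul_le_mul_of_nonneg_right (le_abs_self m) h0
  · rw [abs_of_neg (not_le.1 h0)]
    nlinarith [le_abs_self m, not_le.1 h0]

end IsCenteredGaussian

/-! ### The log-price process -/

namespace IsCorrelatedBrownian

variable {ρ : Matrix (Fin n) (Fin n) ℝ} {W : Fin n → ℝ≥0 → Ω → ℝ}

theorem memLp_two (hW : IsCorrelatedBrownian W ρ P) (i : Fin n) (t : ℝ≥0) : MemLp (W i t) 2 P :=
  (hW.gaussian.hasGaussianLaw_eval (i, t)).memLp_two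

theorem integral_eq_zero (hW : IsCorrelatedBrownian W ρ P) (i : Fin n) (t : ℝ≥0) :
    ∫ ω, W i t ω ∂P = 0 :=
  (hW.brownian i).toIsPreBrownianReal.integral_eval t

theorem corr_self (hW : IsCorrelatedBrownian W ρ P) (i : Fin n) : ρ i i = 1 := by
  have h1 := hW.covariance_eq i i 1 1
  rw [(hW.brownian i).toIsPreBrownianReal.covariance_eval] at h1
  simpa using h1.symm

theorem isCenteredGaussian (hW : IsCorrelatedBrownian W ρ P) (σ : Fin n → ℝ) (t : ℝ≥0) :
    IsCenteredGaussian (fun i ω => σ i * W i t ω) ((t : ℝ) • covMatrix ρ σ) P where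
  gaussian := by
    have h := (hW.gaussian.comp_right fun i : Fin n => (i, t)).smul σ
    have h2 := (h.hasGaussianLaw Finset.univ).map_fun
      (ContinuousLinearMap.pi fun i : Fin n => ContinuousLinearMap.proj (R := ℝ)
        (φ := fun _ : (Finset.univ : Finset (Fin n)) => ℝ) ⟨i, Finset.mem_univ i⟩)
    simpa using h2
  mean i := by rw [integral_const_mul, hW.integral_eq_zero, mul_zero]
  cov i j := by
    rw [covariance_const_mul_left, covariance_const_mul_right]
    have := hW.covariance_eq i j t t
    rw [min_self] at this
    rw [this, Matrix.smul_apply, covMatrix, Matrix.of_apply, smul_eq_mul]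
    ring

theorem isCenteredGaussian_sub (hW : IsCorrelatedBrownian W ρ P) (σ : Fin n → ℝ) {t T : ℝ≥0}
    (htT : t ≤ T) : IsCenteredGaussian (fun i ω => σ i * (W i T ω - W i t ω))
      (((T - t : ℝ≥0) : ℝ) • covMatrix ρ σ) P where
  gaussian := by
    have h : IsGaussianProcess (fun (i : Fin n) ω => σ i * (W i T ω - W i t ω)) P :=
      hW.gaussian.of_isGaussianProcess fun i => by
        classical
        exact ⟨{(i, T), (i, t)}, σ i • (ContinuousLinearMap.proj (R := ℝ)
          (φ := fun _ : ({(i, T), (i, t)} : Finset (Fin n × ℝ≥0)) => ℝ) ⟨(i, T), by simp⟩ -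
          ContinuousLinearMap.proj (R := ℝ)
          (φ := fun _ : ({(i, T), (i, t)} : Finset (Fin n × ℝ≥0)) => ℝ) ⟨(i, t), by simp⟩),
          fun ω => by simp⟩
    have h2 := (h.hasGaussianLaw Finset.univ).map_fun
      (ContinuousLinearMap.pi fun i : Fin n => ContinuousLinearMap.proj (R := ℝ)
        (φ := fun _ : (Finset.univ : Finset (Fin n)) => ℝ) ⟨i, Finset.mem_univ i⟩)
    simpa using h2
  mean i := by
    rw [integral_const_mul, integral_sub, hW.integral_eq_zero, hW.integral_eq_zero, sub_zero,
      mul_zero]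
    · exact (hW.gaussian.hasGaussianLaw_eval (i, T)).integrable
    · exact (hW.gaussian.hasGaussianLaw_eval (i, t)).integrable
  cov i j := by
    have := hW.gaussian.isProbabilityMeasure
    rw [covariance_const_mul_left, covariance_const_mul_right, covariance_fun_sub_fun_sub
      (hW.memLp_two i T) (hW.memLp_two i t) (hW.memLp_two j T) (hW.memLp_two j t)]
    have h : ∀ s u, covariance (fun ω => W i s ω) (fun ω => W j u ω) P
        = ρ i j * ((min s u : ℝ≥0) : ℝ) := hW.covariance_eq i j
    rw [h, h, h, h, min_self, min_self, min_eq_right htT, min_eq_left htT, Matrix.smul_apply,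
      covMatrix, Matrix.of_apply, smul_eq_mul, NNReal.coe_sub htT]
    ring

end IsCorrelatedBrownian

open Complex in
theorem covForm_smul (c : ℝ) (M : Matrix (Fin n) (Fin n) ℝ) (u v : Fin n → ℂ) :
    covForm (c • M) u v = c * covForm M u v := by
  simp only [covForm, Matrix.smul_apply, smul_eq_mul, Finset.mul_sum]
  push_cast
  simp_rw [mul_assoc]

open Complex in
/-- The value of `E exp(i u'Y)` for a Gaussian vector `Y` with mean `τ μ` and covariance matrix
`τ M`. -/
theorem charFn_of_isCenteredGaussian {μ : Fin n → ℝ} {τ : ℝ} {M : Matrix (Fin n) (Fin n) ℝ}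
    (h : IsCenteredGaussian Z (τ • M) P) (u : Fin n → ℂ) :
    Integrable (fun ω => cexp (I * ∑ j, u j * ((μ j * τ + Z j ω : ℝ) : ℂ))) P ∧
      ∫ ω, cexp (I * ∑ j, u j * ((μ j * τ + Z j ω : ℝ) : ℂ)) ∂P
        = cexp (-(τ : ℂ) * charExponent M μ u) := by
  obtain ⟨h1, h2⟩ := h.integral_cexp_sum fun j => I * u j
  have heq : ∀ ω, cexp (I * ∑ j, u j * ((μ j * τ + Z j ω : ℝ) : ℂ))
      = cexp (τ * (I * ∑ j, (μ j : ℂ) * u j)) * cexp (∑ j, I * u j * Z j ω) := by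
    intro ω
    rw [← Complex.exp_add]
    congr 1
    push_cast
    rw [Finset.mul_sum, Finset.mul_sum, Finset.mul_sum, ← Finset.sum_add_distrib]
    exact Finset.sum_congr rfl fun j _ => by ring
  simp_rw [heq]
  refine ⟨h1.const_mul _, ?_⟩
  rw [integral_const_mul, h2, ← Complex.exp_add, covForm_smul]
  congr 1
  have h3 : covForm M (fun j => I * u j) (fun j => I * u j) = -covForm M u u := by
    simp only [covForm, ← Finset.sum_neg_distrib]
    refine Finset.sum_congr rfl fun i _ => Finset.sum_congr rfl fun j _ => ?_
    linear_combination ((M i j : ℂ) * u i * u j) * I_sq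
  rw [h3, charExponent, ← covForm]
  ring

theorem charFn_driftedBrownian {ρ : Matrix (Fin n) (Fin n) ℝ} {W : Fin n → ℝ≥0 → Ω → ℝ}
    (hW : IsCorrelatedBrownian W ρ P) (μ σ : Fin n → ℝ) (u : Fin n → ℂ) (t : ℝ≥0) :
    Integrable (fun ω => Complex.exp (Complex.I *
      ∑ j, u j * (driftedBrownian W μ σ t ω j : ℂ))) P ∧
    charFn P (driftedBrownian W μ σ) u t
      = Complex.exp (-(t : ℂ) * charExponent (covMatrix ρ σ) μ u) :=
  charFn_of_isCenteredGaussian (hW.isCenteredGaussian σ t) u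

/-- The increments of the log-price process over `[t, T]` have the law of its value at `T - t`. -/
theorem charFn_increment {ρ : Matrix (Fin n) (Fin n) ℝ} {W : Fin n → ℝ≥0 → Ω → ℝ}
    (hW : IsCorrelatedBrownian W ρ P) (μ σ : Fin n → ℝ) (u : Fin n → ℂ) {t T : ℝ≥0}
    (htT : t ≤ T) :
    Integrable (fun ω => Complex.exp (Complex.I * ∑ j, u j *
      ((driftedBrownian W μ σ T ω j - driftedBrownian W μ σ t ω j : ℝ) : ℂ))) P ∧
    ∫ ω, Complex.exp (Complex.I * ∑ j, u j *
      ((driftedBrownian W μ σ T ω j - driftedBrownian W μ σ t ω j : ℝ) : ℂ)) ∂P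
      = charFn P (driftedBrownian W μ σ) u (T - t) := by
  have h := charFn_of_isCenteredGaussian (μ := μ) (hW.isCenteredGaussian_sub σ htT) u
  rw [(charFn_driftedBrownian hW μ σ u (T - t)).2]
  have heq : ∀ ω j, driftedBrownian W μ σ T ω j - driftedBrownian W μ σ t ω j
      = μ j * ((T - t : ℝ≥0) : ℝ) + σ j * (W j T ω - W j t ω) := by
    intro ω j
    rw [NNReal.coe_sub htT, driftedBrownian, driftedBrownian]
    ring
  simp_rw [heq]
  exact h

end Gaussian

/-! ### The pricing formula -/

section Pricing

variable {Ω : Type*} [MeasurableSpace Ω] {P : Measure Ω} {n : ℕ}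

theorem norm_mellinInvIntegrand_payoffMellin_le (K : ℝ) {a : Fin n → ℝ} (ha : ∀ j, 0 < a j) :
    ∃ C : ℝ, 0 ≤ C ∧ ∀ x ∈ posOrthant n, ∀ b,
      ‖mellinInvIntegrand a (payoffMellin K) x b‖ ≤ C * ∏ j, x j ^ (-a j) := by
  refine ⟨‖((2 * Real.pi : ℝ) : ℂ)⁻¹‖ * (Real.exp K * (∏ j, Real.Gamma (a j)) *
    ∫ y, ‖(unitLine y ^ 2)⁻¹‖), ?_, fun x hx b => ?_⟩
  · have h1 : 0 ≤ ∏ j, Real.Gamma (a j) :=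
      Finset.prod_nonneg fun j _ => (Real.Gamma_pos_of_pos (ha j)).le
    have h2 : 0 ≤ ∫ y, ‖(unitLine y ^ 2)⁻¹‖ := integral_nonneg fun y => norm_nonneg _
    positivity
  · rw [mellinInvIntegrand_payoffMellin_eq K ha hx, norm_mul, mul_assoc]
    refine mul_le_mul_of_nonneg_left ?_ (norm_nonneg _)
    refine (norm_integral_le_of_norm_le (integrable_inv_unitLine_sq.norm.const_mul _)
      (Eventually.of_forall (norm_doubleIntegrand_le K ha hx b))).trans (le_of_eq ?_)
    rw [integral_const_mul, Finset.prod_mul_distrib]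
    ring

theorem continuous_payoffMellin_contour (K : ℝ) {a : Fin n → ℝ} (ha : ∀ j, 0 < a j) :
    Continuous fun b => payoffMellin K (contourPoint a b) := by
  have hx : (fun _ : Fin n => (1 : ℝ)) ∈ posOrthant n := fun _ => one_pos
  have h1 : ∀ b, payoffMellin K (contourPoint a b)
      = mellinInvIntegrand a (payoffMellin K) (fun _ => 1) b := by
    intro b
    simp [mellinInvIntegrand]
  simp_rw [h1, mellinInvIntegrand_payoffMellin_eq K ha hx]
  refine continuous_const.mul (continuous_of_dominated (F := doubleIntegrand K a _) (fun b => ?_)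
    (fun b => Eventually.of_forall (norm_doubleIntegrand_le K ha hx b))
    (integrable_inv_unitLine_sq.norm.const_mul _) (Eventually.of_forall fun y => ?_))
  · have h := (continuous_doubleIntegrand K ha hx).comp (f := fun y : ℝ => (b, y)) (by fun_prop)
    exact h.aestronglyMeasurable
  · exact (continuous_doubleIntegrand K ha hx).comp (f := fun b : Fin n → ℝ => (b, y))
      (by fun_prop)

theorem continuous_prod_cpow_contour (a : Fin n → ℝ) {S : Fin n → ℝ} (hS : S ∈ posOrthant n) :
    Continuous fun b => ∏ j, (S j : ℂ) ^ (-(contourPoint a b j)) := by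
  refine continuous_finsetProd _ fun j _ => ?_
  refine Continuous.const_cpow (by unfold contourPoint; fun_prop) (Or.inl ?_)
  exact_mod_cast (hS j).ne'

theorem mul_exp_mem_posOrthant {S : Fin n → ℝ} (hS : S ∈ posOrthant n) (v : Fin n → ℝ) :
    (fun i => S i * Real.exp (v i)) ∈ posOrthant n := fun i => mul_pos (hS i) (Real.exp_pos _)

open Complex in
theorem prod_mul_exp_cpow {S : Fin n → ℝ} (hS : S ∈ posOrthant n) (v : Fin n → ℝ)
    (w : Fin n → ℂ) : ∏ j, ((S j * Real.exp (v j) : ℝ) : ℂ) ^ (-(w j))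
      = cexp (-∑ j, w j * v j) * ∏ j, (S j : ℂ) ^ (-(w j)) := by
  rw [← Finset.sum_neg_distrib, Complex.exp_sum, ← Finset.prod_mul_distrib]
  refine Finset.prod_congr rfl fun j _ => ?_
  rw [ofReal_mul, mul_comm, mul_comm (cexp _), mul_comm, mul_cpow_ofReal_nonneg (hS j).le
    (Real.exp_pos _).le, cpow_def_of_ne_zero (x := ((Real.exp (v j) : ℝ) : ℂ))
    (by exact_mod_cast (Real.exp_pos _).ne'), ← ofReal_log (Real.exp_pos _).le, Real.log_exp]
  ring_nf

/-- The weight of `dominatingWeight` along the asset prices grows at most exponentially in the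
log-returns. -/
theorem dominatingWeight_mul_exp_le {a S : Fin n → ℝ} (ha : ∀ j, 0 < a j)
    (hS : S ∈ posOrthant n) (v : Fin n → ℝ) :
    dominatingWeight a (fun i => S i * Real.exp (v i))
      ≤ dominatingWeight a S * Real.exp ((1 + ∑ j, a j) * ∑ j, |v j|) := by
  rw [Finset.mul_sum, Real.exp_sum, dominatingWeight, dominatingWeight, ← Finset.prod_mul_distrib]
  refine Finset.prod_le_prod (fun j _ => ?_) fun j _ => ?_
  · have := hS j
    positivity
  have hSj := hS j
  have hm : a j ≤ ∑ i, a i := Finset.single_le_sum (fun i _ => (ha i).le) (Finset.mem_univ j)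
  set m := 1 + ∑ i, a i with hmdef
  have hv := abs_nonneg (v j)
  have hmv : 0 ≤ m * |v j| := mul_nonneg (by linarith [ha j]) hv
  have h1 : 1 ≤ Real.exp (m * |v j|) := Real.one_le_exp hmv
  have h2 : Real.exp (v j) ≤ Real.exp (m * |v j|) := by
    rw [Real.exp_le_exp]
    nlinarith [le_abs_self (v j), ha j]
  have h3 : Real.exp (v j) ^ (-a j) ≤ Real.exp (m * |v j|) := by
    rw [← Real.exp_mul, Real.exp_le_exp]
    nlinarith [neg_abs_le (v j), ha j]
  rw [Real.mul_rpow hSj.le (Real.exp_pos _).le]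
  have h4 : 0 < S j ^ (-a j) := by positivity
  nlinarith [mul_le_mul_of_nonneg_left h2 hSj.le, mul_le_mul_of_nonneg_left h3 h4.le]

open Complex in
/-- Mellin inversion under an expectation: for a random vector `Y` with exponential moments, the
truncated inverse Mellin transforms of `θ̂(w) E[e^{-w·Y}]` converge to the expected payoff. -/
theorem tendsto_integral_box {Y : Fin n → Ω → ℝ} [IsProbabilityMeasure P]
    (hY : ∀ j, AEMeasurable (Y j) P)
    (hexp : ∀ m : ℝ, Integrable (fun ω => Real.exp (m * ∑ j, |Y j ω|)) P) (K : ℝ)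
    {a S : Fin n → ℝ} (ha : ∀ j, 0 < a j) (hS : S ∈ posOrthant n) :
    Tendsto (fun R : Fin n → ℝ => ((2 * Real.pi : ℝ) : ℂ)⁻¹ ^ n * ∫ b in Set.Icc (-R) R,
        mellinInvIntegrand a
          (fun w => payoffMellin K w * ∫ ω, cexp (-∑ j, w j * Y j ω) ∂P) S b)
      atTop (𝓝 ((∫ ω, putPayoff K (fun i => S i * Real.exp (Y i ω)) ∂P : ℝ) : ℂ)) := by
  set x : Ω → Fin n → ℝ := fun ω i => S i * Real.exp (Y i ω) with hx
  have hxpos : ∀ ω, x ω ∈ posOrthant n := fun ω => mul_exp_mem_posOrthant hS fun i => Y i ω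
  have hint1 : ∀ b, mellinInvIntegrand a
      (fun w => payoffMellin K w * ∫ ω, cexp (-∑ j, w j * Y j ω) ∂P) S b
        = ∫ ω, mellinInvIntegrand a (payoffMellin K) (x ω) b ∂P := by
    intro b
    simp only [mellinInvIntegrand, hx]
    simp_rw [fun ω => prod_mul_exp_cpow hS (fun i => Y i ω) (contourPoint a b)]
    rw [integral_const_mul, integral_mul_const]
    ring
  obtain ⟨C, hC0, hC⟩ := norm_mellinInvIntegrand_payoffMellin_le K ha
  have hdom : Integrable (fun ω => dominatingWeight a (x ω)) P := by
    refine ((hexp (1 + ∑ j, a j)).const_mul (dominatingWeight a S)).mono'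
      (AEMeasurable.aestronglyMeasurable ?_) (Eventually.of_forall fun ω => ?_)
    · simp only [dominatingWeight, hx]
      fun_prop
    · rw [Real.norm_of_nonneg (dominatingWeight_nonneg a (hxpos ω))]
      exact dominatingWeight_mul_exp_le ha hS fun j => Y j ω
  have hF : ∀ R : Fin n → ℝ,
      Integrable (fun p : (Fin n → ℝ) × Ω => mellinInvIntegrand a (payoffMellin K) (x p.2) p.1)
        ((volume.restrict (Set.Icc (-R) R)).prod P) := by
    intro R
    have h1 : Integrable (fun _ : Fin n → ℝ => C) (volume.restrict (Set.Icc (-R) R)) :=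
      continuous_const.integrableOn_Icc
    refine (h1.mul_prod hdom).mono' ?_ (Eventually.of_forall fun p => ?_)
    · simp only [mellinInvIntegrand, hx]
      simp_rw [fun p : (Fin n → ℝ) × Ω => prod_mul_exp_cpow hS (fun i => Y i p.2)
        (contourPoint a p.1)]
      refine AEStronglyMeasurable.mul ?_ (AEStronglyMeasurable.mul ?_ ?_)
      · exact (continuous_payoffMellin_contour K ha).aestronglyMeasurable.comp_fst
      · refine AEMeasurable.aestronglyMeasurable ?_
        have h2 : ∀ j, AEMeasurable (fun p : (Fin n → ℝ) × Ω => Y j p.2)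
            ((volume.restrict (Set.Icc (-R) R)).prod P) := fun j => (hY j).comp_snd
        unfold contourPoint
        fun_prop
      · exact (continuous_prod_cpow_contour a hS).aestronglyMeasurable.comp_fst
    · refine (hC _ (hxpos p.2) p.1).trans (mul_le_mul_of_nonneg_left ?_ hC0)
      refine Finset.prod_le_prod (fun j _ => (Real.rpow_pos_of_pos (hxpos p.2 j) _).le)
        fun j _ => ?_
      have := hxpos p.2 j
      linarith
  have hswap : ∀ R : Fin n → ℝ, ((2 * Real.pi : ℝ) : ℂ)⁻¹ ^ n * ∫ b in Set.Icc (-R) R,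
        mellinInvIntegrand a
          (fun w => payoffMellin K w * ∫ ω, cexp (-∑ j, w j * Y j ω) ∂P) S b
      = ∫ ω, truncPayoffInv K a R (x ω) ∂P := by
    intro R
    simp_rw [hint1]
    rw [integral_integral_swap (hF R), ← integral_const_mul]
    rfl
  simp_rw [hswap]
  obtain ⟨D, hD⟩ := exists_norm_truncPayoffInv_le K ha
  rw [← integral_complex_ofReal]
  refine Tendsto.mono_left (tendsto_integral_filter_of_dominated_convergence
    (fun ω => D * dominatingWeight a (x ω)) (Eventually.of_forall fun R => ?_) ?_
    (hdom.const_mul D) (Eventually.of_forall fun ω => tendsto_truncPayoffInv K ha (hxpos ω)))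
    atTop_le_pi_atTop
  · exact ((hF R).integral_prod_right.const_mul (((2 * Real.pi : ℝ) : ℂ)⁻¹ ^ n)
      ).aestronglyMeasurable
  · filter_upwards [eventually_nonneg_pi_atTop] with R hR
    exact Eventually.of_forall fun ω => hD R hR _ (hxpos ω)

/-- A positive definite quadratic form dominates a multiple of the sum of squares. -/
theorem exists_mul_sum_sq_le {M : Matrix (Fin n) (Fin n) ℝ} (hM : M.PosDef) :
    ∃ c : ℝ, 0 < c ∧ ∀ b : Fin n → ℝ, c * ∑ j, b j ^ 2 ≤ ∑ i, ∑ j, M i j * b i * b j := by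
  have hpos : ∀ b : Fin n → ℝ, b ≠ 0 → 0 < ∑ i, ∑ j, M i j * b i * b j := by
    intro b hb
    refine (hM.dotProduct_mulVec_pos hb).trans_le (le_of_eq ?_)
    simp only [dotProduct, Matrix.mulVec, star_trivial, Finset.mul_sum]
    exact Finset.sum_congr rfl fun i _ => Finset.sum_congr rfl fun j _ => by ring
  have hcont : Continuous fun b : Fin n → ℝ => ∑ i, ∑ j, M i j * b i * b j := by fun_prop
  have hsq : Continuous fun b : Fin n → ℝ => ∑ j, b j ^ 2 := by fun_prop
  have hcpt : IsCompact {b : Fin n → ℝ | ∑ j, b j ^ 2 = 1} := by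
    refine (isCompact_Icc (a := fun _ : Fin n => (-1 : ℝ)) (b := fun _ => 1)).of_isClosed_subset
      (isClosed_eq hsq continuous_const) fun b hb => ?_
    have hj : ∀ j, |b j| ≤ 1 := fun j => by
      rw [← sq_le_one_iff_abs_le_one, ← Set.mem_ofPred.1 hb]
      exact Finset.single_le_sum (f := fun j => b j ^ 2) (fun i _ => sq_nonneg _)
        (Finset.mem_univ j)
    exact ⟨fun j => (abs_le.1 (hj j)).1, fun j => (abs_le.1 (hj j)).2⟩
  obtain ⟨c, hc0, hc⟩ := hcpt.exists_forall_le' hcont.continuousOn (a := 0) fun b hb => hpos b (by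
    rintro rfl
    simp at hb)
  refine ⟨c, hc0, fun b => ?_⟩
  set s := ∑ j, b j ^ 2 with hs
  have hs0 : 0 ≤ s := Finset.sum_nonneg fun j _ => sq_nonneg _
  rcases hs0.eq_or_lt with h0 | h0
  · have hb : b = 0 := by
      ext j
      have := (Finset.sum_eq_zero_iff_of_nonneg fun j _ => sq_nonneg (b j)).1 h0.symm j
        (Finset.mem_univ j)
      exact pow_eq_zero_iff two_ne_zero |>.1 this
    rw [← h0, hb]
    simp
  · have h := hc (fun j => (Real.sqrt s)⁻¹ * b j) (by
      simp only [Set.mem_ofPred_eq, mul_pow, ← Finset.mul_sum, inv_pow, Real.sq_sqrt hs0]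
      exact inv_mul_cancel₀ h0.ne')
    have h2 : ∑ i, ∑ j, M i j * ((Real.sqrt s)⁻¹ * b i) * ((Real.sqrt s)⁻¹ * b j)
        = s⁻¹ * ∑ i, ∑ j, M i j * b i * b j := by
      simp_rw [Finset.mul_sum]
      refine Finset.sum_congr rfl fun i _ => Finset.sum_congr rfl fun j _ => ?_
      rw [show s⁻¹ = (Real.sqrt s)⁻¹ * (Real.sqrt s)⁻¹ by rw [← mul_inv, Real.mul_self_sqrt hs0]]
      ring
    rw [h2, ← div_eq_inv_mul, le_div_iff₀ h0] at h
    exact h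

open Complex in
/-- On the contour, the characteristic function of a nondegenerate Gaussian law decays like a
Gaussian. -/
theorem integrable_mellinInvIntegrand_of_posDef (K : ℝ) {a S : Fin n → ℝ} (ha : ∀ j, 0 < a j)
    (hS : S ∈ posOrthant n) {M : Matrix (Fin n) (Fin n) ℝ} (hM : M.PosDef) (μ : Fin n → ℝ)
    {τ : ℝ} (hτ : 0 < τ) :
    Integrable (mellinInvIntegrand a (fun w => payoffMellin K w *
      cexp (-(τ : ℂ) * charExponent M μ fun j => w j * I)) S) := by
  obtain ⟨C, hC0, hC⟩ := norm_mellinInvIntegrand_payoffMellin_le K ha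
  obtain ⟨c, hc0, hc⟩ := exists_mul_sum_sq_le hM
  have hre : ∀ b, (-(τ : ℂ) * charExponent M μ fun j => contourPoint a b j * I).re
      = τ * ((∑ i, ∑ j, M i j * a i * a j) / 2 - ∑ j, μ j * a j)
        - τ / 2 * ∑ i, ∑ j, M i j * b i * b j := by
    intro b
    have h1 : ∀ i j, (M i j : ℂ) * (contourPoint a b i * I) * (contourPoint a b j * I)
        = ((M i j * b i * b j - M i j * a i * a j : ℝ) : ℂ)
          - ((M i j * a i * b j + M i j * b i * a j : ℝ) : ℂ) * I := by
      intro i j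
      simp only [contourPoint]
      push_cast
      linear_combination ((M i j : ℂ) * (a i + b i * I) * (a j + b j * I)
        - (M i j : ℂ) * b i * b j) * I_sq
    have h2 : ∀ j, (μ j : ℂ) * (contourPoint a b j * I)
        = ((μ j * a j : ℝ) : ℂ) * I - ((μ j * b j : ℝ) : ℂ) := by
      intro j
      simp only [contourPoint]
      push_cast
      linear_combination ((μ j : ℂ) * b j) * I_sq
    simp only [charExponent, h1, h2, Finset.sum_sub_distrib, ← Finset.sum_mul, ← ofReal_sum]
    rw [neg_mul, neg_re, re_ofReal_mul]
    simp
    ring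
  have hint : Integrable fun b : Fin n → ℝ => ∏ j, Real.exp (-(τ / 2 * c) * b j ^ 2) :=
    Integrable.fintype_prod (f := fun _ (u : ℝ) => Real.exp (-(τ / 2 * c) * u ^ 2))
      fun _ => integrable_exp_neg_mul_sq (by positivity)
  set D := Real.exp (τ * ((∑ i, ∑ j, M i j * a i * a j) / 2 - ∑ j, μ j * a j)) with hD
  refine (hint.const_mul (C * (∏ j, S j ^ (-a j)) * D)).mono' ?_ (Eventually.of_forall fun b => ?_)
  · refine Continuous.aestronglyMeasurable ?_
    refine Continuous.mul (Continuous.mul (continuous_payoffMellin_contour K ha) ?_)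
      (continuous_prod_cpow_contour a hS)
    unfold charExponent contourPoint
    fun_prop
  · have h1 : mellinInvIntegrand a (fun w => payoffMellin K w *
        cexp (-(τ : ℂ) * charExponent M μ fun j => w j * I)) S b
        = mellinInvIntegrand a (payoffMellin K) S b *
          cexp (-(τ : ℂ) * charExponent M μ fun j => contourPoint a b j * I) := by
      simp only [mellinInvIntegrand]
      ring
    rw [h1, norm_mul, Complex.norm_exp, hre, sub_eq_add_neg, Real.exp_add, ← hD, ← Real.exp_sum,
      ← mul_assoc]
    have h2 : 0 ≤ ∏ j, S j ^ (-a j) :=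
      Finset.prod_nonneg fun j _ => (Real.rpow_pos_of_pos (hS j) _).le
    have h3 : -(τ / 2 * ∑ i, ∑ j, M i j * b i * b j) ≤ ∑ j, -(τ / 2 * c) * b j ^ 2 := by
      rw [← Finset.mul_sum]
      nlinarith [hc b]
    exact mul_le_mul (mul_le_mul_of_nonneg_right (hC S hS b) (Real.exp_pos _).le)
      (Real.exp_le_exp.2 h3) (Real.exp_pos _).le (by positivity)

end Pricing

/-! ### A maximum principle for the Black-Scholes operator in log-prices -/

/-- At a local maximum at which the first derivative `g` is differentiable, the second derivative is
nonpositive. -/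
theorem second_deriv_nonpos_of_isLocalMax {φ g : ℝ → ℝ} {h : ℝ}
    (hφ : ∀ᶠ s in 𝓝 (0 : ℝ), HasDerivAt φ (g s) s) (hg : HasDerivAt g h 0)
    (hmax : IsLocalMax φ 0) : h ≤ 0 := by
  by_contra hh
  rw [not_le] at hh
  have hg0 : g 0 = 0 := hmax.hasDerivAt_eq_zero hφ.self_of_nhds
  have hslope : ∀ᶠ s in 𝓝[>] (0 : ℝ), 0 < g s := by
    have h1 := (hasDerivAt_iff_tendsto_slope.1 hg).eventually (lt_mem_nhds hh)
    have h2 : 𝓝[>] (0 : ℝ) ≤ 𝓝[≠] 0 := nhdsWithin_mono _ fun x hx => ne_of_gt hx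
    filter_upwards [h2 h1, self_mem_nhdsWithin] with s hs hs0
    have hs0' : 0 < s := hs0
    rw [slope_def_field, hg0, sub_zero, sub_zero] at hs
    exact (div_pos_iff_of_pos_right hs0').1 hs
  obtain ⟨δ, hδ, hδ1⟩ := mem_nhdsGT_iff_exists_Ioo_subset.1 hslope
  obtain ⟨η, hη, hη1⟩ := Metric.eventually_nhds_iff.1 (hφ.and hmax)
  have hδ0 : 0 < δ := hδ
  set s := min (δ / 2) (η / 2) with hs
  have hs0 : 0 < s := by positivity
  have hsδ : s < δ := (min_le_left _ _).trans_lt (by linarith)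
  have hsη : s < η := (min_le_right _ _).trans_lt (by linarith)
  have hd : ∀ x, 0 ≤ x → x ≤ s → HasDerivAt φ (g x) x := fun x hx0 hxs =>
    (hη1 (by rw [Real.dist_eq, sub_zero, abs_of_nonneg hx0]; linarith)).1
  obtain ⟨c, hc, hc1⟩ := exists_hasDerivAt_eq_slope φ g hs0
    (fun x hx => (hd x hx.1 hx.2).continuousAt.continuousWithinAt)
    fun x hx => hd x hx.1.le hx.2.le
  have hgc : 0 < g c := hδ1 ⟨hc.1, hc.2.trans hsδ⟩
  have hle : φ s ≤ φ 0 := (hη1 (by rw [Real.dist_eq, sub_zero, abs_of_pos hs0]; exact hsη)).2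
  rw [hc1, sub_zero] at hgc
  have := (div_pos_iff_of_pos_right hs0).1 hgc
  linarith

section Generator

variable {n : ℕ} {E F : Type*} [NormedAddCommGroup E] [NormedSpace ℝ E]
  [NormedAddCommGroup F] [NormedSpace ℝ F]

/-- The function `f(y, t)` of the log-prices `y` and the time `t` has at `(y, t)` all derivatives
in the operator `∂ₜ + ½ ∑ₖ ∂²_{Bₖ} + ∂_μ - r`, where the `Bₖ` are the rows of `B`, and the operator
takes the value `v` there. With `C = BᵀB` this is the Black-Scholes operator with covariance matrix
`C` in log-prices; only derivatives along lines are used. -/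
def HasGeneratorAt (B : Matrix (Fin n) (Fin n) ℝ) (μ : Fin n → ℝ) (r : ℝ)
    (f : (Fin n → ℝ) → ℝ → E) (y : Fin n → ℝ) (t : ℝ) (v : E) : Prop :=
  ∃ (p d : E) (g : Fin n → ℝ → E) (h : Fin n → E),
    HasDerivAt (f y) p t ∧ HasDerivAt (fun s : ℝ => f (y + s • μ) t) d 0 ∧
    (∀ k, ∀ᶠ s in 𝓝 (0 : ℝ), HasDerivAt (fun s : ℝ => f (y + s • B k) t) (g k s) s) ∧
    (∀ k, HasDerivAt (g k) (h k) 0) ∧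
    v = p + (1 / 2 : ℝ) • ∑ k, h k + d - r • f y t

variable {B : Matrix (Fin n) (Fin n) ℝ} {μ : Fin n → ℝ} {r : ℝ}
  {f f₁ f₂ : (Fin n → ℝ) → ℝ → E} {y : Fin n → ℝ} {t : ℝ} {v v₁ v₂ : E}

namespace HasGeneratorAt

theorem clm_comp (L : E →L[ℝ] F) (h : HasGeneratorAt B μ r f y t v) :
    HasGeneratorAt B μ r (fun y t => L (f y t)) y t (L v) := by
  obtain ⟨p, d, g, h, h1, h2, h3, h4, rfl⟩ := h
  refine ⟨L p, L d, fun k s => L (g k s), fun k => L (h k), L.hasFDerivAt.comp_hasDerivAt _ h1,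
    L.hasFDerivAt.comp_hasDerivAt _ h2, fun k => ?_,
    fun k => L.hasFDerivAt.comp_hasDerivAt _ (h4 k), by simp⟩
  filter_upwards [h3 k] with s hs
  exact L.hasFDerivAt.comp_hasDerivAt _ hs

theorem add (h₁ : HasGeneratorAt B μ r f₁ y t v₁) (h₂ : HasGeneratorAt B μ r f₂ y t v₂) :
    HasGeneratorAt B μ r (fun y t => f₁ y t + f₂ y t) y t (v₁ + v₂) := by
  obtain ⟨p, d, g, h, h1, h2, h3, h4, rfl⟩ := h₁
  obtain ⟨p', d', g', h', h1', h2', h3', h4', rfl⟩ := h₂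
  refine ⟨p + p', d + d', fun k s => g k s + g' k s, fun k => h k + h' k, h1.add h1',
    h2.add h2', fun k => ?_, fun k => (h4 k).add (h4' k), ?_⟩
  · filter_upwards [h3 k, h3' k] with s hs hs'
    exact hs.add hs'
  · rw [Finset.sum_add_distrib]
    module

theorem zero : HasGeneratorAt B μ r (fun _ _ => (0 : E)) y t 0 :=
  ⟨0, 0, fun _ _ => 0, fun _ => 0, hasDerivAt_const _ _, hasDerivAt_const _ _,
    fun _ => Eventually.of_forall fun _ => hasDerivAt_const _ _, fun _ => hasDerivAt_const _ _,
    by simp⟩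

theorem sum {ι : Type*} (s : Finset ι) {f : ι → (Fin n → ℝ) → ℝ → E} {v : ι → E}
    (h : ∀ i ∈ s, HasGeneratorAt B μ r (f i) y t (v i)) :
    HasGeneratorAt B μ r (fun y t => ∑ i ∈ s, f i y t) y t (∑ i ∈ s, v i) := by
  classical
  induction s using Finset.induction_on with
  | empty => simpa using zero
  | insert i s hi ih =>
    simp_rw [Finset.sum_insert hi]
    exact (h i (Finset.mem_insert_self i s)).add
      (ih fun j hj => h j (Finset.mem_insert_of_mem hj))

theorem neg (h : HasGeneratorAt B μ r f y t v) :
    HasGeneratorAt B μ r (fun y t => -f y t) y t (-v) := by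
  simpa using h.clm_comp (-ContinuousLinearMap.id ℝ E)

theorem sub (h₁ : HasGeneratorAt B μ r f₁ y t v₁) (h₂ : HasGeneratorAt B μ r f₂ y t v₂) :
    HasGeneratorAt B μ r (fun y t => f₁ y t - f₂ y t) y t (v₁ - v₂) := by
  simpa [sub_eq_add_neg] using h₁.add h₂.neg

open Complex in
/-- The exponentials `e^{z·y + κ(T - t)}` are eigenfunctions. -/
theorem complex_exp (B : Matrix (Fin n) (Fin n) ℝ) (μ : Fin n → ℝ) (r T : ℝ) (z : Fin n → ℂ) (κ : ℂ)
    (y : Fin n → ℝ) (t : ℝ) :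
    HasGeneratorAt B μ r (fun y t => cexp (∑ j, z j * y j + κ * ((T - t : ℝ) : ℂ))) y t
      ((-κ + 1 / 2 * ∑ k, (∑ j, z j * B k j) ^ 2 + ∑ j, z j * μ j - r) *
        cexp (∑ j, z j * y j + κ * ((T - t : ℝ) : ℂ))) := by
  have hline : ∀ (w : Fin n → ℝ) (s : ℝ),
      HasDerivAt (fun s : ℝ => cexp (∑ j, z j * ((y + s • w) j : ℝ) + κ * ((T - t : ℝ) : ℂ)))
        (cexp (∑ j, z j * ((y + s • w) j : ℝ) + κ * ((T - t : ℝ) : ℂ)) * ∑ j, z j * w j) s := by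
    intro w s
    refine HasDerivAt.cexp ?_
    have h1 : ∀ s : ℝ, ∑ j, z j * ((y + s • w) j : ℝ) + κ * ((T - t : ℝ) : ℂ)
        = (∑ j, z j * y j + κ * ((T - t : ℝ) : ℂ)) + (s : ℂ) * ∑ j, z j * w j := by
      intro s
      simp only [Pi.add_apply, Pi.smul_apply, smul_eq_mul]
      push_cast
      simp_rw [mul_add, Finset.sum_add_distrib, Finset.mul_sum]
      rw [add_right_comm]
      congr 1
      exact Finset.sum_congr rfl fun j _ => by ring
    simp_rw [h1]
    have h2 : HasDerivAt (fun s : ℝ => (s : ℂ)) 1 s := ofRealCLM.hasDerivAt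
    simpa using (h2.mul_const (∑ j, z j * w j)).const_add
      (∑ j, z j * y j + κ * ((T - t : ℝ) : ℂ))
  refine ⟨-κ * cexp (∑ j, z j * y j + κ * ((T - t : ℝ) : ℂ)), _, _, fun k =>
    (cexp (∑ j, z j * ((y + (0 : ℝ) • B k) j : ℝ) + κ * ((T - t : ℝ) : ℂ)) * ∑ j, z j * B k j) *
      ∑ j, z j * B k j, ?_, hline μ 0, fun k => Eventually.of_forall (hline (B k)),
    fun k => (hline (B k) 0).mul_const _, ?_⟩
  · have h2 : HasDerivAt (fun t : ℝ => ((T - t : ℝ) : ℂ)) (-1) t := by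
      have := (ofRealCLM.hasDerivAt (x := t)).const_sub (T : ℂ)
      simpa using this
    have h3 := ((h2.const_mul κ).const_add (∑ j, z j * (y j : ℂ))).cexp
    refine h3.congr_deriv ?_
    ring
  · simp only [zero_smul, add_zero, real_smul, mul_assoc, ← Finset.mul_sum]
    simp_rw [← sq]
    push_cast
    ring

open Complex in
theorem real_exp (B : Matrix (Fin n) (Fin n) ℝ) (μ : Fin n → ℝ) (r T : ℝ) (z : Fin n → ℝ) (κ : ℝ)
    (y : Fin n → ℝ) (t : ℝ) :
    HasGeneratorAt B μ r (fun y t => Real.exp (∑ j, z j * y j + κ * (T - t))) y t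
      ((-κ + 1 / 2 * ∑ k, (∑ j, z j * B k j) ^ 2 + ∑ j, z j * μ j - r) *
        Real.exp (∑ j, z j * y j + κ * (T - t))) := by
  have h := (complex_exp B μ r T (fun j => (z j : ℂ)) κ y t).clm_comp reCLM
  have h1 : ∀ (y : Fin n → ℝ) (t : ℝ),
      Complex.exp (∑ j, (z j : ℂ) * y j + κ * ((T - t : ℝ) : ℂ))
        = ((Real.exp (∑ j, z j * y j + κ * (T - t)) : ℝ) : ℂ) := by
    intro y t
    push_cast
    rfl
  have h2 : -(κ : ℂ) + 1 / 2 * ∑ k, (∑ j, (z j : ℂ) * B k j) ^ 2 + ∑ j, (z j : ℂ) * μ j - r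
      = ((-κ + 1 / 2 * ∑ k, (∑ j, z j * B k j) ^ 2 + ∑ j, z j * μ j - r : ℝ) : ℂ) := by
    push_cast
    rfl
  simp_rw [h1, h2, ← ofReal_mul] at h
  simpa only [reCLM_apply, ofReal_re] using h

end HasGeneratorAt

/-- The weight `1 + ∑ⱼ (e^{yⱼ} + e^{-yⱼ})`, which tends to infinity in all directions. -/
noncomputable def expWeight (y : Fin n → ℝ) : ℝ := 1 + ∑ j, (Real.exp (y j) + Real.exp (-y j))

theorem expWeight_pos (y : Fin n → ℝ) : 0 < expWeight y := by
  have : 0 ≤ ∑ j, (Real.exp (y j) + Real.exp (-y j)) := Finset.sum_nonneg fun j _ => by positivity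
  unfold expWeight
  linarith

theorem exp_abs_le_expWeight (y : Fin n → ℝ) (j : Fin n) : Real.exp |y j| + 1 ≤ expWeight y := by
  have h1 : Real.exp |y j| ≤ Real.exp (y j) + Real.exp (-y j) := by
    rcases abs_choice (y j) with h | h <;> rw [h] <;>
      linarith [Real.exp_pos (y j), Real.exp_pos (-y j)]
  have h2 : Real.exp (y j) + Real.exp (-y j) ≤ ∑ j, (Real.exp (y j) + Real.exp (-y j)) :=
    Finset.single_le_sum (f := fun j => Real.exp (y j) + Real.exp (-y j))
      (fun i _ => by positivity) (Finset.mem_univ j)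
  unfold expWeight
  linarith

theorem continuous_expWeight : Continuous (expWeight (n := n)) := by
  unfold expWeight; fun_prop

/-- For a sufficiently large growth rate `lam`, the function `e^{lam (T - t)} expWeight y` is a
strict supersolution. -/
theorem exists_expWeight_supersolution (B : Matrix (Fin n) (Fin n) ℝ) (μ : Fin n → ℝ) {r : ℝ}
    (hr : 0 ≤ r) (T : ℝ) : ∃ lam : ℝ, 0 ≤ lam ∧ ∀ (y : Fin n → ℝ) (t : ℝ), ∃ v < 0,
      HasGeneratorAt B μ r (fun y t => Real.exp (lam * (T - t)) * expWeight y) y t v := by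
  classical
  set lam : ℝ := 1 + ∑ j, (1 / 2 * ∑ k, B k j ^ 2 + |μ j|) with hlam
  have hterm : ∀ j, 0 ≤ 1 / 2 * ∑ k, B k j ^ 2 + |μ j| := fun j => by
    have : 0 ≤ ∑ k, B k j ^ 2 := Finset.sum_nonneg fun k _ => sq_nonneg _
    positivity
  have hsum : 0 ≤ ∑ j, (1 / 2 * ∑ k, B k j ^ 2 + |μ j|) := Finset.sum_nonneg fun j _ => hterm j
  have hle : ∀ j, 1 / 2 * ∑ k, B k j ^ 2 + |μ j| + 1 ≤ lam := fun j => by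
    have := Finset.single_le_sum (f := fun j => 1 / 2 * ∑ k, B k j ^ 2 + |μ j|)
      (fun i _ => hterm i) (Finset.mem_univ j)
    rw [hlam]
    linarith
  refine ⟨lam, by linarith, fun y t => ?_⟩
  have h0 := HasGeneratorAt.real_exp B μ r T 0 lam y t
  have h1 := fun j => HasGeneratorAt.real_exp B μ r T (Pi.single j 1) lam y t
  have h2 := fun j => HasGeneratorAt.real_exp B μ r T (-Pi.single j 1) lam y t
  have h3 := h0.add (HasGeneratorAt.sum Finset.univ fun j _ => (h1 j).add (h2 j))
  have hs : ∀ (j : Fin n) (x : Fin n → ℝ), ∑ i, (Pi.single j 1 : Fin n → ℝ) i * x i = x j := by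
    intro j x
    simp [Pi.single_apply]
  have hs' : ∀ (j : Fin n) (x : Fin n → ℝ), ∑ i, (-Pi.single j 1 : Fin n → ℝ) i * x i = -x j := by
    intro j x
    simp [Pi.single_apply]
  simp only [hs, hs', Pi.zero_apply, zero_mul, Finset.sum_const_zero, zero_add] at h3
  have hfun : (fun (y : Fin n → ℝ) t => Real.exp (lam * (T - t)) * expWeight y) = fun y t =>
      Real.exp (lam * (T - t)) + ∑ j, (Real.exp (y j + lam * (T - t))
        + Real.exp (-y j + lam * (T - t))) := by
    funext y t
    rw [expWeight, mul_add, mul_one, Finset.mul_sum]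
    congr 1
    refine Finset.sum_congr rfl fun j _ => ?_
    rw [mul_add, ← Real.exp_add, ← Real.exp_add]
    ring_nf
  rw [hfun]
  refine ⟨_, ?_, h3⟩
  · refine add_neg_of_neg_of_nonpos ?_ (Finset.sum_nonpos fun j _ => ?_)
    · refine mul_neg_of_neg_of_pos ?_ (Real.exp_pos _)
      norm_num
      linarith
    · have hj := hle j
      have hμ1 := le_abs_self (μ j)
      have hμ2 := neg_abs_le (μ j)
      refine add_nonpos (mul_nonpos_of_nonpos_of_nonneg ?_ (Real.exp_pos _).le)
        (mul_nonpos_of_nonpos_of_nonneg ?_ (Real.exp_pos _).le)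
      · linarith
      · simp only [neg_sq]
        linarith

/-- The maximum principle: a bounded solution which at the terminal time lies below a multiple of
the weight does so, up to exponential growth, at all times. No condition at the faces `Sᵢ = 0` is
needed, since they lie at infinity in log-prices. At a positive maximum over `[t₁, T]` of the
difference of the two sides, which exists since the weight dominates at infinity, all derivatives
have a sign which contradicts the strict supersolution property. -/
theorem le_of_hasGeneratorAt_zero {f : (Fin n → ℝ) → ℝ → ℝ} {T M ε lam : ℝ} (hr : 0 ≤ r)
    (hε : 0 < ε) (hlam0 : 0 ≤ lam)
    (hlam : ∀ (y : Fin n → ℝ) (t : ℝ), ∃ v < 0,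
      HasGeneratorAt B μ r (fun y t => Real.exp (lam * (T - t)) * expWeight y) y t v)
    (hbound : ∀ y, ∀ t ∈ Set.Icc 0 T, f y t ≤ M)
    (hcont : ContinuousOn (fun p : (Fin n → ℝ) × ℝ => f p.1 p.2) (Set.univ ×ˢ Set.Icc 0 T))
    (hgen : ∀ y, ∀ t ∈ Set.Ioo 0 T, HasGeneratorAt B μ r f y t 0)
    (hterm : ∀ y, f y T ≤ ε * expWeight y) :
    ∀ y, ∀ t ∈ Set.Ioo 0 T, f y t ≤ ε * (Real.exp (lam * (T - t)) * expWeight y) := by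
  intro y₁ t₁ ht₁
  by_contra hcon
  rw [not_le] at hcon
  set G : (Fin n → ℝ) → ℝ → ℝ := fun y t => f y t - ε * (Real.exp (lam * (T - t)) * expWeight y)
    with hG
  have hG1 : 0 < G y₁ t₁ := by rw [hG]; simp only; linarith
  obtain ⟨ρ, hρ⟩ : ∃ ρ : ℝ, M ≤ ε * Real.exp ρ := by
    refine ⟨M / ε, ?_⟩
    have := Real.add_one_le_exp (M / ε)
    rw [← div_le_iff₀' hε]
    linarith
  have hsub : Set.Icc t₁ T ⊆ Set.Icc 0 T := Set.Icc_subset_Icc_left ht₁.1.le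
  -- outside a compact box the weight dominates
  have hout : ∀ y, ∀ t ∈ Set.Icc t₁ T, 0 < G y t →
      y ∈ Set.Icc (fun _ => -ρ) fun _ : Fin n => ρ := by
    intro y t ht hpos
    have hj : ∀ j, |y j| ≤ ρ := by
      intro j
      by_contra hj
      rw [not_le] at hj
      have h1 := exp_abs_le_expWeight y j
      have h2 : Real.exp ρ ≤ Real.exp |y j| := Real.exp_le_exp.2 hj.le
      have h3 : 1 ≤ Real.exp (lam * (T - t)) :=
        Real.one_le_exp (mul_nonneg hlam0 (by linarith [ht.2]))
      have h4 : expWeight y ≤ Real.exp (lam * (T - t)) * expWeight y :=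
        le_mul_of_one_le_left (expWeight_pos y).le h3
      have h5 : ε * Real.exp ρ ≤ ε * (Real.exp (lam * (T - t)) * expWeight y) :=
        mul_le_mul_of_nonneg_left (by linarith) hε.le
      have h6 := hbound y t (hsub ht)
      simp only [hG] at hpos
      linarith
    exact ⟨fun j => (abs_le.1 (hj j)).1, fun j => (abs_le.1 (hj j)).2⟩
  have hGc : ContinuousOn (fun p : (Fin n → ℝ) × ℝ => G p.1 p.2)
      ((Set.Icc (fun _ => -ρ) fun _ : Fin n => ρ) ×ˢ Set.Icc t₁ T) := by
    refine (hcont.mono (Set.prod_mono (Set.subset_univ _) hsub)).sub ?_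
    have := continuous_expWeight (n := n)
    exact Continuous.continuousOn (by fun_prop)
  have hmem₁ : (y₁, t₁) ∈ (Set.Icc (fun _ => -ρ) fun _ : Fin n => ρ) ×ˢ Set.Icc t₁ T :=
    ⟨hout y₁ t₁ ⟨le_rfl, ht₁.2.le⟩ hG1, le_rfl, ht₁.2.le⟩
  obtain ⟨⟨y₀, t₀⟩, hmem₀, hmax⟩ := (isCompact_Icc.prod isCompact_Icc).exists_isMaxOn
    ⟨_, hmem₁⟩ hGc
  have hG0 : 0 < G y₀ t₀ := hG1.trans_le (hmax hmem₁)
  have hmax' : ∀ y, ∀ t ∈ Set.Icc t₁ T, G y t ≤ G y₀ t₀ := by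
    intro y t ht
    by_cases hpos : 0 < G y t
    · exact hmax (show (y, t) ∈ _ from ⟨hout y t ht hpos, ht⟩)
    · linarith
  have ht₀ : t₀ ∈ Set.Icc t₁ T := hmem₀.2
  have ht₀T : t₀ < T := by
    refine lt_of_le_of_ne ht₀.2 fun h => ?_
    have h1 := hterm y₀
    rw [h] at hG0
    simp [hG] at hG0
    linarith
  obtain ⟨v, hv, hgw⟩ := hlam y₀ t₀
  have hgenG := (hgen y₀ t₀ ⟨ht₁.1.trans_le ht₀.1, ht₀T⟩).sub
    (hgw.clm_comp (ε • ContinuousLinearMap.id ℝ ℝ))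
  obtain ⟨p, d, g, h, h1, h2, h3, h4, h5⟩ := hgenG
  -- the maximum may be attained at `t₁`, so that only times after `t₀` are compared
  have hp : p ≤ 0 := by
    refine le_of_tendsto ((hasDerivAt_iff_tendsto_slope.1 h1).mono_left
      (nhdsWithin_mono _ fun x (hx : x ∈ Set.Ioi t₀) => ne_of_gt hx)) ?_
    filter_upwards [Ioo_mem_nhdsGT ht₀T] with t ht
    rw [slope_def_field]
    refine div_nonpos_of_nonpos_of_nonneg ?_ (by linarith [ht.1])
    have := hmax' y₀ t ⟨ht₀.1.trans ht.1.le, ht.2.le⟩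
    simp only [hG] at this
    simpa using this
  have hloc : ∀ w : Fin n → ℝ, IsLocalMax (fun s : ℝ => f (y₀ + s • w) t₀
      - (ε • ContinuousLinearMap.id ℝ ℝ)
        (Real.exp (lam * (T - t₀)) * expWeight (y₀ + s • w))) 0 := by
    intro w
    refine Eventually.of_forall fun s => ?_
    have := hmax' (y₀ + s • w) t₀ ht₀
    simp only [hG] at this
    simpa using this
  have hd : d = 0 := (hloc μ).hasDerivAt_eq_zero h2
  have hh : ∀ k, h k ≤ 0 := fun k => second_deriv_nonpos_of_isLocalMax (h3 k) (h4 k) (hloc (B k))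
  have hhs : ∑ k, h k ≤ 0 := Finset.sum_nonpos fun k _ => hh k
  have hlast : 0 ≤ r * G y₀ t₀ := mul_nonneg hr hG0.le
  have hneg : 0 < -(ε * v) := by nlinarith
  simp [hd] at h5
  simp only [hG] at hlast
  nlinarith

/-- The maximum principle on the closed time interval. -/
theorem le_of_hasGeneratorAt_zero_of_mem_Icc {f : (Fin n → ℝ) → ℝ → ℝ} {T M ε lam : ℝ}
    (hr : 0 ≤ r) (hε : 0 < ε) (hlam0 : 0 ≤ lam)
    (hlam : ∀ (y : Fin n → ℝ) (t : ℝ), ∃ v < 0,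
      HasGeneratorAt B μ r (fun y t => Real.exp (lam * (T - t)) * expWeight y) y t v)
    (hbound : ∀ y, ∀ t ∈ Set.Icc 0 T, f y t ≤ M)
    (hcont : ContinuousOn (fun p : (Fin n → ℝ) × ℝ => f p.1 p.2) (Set.univ ×ˢ Set.Icc 0 T))
    (hgen : ∀ y, ∀ t ∈ Set.Ioo 0 T, HasGeneratorAt B μ r f y t 0)
    (hterm : ∀ y, f y T ≤ ε * expWeight y) (y : Fin n → ℝ) {t : ℝ} (ht : t ∈ Set.Icc 0 T) :
    f y t ≤ ε * (Real.exp (lam * (T - t)) * expWeight y) := by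
  rcases (ht.1.trans ht.2).eq_or_lt with hT | hT
  · obtain rfl : t = T := le_antisymm ht.2 (hT ▸ ht.1)
    simpa using hterm y
  · rw [← closure_Ioo hT.ne] at ht
    have hc : ContinuousOn (f y) (Set.Icc 0 T) :=
      hcont.comp (f := fun t => (y, t)) (by fun_prop) fun t ht => ⟨Set.mem_univ _, ht⟩
    refine ContinuousWithinAt.closure_le ht ?_ ?_
      (le_of_hasGeneratorAt_zero hr hε hlam0 hlam hbound hcont hgen hterm y)
    · exact (hc t (closure_Ioo hT.ne ▸ ht)).mono Set.Ioo_subset_Icc_self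
    · exact Continuous.continuousWithinAt (by fun_prop)

end Generator

/-! ### Trigonometric approximation of the payoff in log-prices -/

open Complex in
/-- Up to an arbitrarily small multiple of the weight, the payoff is a trigonometric polynomial in
the log-prices. On a large box this is the Weierstrass theorem on the torus, applied to the function
which reads off `y` from `sin (y / c)` for `|y / c| ≤ π / 2`; outside of the box the weight exceeds
the bound `K` of the payoff. -/
theorem exists_trigSum_approx_putPayoff {n : ℕ} {K ε : ℝ} (hK : 0 < K) (hε : 0 < ε) :
    ∃ (s : Finset (Fin n → ℤ)) (c : (Fin n → ℤ) → ℂ) (ω : ℝ), ∀ y : Fin n → ℝ,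
      |(∑ m ∈ s, c m * cexp (∑ j, I * (ω * m j : ℝ) * y j)).re
        - putPayoff K (fun j => Real.exp (y j))| ≤ ε * expWeight y := by
  obtain ⟨L, hL0, hL⟩ : ∃ L : ℝ, 0 < L ∧ K ≤ ε * Real.exp L := by
    refine ⟨K / ε, by positivity, ?_⟩
    have := Real.add_one_le_exp (K / ε)
    rw [← div_le_iff₀' hε]
    linarith
  have hpay : ∀ x : Fin n → ℝ, (∀ j, 0 ≤ x j) → 0 ≤ putPayoff K x ∧ putPayoff K x ≤ K := by
    intro x hx
    refine ⟨le_max_right _ _, max_le ?_ hK.le⟩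
    linarith [Finset.sum_nonneg fun j (_ : j ∈ Finset.univ) => hx j]
  set c₀ : ℝ := 2 * L / Real.pi with hc₀
  have hc₀0 : 0 < c₀ := by positivity
  let f : C(UnitAddTorus (Fin n), ℂ) :=
    ⟨fun x => ((putPayoff K fun j => Real.exp (c₀ * Real.arcsin (fourier 1 (x j)).im) : ℝ) : ℂ), by
      unfold putPayoff
      have h : ∀ j, Continuous fun x : UnitAddTorus (Fin n) => (fourier 1 (x j)).im := fun j =>
        continuous_im.comp ((fourier 1).continuous.comp (continuous_apply j))
      have h' : ∀ j, Continuous fun x : UnitAddTorus (Fin n) =>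
          Real.arcsin (fourier 1 (x j)).im := fun j => Real.continuous_arcsin.comp (h j)
      fun_prop⟩
  have hf : f ∈ closure ((Submodule.span ℂ (Set.range (UnitAddTorus.mFourier (d := Fin n))) :
      Submodule ℂ C(UnitAddTorus (Fin n), ℂ)) : Set C(UnitAddTorus (Fin n), ℂ)) := by
    rw [← Submodule.topologicalClosure_coe, UnitAddTorus.span_mFourier_closure_eq_top]
    trivial
  obtain ⟨g, hg, hgf⟩ := Metric.mem_closure_iff.1 hf ε hε
  obtain ⟨c, rfl⟩ := Finsupp.mem_span_range_iff_exists_finsupp.1 hg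
  refine ⟨c.support, c, c₀⁻¹, fun y => ?_⟩
  let x : UnitAddTorus (Fin n) := fun j => ((c₀⁻¹ * y j / (2 * Real.pi) : ℝ) : UnitAddCircle)
  have hfour : ∀ (m : ℤ) (j : Fin n), fourier m (x j) = cexp (I * (c₀⁻¹ * m : ℝ) * y j) := by
    intro m j
    simp only [x]
    rw [fourier_coe_apply]
    congr 1
    have : (Real.pi : ℂ) ≠ 0 := by exact_mod_cast Real.pi_ne_zero
    push_cast
    field_simp
  have hgx : (c.sum fun i a => a • UnitAddTorus.mFourier i) x
      = ∑ m ∈ c.support, c m * cexp (∑ j, I * (c₀⁻¹ * m j : ℝ) * y j) := by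
    rw [Finsupp.sum, ContinuousMap.sum_apply]
    refine Finset.sum_congr rfl fun m _ => ?_
    rw [ContinuousMap.smul_apply, smul_eq_mul, exp_sum]
    simp_rw [← hfour]
    rfl
  have hfx : f x = ((putPayoff K fun j =>
      Real.exp (c₀ * Real.arcsin (Real.sin (y j / c₀))) : ℝ) : ℂ) := by
    simp only [f, ContinuousMap.coe_mk, hfour]
    congr 3
    funext j
    have : I * ((c₀⁻¹ * (1 : ℤ) : ℝ) : ℂ) * y j = ((y j / c₀ : ℝ) : ℂ) * I := by
      push_cast
      ring
    rw [this, exp_ofReal_mul_I_im]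
  have h1 : |(∑ m ∈ c.support, c m * cexp (∑ j, I * (c₀⁻¹ * m j : ℝ) * y j)).re
      - putPayoff K fun j => Real.exp (c₀ * Real.arcsin (Real.sin (y j / c₀)))| ≤ ε := by
    have h2 := (ContinuousMap.dist_apply_le_dist (f := f) x).trans hgf.le
    rw [dist_comm, dist_eq_norm, hgx, hfx] at h2
    refine (le_of_eq ?_).trans ((abs_re_le_norm _).trans h2)
    rw [sub_re, ofReal_re]
  by_cases hy : ∀ j, |y j| ≤ L
  · have h2 : (fun j => Real.exp (c₀ * Real.arcsin (Real.sin (y j / c₀))))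
        = fun j => Real.exp (y j) := by
      funext j
      have h3 : |y j / c₀| ≤ Real.pi / 2 := by
        rw [abs_div, abs_of_pos hc₀0, div_le_iff₀ hc₀0, hc₀]
        refine (hy j).trans (le_of_eq ?_)
        field_simp
      rw [Real.arcsin_sin (abs_le.1 h3).1 (abs_le.1 h3).2, mul_div_cancel₀ _ hc₀0.ne']
    rw [h2] at h1
    refine h1.trans (le_mul_of_one_le_right hε.le ?_)
    unfold expWeight
    linarith [Finset.sum_nonneg fun j (_ : j ∈ Finset.univ) =>
      add_nonneg (Real.exp_pos (y j)).le (Real.exp_pos (-y j)).le]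
  · push Not at hy
    obtain ⟨j, hj⟩ := hy
    have h2 := exp_abs_le_expWeight y j
    have h3 : Real.exp L ≤ Real.exp |y j| := Real.exp_le_exp.2 hj.le
    have h4 : ε * (Real.exp L + 1) ≤ ε * expWeight y :=
      mul_le_mul_of_nonneg_left (by linarith) hε.le
    obtain ⟨h5, h6⟩ := hpay (fun j => Real.exp (y j)) fun j => (Real.exp_pos _).le
    obtain ⟨h7, h8⟩ := hpay (fun j => Real.exp (c₀ * Real.arcsin (Real.sin (y j / c₀))))
      fun j => (Real.exp_pos _).le
    rw [abs_le] at h1 ⊢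
    constructor <;> linarith [h1.1, h1.2]

/-! ### The Black-Scholes problem in log-prices -/

section LogPrices

variable {n : ℕ}

theorem isOpen_posOrthant : IsOpen (posOrthant n) := by
  have : posOrthant n = ⋂ i, {x : Fin n → ℝ | 0 < x i} := by
    ext x
    simp [posOrthant]
  rw [this]
  exact isOpen_iInter_of_finite fun i => isOpen_lt continuous_const (continuous_apply i)

theorem pderiv_eq_fderiv {U : (Fin n → ℝ) → ℝ} {x : Fin n → ℝ} (hU : DifferentiableAt ℝ U x)
    (i : Fin n) : pderiv i U x = fderiv ℝ U x (Pi.single i 1) :=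
  hU.lineDeriv_eq_fderiv

theorem differentiableAt_pderiv {U : (Fin n → ℝ) → ℝ} (hU : ContDiffOn ℝ 2 U (posOrthant n))
    (i : Fin n) {x : Fin n → ℝ} (hx : x ∈ posOrthant n) :
    DifferentiableAt ℝ (fun x => pderiv i U x) x := by
  have hn := isOpen_posOrthant.mem_nhds hx
  have h1 : DifferentiableAt ℝ (fun x => fderiv ℝ U x (Pi.single i 1)) x :=
    (((hU.fderiv_of_isOpen isOpen_posOrthant (m := 1) (by norm_num)).differentiableOn
      (by norm_num)).differentiableAt hn).clm_apply (differentiableAt_const _)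
  refine h1.congr_of_eventuallyEq ?_
  filter_upwards [hn] with z hz
  exact pderiv_eq_fderiv
    ((hU.differentiableOn (by norm_num)).differentiableAt (isOpen_posOrthant.mem_nhds hz)) i

/-- The chain rule along a line in log-prices. -/
theorem hasDerivAt_comp_exp_line {U : (Fin n → ℝ) → ℝ} (y d : Fin n → ℝ) (s : ℝ)
    (hU : DifferentiableAt ℝ U fun i => Real.exp ((y + s • d) i)) :
    HasDerivAt (fun s : ℝ => U fun i => Real.exp ((y + s • d) i))
      (∑ j, Real.exp ((y + s • d) j) * d j * pderiv j U fun i => Real.exp ((y + s • d) i)) s := by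
  have h1 : HasDerivAt (fun s : ℝ => fun i => Real.exp ((y + s • d) i))
      (fun i => Real.exp ((y + s • d) i) * d i) s := by
    rw [hasDerivAt_pi]
    intro i
    refine HasDerivAt.exp ?_
    simpa using ((hasDerivAt_id s).mul_const (d i)).const_add (y i)
  refine (hU.hasFDerivAt.comp_hasDerivAt s h1).congr_deriv ?_
  simp_rw [pderiv_eq_fderiv hU]
  conv_lhs => rw [pi_eq_sum_univ' fun i => Real.exp ((y + s • d) i) * d i]
  rw [map_sum]
  refine Finset.sum_congr rfl fun j _ => ?_
  rw [map_smul, smul_eq_mul]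

theorem exp_mem_posOrthant (y : Fin n → ℝ) : (fun i => Real.exp (y i)) ∈ posOrthant n :=
  fun _ => Real.exp_pos _

variable {ρ : Matrix (Fin n) (Fin n) ℝ} {σ q : Fin n → ℝ} {r K T : ℝ}
  {V : (Fin n → ℝ) → ℝ → ℝ}

namespace SolvesBlackScholes

/-- In log-prices the Black-Scholes equation has constant coefficients. -/
theorem hasGeneratorAt (hV : SolvesBlackScholes ρ σ q r K T V) {B : Matrix (Fin n) (Fin n) ℝ}
    (hB : ∀ i j, covMatrix ρ σ i j = ∑ k, B k i * B k j) (hρ : ∀ i, ρ i i = 1)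
    (y : Fin n → ℝ) {t : ℝ} (ht : t ∈ Set.Ioo 0 T) :
    HasGeneratorAt B (riskNeutralDrift r q σ) r
      (fun y t => V (fun i => Real.exp (y i)) t) y t 0 := by
  have hC := hV.contDiffOn t ht
  have hU : ∀ x ∈ posOrthant n, DifferentiableAt ℝ (fun S => V S t) x := fun x hx =>
    (hC.differentiableOn (by norm_num)).differentiableAt (isOpen_posOrthant.mem_nhds hx)
  set S : Fin n → ℝ := fun i => Real.exp (y i) with hS
  set D : Fin n → (Fin n → ℝ) → ℝ := fun j x => pderiv j (fun S => V S t) x with hD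
  have hD1 : ∀ j, ∀ x ∈ posOrthant n, DifferentiableAt ℝ (D j) x := fun j x hx =>
    differentiableAt_pderiv hC j hx
  have hg : ∀ (d : Fin n → ℝ) (s : ℝ), HasDerivAt
      (fun s : ℝ => V (fun i => Real.exp ((y + s • d) i)) t)
      (∑ j, Real.exp ((y + s • d) j) * d j * D j fun i => Real.exp ((y + s • d) i)) s :=
    fun d s => hasDerivAt_comp_exp_line (U := fun S => V S t) y d s (hU _ (exp_mem_posOrthant _))
  have hh : ∀ d : Fin n → ℝ, HasDerivAt
      (fun s : ℝ => ∑ j, Real.exp ((y + s • d) j) * d j * D j fun i => Real.exp ((y + s • d) i))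
      (∑ j, (S j * d j * d j * D j S + S j * d j * ∑ i, S i * d i * pderiv i (D j) S)) 0 := by
    intro d
    refine HasDerivAt.fun_sum fun j _ => ?_
    have h1 : HasDerivAt (fun s : ℝ => Real.exp ((y + s • d) j) * d j) (S j * d j * d j) 0 := by
      have h2 : HasDerivAt (fun s : ℝ => (y + s • d) j) (d j) 0 := by
        simpa using ((hasDerivAt_id (0 : ℝ)).mul_const (d j)).const_add (y j)
      simpa [hS] using h2.exp.mul_const (d j)
    have h3 := hasDerivAt_comp_exp_line (U := D j) y d 0 (hD1 j _ (exp_mem_posOrthant _))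
    have h4 := h1.fun_mul h3
    simpa [hS] using h4
  refine ⟨deriv (V S) t, ∑ j, S j * riskNeutralDrift r q σ j * D j S, _, _,
    (hV.differentiableAt S (exp_mem_posOrthant y) t ht).hasDerivAt, ?_,
    fun k => Eventually.of_forall (hg (B k)), fun k => hh (B k), ?_⟩
  · simpa [hS] using hg (riskNeutralDrift r q σ) 0
  · have heq := hV.equation S (exp_mem_posOrthant y) t ht
    have h1 : ∑ k, ∑ j, (S j * B k j * B k j * D j S
          + S j * B k j * ∑ i, S i * B k i * pderiv i (D j) S)
        = ∑ j, σ j ^ 2 * S j * D j S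
          + ∑ i, ∑ j, ρ i j * σ i * σ j * S i * S j * pderiv i (D j) S := by
      rw [Finset.sum_comm]
      simp_rw [Finset.sum_add_distrib]
      congr 1
      · refine Finset.sum_congr rfl fun j _ => ?_
        have h2 := hB j j
        simp only [covMatrix, Matrix.of_apply, hρ, one_mul] at h2
        rw [sq, h2, Finset.sum_mul, Finset.sum_mul]
        exact Finset.sum_congr rfl fun k _ => by ring
      · rw [Finset.sum_comm (γ := Fin n)
          (f := fun i j => ρ i j * σ i * σ j * S i * S j * pderiv i (D j) S)]
        refine Finset.sum_congr rfl fun j _ => ?_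
        simp_rw [Finset.mul_sum]
        rw [Finset.sum_comm]
        refine Finset.sum_congr rfl fun i _ => ?_
        have h2 := hB i j
        simp only [covMatrix, Matrix.of_apply] at h2
        rw [h2, Finset.sum_mul, Finset.sum_mul, Finset.sum_mul]
        exact Finset.sum_congr rfl fun k _ => by ring
    have h3 : ∑ j, S j * riskNeutralDrift r q σ j * D j S
        = ∑ j, (r - q j) * S j * D j S - 1 / 2 * ∑ j, σ j ^ 2 * S j * D j S := by
      rw [Finset.mul_sum, ← Finset.sum_sub_distrib]
      refine Finset.sum_congr rfl fun j _ => ?_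
      rw [riskNeutralDrift]
      ring
    rw [h1, h3, smul_eq_mul, smul_eq_mul]
    linarith

/-- A solution is bounded: it is continuous, and small outside of a compact set. -/
theorem exists_abs_le (hV : SolvesBlackScholes ρ σ q r K T V) :
    ∃ M : ℝ, ∀ S : Fin n → ℝ, (∀ i, 0 ≤ S i) → ∀ t ∈ Set.Icc 0 T, |V S t| ≤ M := by
  obtain ⟨R, hR⟩ := hV.tendsto_zero 1 one_pos
  have hsub : (Set.Icc 0 fun _ : Fin n => R) ×ˢ Set.Icc 0 T
      ⊆ {S : Fin n → ℝ | ∀ i, 0 ≤ S i} ×ˢ Set.Icc 0 T :=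
    Set.prod_mono_left fun S hS => hS.1
  obtain ⟨C, hC⟩ := (isCompact_Icc.prod isCompact_Icc).exists_bound_of_continuousOn
    (hV.continuousOn.mono hsub)
  refine ⟨max C 1, fun S hS t ht => ?_⟩
  rcases le_total R ‖S‖ with h | h
  · exact (hR S hS h t ht).trans (le_max_right _ _)
  · refine (hC (S, t) ⟨⟨hS, fun i => ?_⟩, ht⟩).trans (le_max_left _ _)
    exact (le_abs_self _).trans ((norm_le_pi_norm S i).trans h)

theorem continuousOn_exp (hV : SolvesBlackScholes ρ σ q r K T V) :
    ContinuousOn (fun p : (Fin n → ℝ) × ℝ => V (fun i => Real.exp (p.1 i)) p.2)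
      (Set.univ ×ˢ Set.Icc 0 T) :=
  hV.continuousOn.comp (f := fun p : (Fin n → ℝ) × ℝ => (fun i => Real.exp (p.1 i), p.2))
    (by fun_prop) fun p hp => ⟨fun i => (Real.exp_pos _).le, hp.2⟩

end SolvesBlackScholes

open scoped MatrixOrder in
/-- A covariance matrix is of the form `BᵀB`. -/
theorem IsCorrelatedBrownian.exists_covMatrix_eq {Ω : Type*} [MeasurableSpace Ω] {P : Measure Ω}
    {W : Fin n → ℝ≥0 → Ω → ℝ} (hW : IsCorrelatedBrownian W ρ P) (σ : Fin n → ℝ) :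
    ∃ B : Matrix (Fin n) (Fin n) ℝ, ∀ i j, covMatrix ρ σ i j = ∑ k, B k i * B k j := by
  have hZ := hW.isCenteredGaussian σ 1
  rw [NNReal.coe_one, one_smul] at hZ
  have hM : (covMatrix ρ σ).PosSemidef := by
    refine Matrix.PosSemidef.of_dotProduct_mulVec_nonneg ?_ fun x => ?_
    · ext i j
      simpa using hZ.symm j i
    · refine (hZ.sum_mul_nonneg x).trans_eq ?_
      simp only [dotProduct, Matrix.mulVec, star_trivial, Finset.mul_sum]
      exact Finset.sum_congr rfl fun i _ => Finset.sum_congr rfl fun j _ => by ring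
  obtain ⟨B, hB⟩ := CStarAlgebra.nonneg_iff_eq_star_mul_self.mp hM.nonneg
  refine ⟨B, fun i j => ?_⟩
  rw [hB, Matrix.mul_apply]
  rfl

end LogPrices

/-! ### Solutions of the Black-Scholes problem are prices -/

section Comparison

variable {Ω : Type*} [MeasurableSpace Ω] {P : Measure Ω} {n : ℕ}
  {ρ : Matrix (Fin n) (Fin n) ℝ} {W : Fin n → ℝ≥0 → Ω → ℝ}

theorem continuous_putPayoff (K : ℝ) : Continuous (putPayoff K : (Fin n → ℝ) → ℝ) := by
  unfold putPayoff
  fun_prop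

open Complex in
/-- The trigonometric sum `∑ₘ cₘ e^{i ω m·y}` in the log-prices, propagated backwards over a time to
maturity `τ` by the Black-Scholes equation. -/
noncomputable def trigSolution (C : Matrix (Fin n) (Fin n) ℝ) (μ : Fin n → ℝ) (r : ℝ)
    (s : Finset (Fin n → ℤ)) (c : (Fin n → ℤ) → ℂ) (ω : ℝ) (y : Fin n → ℝ) (τ : ℝ) : ℝ :=
  (∑ m ∈ s, c m * cexp (∑ j, I * (ω * m j : ℝ) * y j
    + -(r + charExponent C μ fun j => ((ω * m j : ℝ) : ℂ)) * (τ : ℂ))).re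

variable {μ : Fin n → ℝ} {r : ℝ} {s : Finset (Fin n → ℤ)} {c : (Fin n → ℤ) → ℂ} {ω : ℝ}

theorem continuous_trigSolution (C : Matrix (Fin n) (Fin n) ℝ) :
    Continuous fun p : (Fin n → ℝ) × ℝ => trigSolution C μ r s c ω p.1 p.2 := by
  unfold trigSolution
  refine Complex.continuous_re.comp (continuous_finsetSum _ fun m _ => ?_)
  fun_prop

open Complex in
theorem exists_abs_trigSolution_le (C : Matrix (Fin n) (Fin n) ℝ) (T : ℝ) :
    ∃ M : ℝ, ∀ y, ∀ τ ∈ Set.Icc 0 T, |trigSolution C μ r s c ω y τ| ≤ M := by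
  refine ⟨∑ m ∈ s, ‖c m‖ *
    Real.exp (|(-(r + charExponent C μ fun j => ((ω * m j : ℝ) : ℂ))).re| * T), fun y τ hτ => ?_⟩
  refine (abs_re_le_norm _).trans ((norm_sum_le _ _).trans (Finset.sum_le_sum fun m _ => ?_))
  rw [norm_mul, norm_exp]
  refine mul_le_mul_of_nonneg_left (Real.exp_le_exp.2 ?_) (norm_nonneg _)
  have h1 : (∑ j, I * (ω * m j : ℝ) * (y j : ℂ)).re = 0 := by
    rw [re_sum]
    exact Finset.sum_eq_zero fun j _ => by simp [-ofReal_mul]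
  rw [add_re, h1, zero_add, re_mul_ofReal]
  exact mul_le_mul (le_abs_self _) hτ.2 hτ.1 (abs_nonneg _)

open Complex in
theorem hasGeneratorAt_trigSolution {C B : Matrix (Fin n) (Fin n) ℝ}
    (hB : ∀ i j, C i j = ∑ k, B k i * B k j) (T : ℝ) (y : Fin n → ℝ) (t : ℝ) :
    HasGeneratorAt B μ r (fun y t => trigSolution C μ r s c ω y (T - t)) y t 0 := by
  have hval : ∀ u : Fin n → ℂ, charExponent C μ u
      + 1 / 2 * ∑ k, (∑ j, I * u j * B k j) ^ 2 + ∑ j, I * u j * μ j = 0 := by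
    intro u
    have h1 : ∑ k, (∑ j, I * u j * B k j) ^ 2 = -∑ i, ∑ j, (C i j : ℂ) * u i * u j := by
      simp_rw [hB, sq, Finset.sum_mul_sum]
      rw [Finset.sum_comm, ← Finset.sum_neg_distrib]
      refine Finset.sum_congr rfl fun i _ => ?_
      rw [Finset.sum_comm, ← Finset.sum_neg_distrib]
      refine Finset.sum_congr rfl fun j _ => ?_
      push_cast
      rw [Finset.sum_mul, Finset.sum_mul, ← Finset.sum_neg_distrib]
      refine Finset.sum_congr rfl fun k _ => ?_
      linear_combination (u i * u j * B k i * B k j) * I_sq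
    have h2 : ∑ j, I * u j * μ j = I * ∑ j, (μ j : ℂ) * u j := by
      rw [Finset.mul_sum]
      exact Finset.sum_congr rfl fun j _ => by ring
    rw [h1, h2, charExponent]
    ring
  have h := (HasGeneratorAt.sum s fun m _ =>
    (HasGeneratorAt.complex_exp B μ r T (fun j => I * (ω * m j : ℝ))
      (-(r + charExponent C μ fun j => ((ω * m j : ℝ) : ℂ))) y t).clm_comp
        (c m • ContinuousLinearMap.id ℝ ℂ)).clm_comp reCLM
  have h0 : ∀ m : Fin n → ℤ, - -((r : ℂ) + charExponent C μ fun j => ((ω * m j : ℝ) : ℂ))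
      + 1 / 2 * ∑ k, (∑ j, I * (ω * m j : ℝ) * B k j) ^ 2 + ∑ j, I * (ω * m j : ℝ) * μ j - r
      = 0 := fun m => by
    linear_combination hval fun j => ((ω * m j : ℝ) : ℂ)
  simp only [h0, zero_mul, map_zero, Finset.sum_const_zero] at h
  exact h

/-- By the maximum principle, a solution of the Black-Scholes problem is close to a trigonometric
solution whose terminal value is close to the payoff. -/
theorem SolvesBlackScholes.abs_sub_trigSolution_le {σ q : Fin n → ℝ} {K T ε lam : ℝ}
    {V : (Fin n → ℝ) → ℝ → ℝ} (hV : SolvesBlackScholes ρ σ q r K T V)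
    {B : Matrix (Fin n) (Fin n) ℝ} (hB : ∀ i j, covMatrix ρ σ i j = ∑ k, B k i * B k j)
    (hρ : ∀ i, ρ i i = 1) (hr : 0 ≤ r) (hε : 0 < ε) (hlam0 : 0 ≤ lam)
    (hlam : ∀ (y : Fin n → ℝ) (t : ℝ), ∃ v < 0, HasGeneratorAt B (riskNeutralDrift r q σ) r
      (fun y t => Real.exp (lam * (T - t)) * expWeight y) y t v)
    (hs : ∀ y : Fin n → ℝ, |trigSolution (covMatrix ρ σ) (riskNeutralDrift r q σ) r s c ω y 0
      - putPayoff K (fun j => Real.exp (y j))| ≤ ε * expWeight y)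
    (y : Fin n → ℝ) {t : ℝ} (ht : t ∈ Set.Icc 0 T) :
    |V (fun i => Real.exp (y i)) t
      - trigSolution (covMatrix ρ σ) (riskNeutralDrift r q σ) r s c ω y (T - t)|
      ≤ ε * (Real.exp (lam * (T - t)) * expWeight y) := by
  obtain ⟨M₁, hM₁⟩ := hV.exists_abs_le
  obtain ⟨M₂, hM₂⟩ := exists_abs_trigSolution_le (μ := riskNeutralDrift r q σ) (r := r) (s := s)
    (c := c) (ω := ω) (covMatrix ρ σ) T
  have hτ : ∀ t ∈ Set.Icc 0 T, T - t ∈ Set.Icc 0 T := fun t ht =>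
    ⟨by linarith [ht.2], by linarith [ht.1]⟩
  have h1 := fun (y : Fin n → ℝ) t ht =>
    abs_le.1 (hM₁ (fun i => Real.exp (y i)) (fun i => (Real.exp_pos _).le) t ht)
  have h2 := fun y t ht => abs_le.1 (hM₂ y (T - t) (hτ t ht))
  have hgV := fun y t ht => hV.hasGeneratorAt hB hρ (t := t) y ht
  have hgu := fun y t => hasGeneratorAt_trigSolution (μ := riskNeutralDrift r q σ) (r := r)
    (s := s) (c := c) (ω := ω) hB T y t
  have hcu : ContinuousOn (fun p : (Fin n → ℝ) × ℝ => trigSolution (covMatrix ρ σ)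
      (riskNeutralDrift r q σ) r s c ω p.1 (T - p.2)) (Set.univ ×ˢ Set.Icc 0 T) :=
    ((continuous_trigSolution _).comp (f := fun p : (Fin n → ℝ) × ℝ => (p.1, T - p.2))
      (by fun_prop)).continuousOn
  have hVT : ∀ y : Fin n → ℝ,
      V (fun i => Real.exp (y i)) T = putPayoff K fun i => Real.exp (y i) :=
    fun y => hV.terminal _ fun i => (Real.exp_pos _).le
  rw [abs_le']
  constructor
  · refine le_of_hasGeneratorAt_zero_of_mem_Icc
      (f := fun y t => V (fun i => Real.exp (y i)) t - trigSolution (covMatrix ρ σ)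
        (riskNeutralDrift r q σ) r s c ω y (T - t)) (M := M₁ + M₂) hr hε hlam0 hlam
      (fun y t ht => ?_) (hV.continuousOn_exp.sub hcu) (fun y t ht => ?_) (fun y => ?_) y ht
    · linarith [(h1 y t ht).2, (h2 y t ht).1]
    · simpa using (hgV y t ht).sub (hgu y t)
    · rw [sub_self, hVT]
      linarith [(abs_le.1 (hs y)).1]
  · refine le_of_hasGeneratorAt_zero_of_mem_Icc
      (f := fun y t => -(V (fun i => Real.exp (y i)) t - trigSolution (covMatrix ρ σ)
        (riskNeutralDrift r q σ) r s c ω y (T - t))) (M := M₁ + M₂) hr hε hlam0 hlam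
      (fun y t ht => ?_) (hV.continuousOn_exp.sub hcu).neg (fun y t ht => ?_) (fun y => ?_) y ht
    · linarith [(h1 y t ht).1, (h2 y t ht).2]
    · simpa using ((hgV y t ht).sub (hgu y t)).neg
    · rw [sub_self, hVT]
      linarith [(abs_le.1 (hs y)).2]

theorem driftedBrownian_sub {Ω : Type*} (W : Fin n → ℝ≥0 → Ω → ℝ) (μ σ : Fin n → ℝ)
    (t T : ℝ≥0) (a : Ω) (j : Fin n) : driftedBrownian W μ σ T a j - driftedBrownian W μ σ t a j
      = μ j * ((T : ℝ) - t) + σ j * (W j T a - W j t a) := by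
  rw [driftedBrownian, driftedBrownian]
  ring

theorem aemeasurable_increment (hW : IsCorrelatedBrownian W ρ P) (μ σ : Fin n → ℝ)
    (t T : ℝ≥0) (j : Fin n) :
    AEMeasurable (fun a => driftedBrownian W μ σ T a j - driftedBrownian W μ σ t a j) P := by
  simp_rw [driftedBrownian_sub]
  exact (((hW.memLp_two j T).aestronglyMeasurable.aemeasurable.sub
    (hW.memLp_two j t).aestronglyMeasurable.aemeasurable).const_mul _).const_add _

theorem integrable_exp_mul_sum_abs_increment (hW : IsCorrelatedBrownian W ρ P) (μ σ : Fin n → ℝ)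
    {t T : ℝ≥0} (htT : t ≤ T) (m : ℝ) :
    Integrable (fun a => Real.exp (m * ∑ j,
      |driftedBrownian W μ σ T a j - driftedBrownian W μ σ t a j|)) P := by
  have h1 := ((hW.isCenteredGaussian_sub σ htT).integrable_exp_mul_sum_abs |m|).const_mul
    (Real.exp (|m| * ∑ j, |μ j * ((T : ℝ) - t)|))
  refine h1.mono' ?_ (Eventually.of_forall fun a => ?_)
  · have := aemeasurable_increment hW μ σ t T
    exact AEMeasurable.aestronglyMeasurable (by fun_prop)
  · rw [Real.norm_of_nonneg (Real.exp_pos _).le, ← Real.exp_add, Real.exp_le_exp, ← mul_add,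
      ← Finset.sum_add_distrib]
    refine mul_le_mul (le_abs_self m) (Finset.sum_le_sum fun j _ => ?_)
      (Finset.sum_nonneg fun j _ => abs_nonneg _) (abs_nonneg _)
    rw [driftedBrownian_sub]
    exact abs_add_le _ _

open Complex in
/-- The discounted expectation of a trigonometric sum is the corresponding trigonometric
solution. -/
theorem integral_trigSolution_zero (hW : IsCorrelatedBrownian W ρ P) (σ : Fin n → ℝ)
    (y : Fin n → ℝ) {t T : ℝ≥0} (htT : t ≤ T) :
    Integrable (fun a => trigSolution (covMatrix ρ σ) μ r s c ω (fun j => y j +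
      (driftedBrownian W μ σ T a j - driftedBrownian W μ σ t a j)) 0) P ∧
    Real.exp (-(r * ((T : ℝ) - t))) * ∫ a, trigSolution (covMatrix ρ σ) μ r s c ω (fun j => y j +
      (driftedBrownian W μ σ T a j - driftedBrownian W μ σ t a j)) 0 ∂P
      = trigSolution (covMatrix ρ σ) μ r s c ω y ((T : ℝ) - t) := by
  have heq : ∀ a, trigSolution (covMatrix ρ σ) μ r s c ω (fun j => y j +
      (driftedBrownian W μ σ T a j - driftedBrownian W μ σ t a j)) 0
      = reCLM (∑ m ∈ s, c m * cexp (∑ j, I * (ω * m j : ℝ) * y j) *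
        cexp (I * ∑ j, ((ω * m j : ℝ) : ℂ) *
          ((driftedBrownian W μ σ T a j - driftedBrownian W μ σ t a j : ℝ) : ℂ))) := by
    intro a
    rw [trigSolution, reCLM_apply]
    congr 1
    refine Finset.sum_congr rfl fun m _ => ?_
    rw [mul_assoc, ← Complex.exp_add, ofReal_zero, mul_zero, add_zero, Finset.mul_sum,
      ← Finset.sum_add_distrib]
    congr 2
    refine Finset.sum_congr rfl fun j _ => ?_
    push_cast
    ring
  have hint : ∀ m ∈ s, Integrable (fun a => c m * cexp (∑ j, I * (ω * m j : ℝ) * y j) *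
        cexp (I * ∑ j, ((ω * m j : ℝ) : ℂ) *
          ((driftedBrownian W μ σ T a j - driftedBrownian W μ σ t a j : ℝ) : ℂ))) P :=
    fun m _ => (charFn_increment hW μ σ (fun j => ((ω * m j : ℝ) : ℂ)) htT).1.const_mul _
  simp_rw [heq]
  refine ⟨reCLM.integrable_comp (integrable_finsetSum s hint), ?_⟩
  rw [reCLM.integral_comp_comm (integrable_finsetSum s hint), integral_finsetSum s hint,
    reCLM_apply, ← re_ofReal_mul, trigSolution, Finset.mul_sum]
  congr 1
  refine Finset.sum_congr rfl fun m _ => ?_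
  rw [integral_const_mul, (charFn_increment hW μ σ (fun j => ((ω * m j : ℝ) : ℂ)) htT).2,
    (charFn_driftedBrownian hW μ σ _ (T - t)).2, ofReal_exp, mul_left_comm, mul_assoc,
    ← Complex.exp_add, ← Complex.exp_add]
  congr 2
  rw [NNReal.coe_sub htT]
  push_cast
  ring

theorem integrable_expWeight_increment (hW : IsCorrelatedBrownian W ρ P) (μ σ : Fin n → ℝ)
    (y : Fin n → ℝ) {t T : ℝ≥0} (htT : t ≤ T) :
    Integrable (fun a => expWeight fun j => y j +
      (driftedBrownian W μ σ T a j - driftedBrownian W μ σ t a j)) P := by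
  have := hW.gaussian.isProbabilityMeasure
  have hm := aemeasurable_increment hW μ σ t T
  have hint := (integrable_exp_mul_sum_abs_increment hW μ σ htT 1).const_mul
    (Real.exp (∑ j, |y j|))
  have hle : ∀ (a : Ω) (j : Fin n) (x : ℝ),
      x ≤ |y j + (driftedBrownian W μ σ T a j - driftedBrownian W μ σ t a j)| →
      ‖Real.exp x‖ ≤ Real.exp (∑ j, |y j|) * Real.exp (1 * ∑ j,
        |driftedBrownian W μ σ T a j - driftedBrownian W μ σ t a j|) := by
    intro a j x hx
    rw [Real.norm_of_nonneg (Real.exp_pos _).le, ← Real.exp_add, Real.exp_le_exp, one_mul]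
    refine hx.trans ((abs_add_le _ _).trans (add_le_add ?_ ?_))
    · exact Finset.single_le_sum (f := fun j => |y j|) (fun _ _ => abs_nonneg _)
        (Finset.mem_univ j)
    · exact Finset.single_le_sum
        (f := fun j => |driftedBrownian W μ σ T a j - driftedBrownian W μ σ t a j|)
        (fun _ _ => abs_nonneg _) (Finset.mem_univ j)
  unfold expWeight
  refine (integrable_const 1).add (integrable_finsetSum _ fun j _ => ?_)
  refine (hint.mono' ?_ (Eventually.of_forall fun a => hle a j _ (le_abs_self _))).add
    (hint.mono' ?_ (Eventually.of_forall fun a => hle a j _ (neg_le_abs _)))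
  · exact AEMeasurable.aestronglyMeasurable (by fun_prop)
  · exact AEMeasurable.aestronglyMeasurable (by fun_prop)

theorem abs_europeanPutPrice_sub_trigSolution_le (hW : IsCorrelatedBrownian W ρ P)
    (σ : Fin n → ℝ) {K ε : ℝ} (hr : 0 ≤ r)
    (hs : ∀ y : Fin n → ℝ, |trigSolution (covMatrix ρ σ) μ r s c ω y 0
      - putPayoff K (fun j => Real.exp (y j))| ≤ ε * expWeight y)
    (y : Fin n → ℝ) {t T : ℝ≥0} (htT : t ≤ T) :
    |europeanPutPrice P (driftedBrownian W μ σ) K r T (fun i => Real.exp (y i)) t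
      - trigSolution (covMatrix ρ σ) μ r s c ω y ((T : ℝ) - t)|
      ≤ ε * ∫ a, expWeight (fun j => y j +
        (driftedBrownian W μ σ T a j - driftedBrownian W μ σ t a j)) ∂P := by
  have := hW.gaussian.isProbabilityMeasure
  obtain ⟨hu, hu'⟩ := integral_trigSolution_zero (μ := μ) (r := r) (s := s) (c := c) (ω := ω)
    hW σ y htT
  have hw := (integrable_expWeight_increment hW μ σ y htT).const_mul ε
  have hbound : ∀ a, |trigSolution (covMatrix ρ σ) μ r s c ω (fun j => y j +
      (driftedBrownian W μ σ T a j - driftedBrownian W μ σ t a j)) 0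
      - putPayoff K (fun i => Real.exp (y i) *
        Real.exp (driftedBrownian W μ σ T a i - driftedBrownian W μ σ t a i))|
      ≤ ε * expWeight (fun j => y j +
        (driftedBrownian W μ σ T a j - driftedBrownian W μ σ t a j)) := by
    intro a
    simp_rw [← Real.exp_add]
    exact hs _
  have hp : Integrable (fun a => putPayoff K (fun i => Real.exp (y i) *
      Real.exp (driftedBrownian W μ σ T a i - driftedBrownian W μ σ t a i))) P := by
    refine (integrable_const (max K 0)).mono' ?_ (Eventually.of_forall fun a => ?_)
    · have hm := aemeasurable_increment hW μ σ t T
      exact ((continuous_putPayoff K).measurable.comp_aemeasurable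
        (aemeasurable_pi_lambda _ fun j => by fun_prop)).aestronglyMeasurable
    · rw [putPayoff, Real.norm_of_nonneg (le_max_right _ _)]
      refine max_le_max ?_ le_rfl
      have : 0 ≤ ∑ i, Real.exp (y i) *
          Real.exp (driftedBrownian W μ σ T a i - driftedBrownian W μ σ t a i) :=
        Finset.sum_nonneg fun i _ => by positivity
      linarith
  have hdisc : Real.exp (-(r * ((T : ℝ) - t))) ≤ 1 := by
    rw [Real.exp_le_one_iff, neg_nonpos]
    exact mul_nonneg hr (sub_nonneg.2 htT)
  rw [abs_sub_comm, ← hu', europeanPutPrice, ← mul_sub, ← integral_sub hu hp, abs_mul,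
    abs_of_pos (Real.exp_pos _), ← integral_const_mul]
  refine (mul_le_of_le_one_left (abs_nonneg _) hdisc).trans ?_
  rw [← Real.norm_eq_abs]
  exact norm_integral_le_of_norm_le hw (Eventually.of_forall fun a =>
    (Real.norm_eq_abs _).trans_le (hbound a))

/-- A solution of the Black-Scholes problem is the discounted expectation of the payoff. -/
theorem SolvesBlackScholes.eq_europeanPutPrice (hW : IsCorrelatedBrownian W ρ P) {σ q : Fin n → ℝ}
    {K : ℝ} {t T : ℝ≥0} (hr : 0 ≤ r) (hK : 0 < K) {V : (Fin n → ℝ) → ℝ → ℝ}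
    (hV : SolvesBlackScholes ρ σ q r K T V) (htT : t ≤ T) {S : Fin n → ℝ}
    (hS : S ∈ posOrthant n) :
    V S t = europeanPutPrice P (driftedBrownian W (riskNeutralDrift r q σ) σ) K r T S t := by
  set y : Fin n → ℝ := fun i => Real.log (S i) with hy
  have hSy : S = fun i => Real.exp (y i) := funext fun i => (Real.exp_log (hS i)).symm
  obtain ⟨B, hB⟩ := hW.exists_covMatrix_eq σ
  obtain ⟨lam, hlam0, hlam⟩ := exists_expWeight_supersolution B (riskNeutralDrift r q σ) hr T
  rw [hSy, ← sub_eq_zero, ← abs_nonpos_iff]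
  set A : ℝ := Real.exp (lam * ((T : ℝ) - t)) * expWeight y + ∫ a, expWeight (fun j => y j +
    (driftedBrownian W (riskNeutralDrift r q σ) σ T a j
      - driftedBrownian W (riskNeutralDrift r q σ) σ t a j)) ∂P with hA
  have hA0 : 0 ≤ A := add_nonneg (mul_nonneg (Real.exp_pos _).le (expWeight_pos y).le)
    (integral_nonneg fun a => (expWeight_pos _).le)
  refine le_of_forall_pos_le_add fun δ hδ => ?_
  have hε : 0 < δ / (A + 1) := by positivity
  obtain ⟨s, c, ω, hs⟩ := exists_trigSum_approx_putPayoff (n := n) hK hε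
  have hs' : ∀ y : Fin n → ℝ, |trigSolution (covMatrix ρ σ) (riskNeutralDrift r q σ) r s c ω y 0
      - putPayoff K (fun j => Real.exp (y j))| ≤ δ / (A + 1) * expWeight y := by
    intro y
    simpa only [trigSolution, Complex.ofReal_zero, mul_zero, add_zero] using hs y
  have h1 := hV.abs_sub_trigSolution_le hB hW.corr_self hr hε hlam0 hlam hs' y
    (t := t) ⟨t.2, htT⟩
  have h2 := abs_europeanPutPrice_sub_trigSolution_le hW σ hr hs' y htT
  rw [abs_sub_comm] at h2
  refine (abs_sub_le _ _ _).trans ((add_le_add h1 h2).trans ?_)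
  rw [zero_add, ← mul_add, ← hA, div_mul_eq_mul_div, div_le_iff₀ (by positivity)]
  nlinarith

end Comparison

end BasketOption

/-! ### The Mellin transform pricing formula -/

open BasketOption in
theorem mainTheorem1 {Ω : Type*} [MeasurableSpace Ω] (P : Measure Ω) [IsProbabilityMeasure P]
    (n : ℕ) (hn : 0 < n)
    (ρ : Matrix (Fin n) (Fin n) ℝ) (W : Fin n → ℝ≥0 → Ω → ℝ) (hW : IsCorrelatedBrownian W ρ P)
    (σ q : Fin n → ℝ) (hσ : ∀ i, 0 ≤ σ i) (hq : ∀ i, 0 ≤ q i)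
    (r K : ℝ) (hr : 0 ≤ r) (hK : 0 < K)
    (μ : Fin n → ℝ) (hμ : μ = riskNeutralDrift r q σ)
    (X : ℝ≥0 → Ω → Fin n → ℝ) (hX : X = driftedBrownian W μ σ) :
    -- the Mellin transform of the payoff
    (∀ w : Fin n → ℂ, (∀ j, 0 < (w j).re) →
      MellinTransformConvergent (fun S => (putPayoff K S : ℂ)) w ∧
      payoffMellin K w =
        multinomialBeta w * (K : ℂ) ^ (1 + ∑ j, w j) / ((∑ j, w j) * (∑ j, w j + 1))) ∧
    -- the characteristic function of the Brownian motion with drift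
    (∀ (u : Fin n → ℂ) (t : ℝ≥0),
      Integrable (fun ω => Complex.exp (Complex.I * ∑ j, u j * (X t ω j : ℂ))) P ∧
      charFn P X u t = Complex.exp (-(t : ℂ) * charExponent (covMatrix ρ σ) μ u)) ∧
    -- the pricing formula
    (∀ (t T : ℝ≥0), t ≤ T → ∀ S ∈ posOrthant n, ∀ a : Fin n → ℝ, (∀ j, 0 < a j) →
      (∃ I : ℂ,
        HasMellinInverse a
          (fun w => payoffMellin K w * charFn P X (fun j => w j * Complex.I) (T - t)) S I ∧
        (europeanPutPrice P X K r T S t : ℂ) = I * Complex.exp (-(r * ((T : ℂ) - t))) ∧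
        ∀ V : (Fin n → ℝ) → ℝ → ℝ, SolvesBlackScholes ρ σ q r K T V →
          (V S t : ℂ) = I * Complex.exp (-(r * ((T : ℂ) - t)))) ∧
      (t < T → (covMatrix ρ σ).PosDef →
        Integrable (mellinInvIntegrand a
          (fun w => payoffMellin K w * charFn P X (fun j => w j * Complex.I) (T - t)) S))) := by
  subst hμ hX
  set μ := riskNeutralDrift r q σ
  set X := driftedBrownian W μ σ with hX
  refine ⟨fun w hw => ⟨mellinTransformConvergent_putPayoff K hw, payoffMellin_eq hn hK hw⟩,
    charFn_driftedBrownian hW μ σ, fun t T htT S hS a ha => ?_⟩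
  have hlap : ∀ w : Fin n → ℂ,
      ∫ ω, Complex.exp (-∑ j, w j * ((X T ω j - X t ω j : ℝ) : ℂ)) ∂P
        = charFn P X (fun j => w j * Complex.I) (T - t) := by
    intro w
    rw [hX, ← (charFn_increment hW μ σ (fun j => w j * Complex.I) htT).2]
    congr 1
    funext ω
    congr 1
    rw [Finset.mul_sum, ← Finset.sum_neg_distrib]
    refine Finset.sum_congr rfl fun j _ => ?_
    linear_combination (-(w j * ((driftedBrownian W μ σ T ω j
      - driftedBrownian W μ σ t ω j : ℝ) : ℂ))) * Complex.I_sq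
  have hprice : (europeanPutPrice P X K r T S t : ℂ)
      = ((∫ ω, putPayoff K (fun i => S i * Real.exp (X T ω i - X t ω i)) ∂P : ℝ) : ℂ)
        * Complex.exp (-(r * ((T : ℂ) - t))) := by
    rw [europeanPutPrice, mul_comm]
    push_cast
    rfl
  refine ⟨⟨((∫ ω, putPayoff K (fun i => S i * Real.exp (X T ω i - X t ω i)) ∂P : ℝ) : ℂ), ?_,
    hprice, fun V hV => ?_⟩, fun hlt hpos => ?_⟩
  · have h := tendsto_integral_box (Y := fun j ω => X T ω j - X t ω j)
      (aemeasurable_increment hW μ σ t T)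
      (integrable_exp_mul_sum_abs_increment hW μ σ htT) K ha hS
    simp_rw [hlap] at h
    exact h
  · rw [← hprice, hV.eq_europeanPutPrice hW hr hK htT hS]
  · have hτ : 0 < ((T - t : ℝ≥0) : ℝ) := NNReal.coe_pos.2 (tsub_pos_of_lt hlt)
    have h := integrable_mellinInvIntegrand_of_posDef K ha hS hpos μ hτ
    simp_rw [hX, fun w : Fin n → ℂ => (charFn_driftedBrownian hW μ σ w (T - t)).2]
    exact h
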